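/- Let $G\rightrightarrows M$ be a Lie groupoid with source $s$ and target $t$ (smooth maps, $s,t$ submersions; $gh$ is defined when $s(g)=t(h)$), where $G$ and $M$ are finite-dimensional manifolds without boundary and $M$ is Hausdorff. Let $V\to M$ be a finite-rank smooth real vector bundle with a representation of $G$, i.e. a smooth action $(g,v)\mapsto g\cdot v$, linear $V_{s(g)}\to V_{t(g)}$, with $1_x\cdot v=v$ and $g\cdot(h\cdot v)=(gh)\cdot v$, and let $\nabla$ be a smooth connection on $V$. Let $G^{(0)}=M$ and let $G^{(p)}$, $p\ge 1$, be the manifold of strings $(g_1,\dots,g_p)$ with $s(g_i)=t(g_{i+1})$. Put $\pi_0=\mathrm{id}_M$ and $\pi_p(g_1,\dots,g_p)=s(g_p)$ for $p\geq 1$, and let $\mathrm{pr}_{p}(g_1,\dots,g_{p})=g_{p}$. Let $\Omega^{p,q}(G;V)=\Omega^q(G^{(p)};\pi_p^*V)$. Let $f_i\colon G^{(p+1)}\to G^{(p)}$ $(0\le i\le p+1)$ be the face maps: $f_0$ omits $g_1$, $f_i$ for $1\le i\le p$ replaces $g_i,g_{i+1}$ by $g_ig_{i+1}$, and $f_{p+1}$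 omits $g_{p+1}$ (for $p=0$: $f_0=s$, $f_1=t$). The simplicial differential is $$\delta\colon\Omega^{p,q}(G;V)\to\Omega^{p+1,q}(G;V),\qquad \delta=\sum_{i=0}^{p}(-1)^i f_i^*+(-1)^{p+1}\Phi_*f_{p+1}^*,$$ where $\Phi_*$ acts on values by $v\mapsto g_{p+1}^{-1}\cdot v$; in particular $(\delta\gamma)_g=(s^*\gamma)_g-g^{-1}\cdot(t^*\gamma)_g$ for $p=0$. Let $d^\nabla\colon\Omega^{p,q}(G;V)\to\Omega^{p,q+1}(G;V)$ be the exterior covariant derivative of the pullback connection $\nabla^{\pi_p}$. The forms in $\ker(\delta\colon\Omega^{1,q}(G;V)\to\Omega^{2,q}(G;V))$ are called multiplicative. Let $\phi\colon t^*V\to s^*V$, $\phi(g,v)=(g,g^{-1}\cdot v)$, and let $\nabla^t,\nabla^s$ be the pullbacks of $\nabla$ along $t,s\colon G\to M$. Then $\delta$ and $d^\nabla$ map smooth forms to smooth forms, and: 1. There is a unique $1$-form $\Theta$ on $G$ with values in $\operatorname{Hom}(t^*V,s^*V)$ such that $$\Theta(X)\,\xi(g)=\phi(\nabla^t_X\xi)-\nabla^s_X\phi(\xi)$$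 for all $g\in G$, $X\in T_gG$ and all sections $\xi$ of $t^*V$ that are differentiable at $g$; it is smooth, $\Theta\in\Omega^1(G;\operatorname{Hom}(t^*V,s^*V))$. 2. For all $p,q\ge 0$ and $\omega\in\Omega^{p,q}(G;V)$, $$(d^\nabla\delta-\delta d^\nabla)\,\omega=(-1)^p\,\mathrm{pr}_{p+1}^*\Theta\wedge f_{p+1}^*\omega ,$$ that is, for tangent vectors $X_1,\dots,X_{q+1}$ at a point of $G^{(p+1)}$, the left-hand side evaluates to $$(-1)^p\sum_{i=1}^{q+1}(-1)^{i+1}\,\Theta\big(d\,\mathrm{pr}_{p+1}X_i\big)\cdot\omega\big(df_{p+1}X_1,\dots,\widehat{df_{p+1}X_i},\dots,df_{p+1}X_{q+1}\big).$$ For $p=0$ this reads $(d^{\nabla}\delta-\delta d^\nabla)\omega=\Theta\wedge t^*\omega$. 3. $d^\nabla$ is a cochain map, i.e. $d^\nabla\delta=\delta d^\nabla$ on $\Omega^{p,q}(G;V)$ for all $p,q\geq 0$, if and only if $\nabla$ is $G$-invariant, i.e. $\Theta=0$. 4. If $\nabla$ is $G$-invariant, then $d^\nabla$ maps multiplicative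 forms to multiplicative forms. -/

import Mathlib

open Bundle Manifold Set
open scoped ContDiff

set_option linter.unusedSectionVars false

noncomputable section

section Nerves

/-- Two manifolds `G` (arrows) and `M` (objects) with two smooth submersions, the source `src` and
the target `tgt`. All manifolds are modelled on normed spaces, hence have no boundary. -/
structure SubmersiveQuiver (EM : Type*) [NormedAddCommGroup EM] [NormedSpace ℝ EM]
    (M : Type*) [TopologicalSpace M] [ChartedSpace EM M]
    (EG : Type*) [NormedAddCommGroup EG] [NormedSpace ℝ EG]
    (G : Type*) [TopologicalSpace G] [ChartedSpace EG G] where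
  src : C^∞⟮𝓘(ℝ, EG), G; 𝓘(ℝ, EM), M⟯
  tgt : C^∞⟮𝓘(ℝ, EG), G; 𝓘(ℝ, EM), M⟯
  isSubmersion_src : IsSubmersion 𝓘(ℝ, EG) 𝓘(ℝ, EM) ∞ src
  isSubmersion_tgt : IsSubmersion 𝓘(ℝ, EG) 𝓘(ℝ, EM) ∞ tgt

variable {EM : Type*} [NormedAddCommGroup EM] [NormedSpace ℝ EM]
  {M : Type*} [TopologicalSpace M] [ChartedSpace EM M]
  {EG : Type*} [NormedAddCommGroup EG] [NormedSpace ℝ EG]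
  {G : Type*} [TopologicalSpace G] [ChartedSpace EG G]

/-- Composable strings of `p` arrows: objects `x_0, …, x_p` and arrows `g_1, …, g_p` with
`t(g_i) = x_{i-1}` and `s(g_i) = x_i`, so that `s(g_i) = t(g_{i+1})`. For `p = 0` this is `M` (via
`x_0`); for `p ≥ 1` the arrows determine the objects, and this is the set `G^(p)` of composable
`p`-tuples. -/
@[ext]
structure Nerve (Q : SubmersiveQuiver EM M EG G) (p : ℕ) where
  obj : Fin (p + 1) → M
  arr : Fin p → G
  tgt_arr : ∀ i, Q.tgt (arr i) = obj i.castSucc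
  src_arr : ∀ i, Q.src (arr i) = obj i.succ

namespace Nerve

variable {Q : SubmersiveQuiver EM M EG G} {p : ℕ}

/-- The subspace topology. -/
instance : TopologicalSpace (Nerve Q p) :=
  TopologicalSpace.induced (fun c ↦ (c.obj, c.arr)) inferInstance

/-- The last object `x_p`, the source of the last arrow when `p ≥ 1`. -/
def base (c : Nerve Q p) : M := c.obj (Fin.last p)

lemma isInducing_data : Topology.IsInducing (fun c : Nerve Q p ↦ (c.obj, c.arr)) := ⟨rfl⟩

lemma continuous_obj (i : Fin (p + 1)) : Continuous (fun c : Nerve Q p ↦ c.obj i) :=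
  (continuous_apply i).comp (continuous_fst.comp isInducing_data.continuous)

lemma continuous_arr (i : Fin p) : Continuous (fun c : Nerve Q p ↦ c.arr i) :=
  (continuous_apply i).comp (continuous_snd.comp isInducing_data.continuous)

lemma continuousOn_iff {X : Type*} [TopologicalSpace X] {f : X → Nerve Q p} {s : Set X} :
    ContinuousOn f s ↔ (∀ i, ContinuousOn (fun x ↦ (f x).obj i) s) ∧
      ∀ i, ContinuousOn (fun x ↦ (f x).arr i) s := by
  rw [isInducing_data.continuousOn_iff]
  constructor
  · intro h
    exact ⟨fun i ↦ (continuous_apply i).comp_continuousOn (continuous_fst.comp_continuousOn h),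
      fun i ↦ (continuous_apply i).comp_continuousOn (continuous_snd.comp_continuousOn h)⟩
  · rintro ⟨h1, h2⟩
    exact (continuousOn_pi.2 h1).prodMk (continuousOn_pi.2 h2)

/-- The string of length `0` at `x`. -/
def ofObj (x : M) : Nerve Q 0 := ⟨fun _ ↦ x, Fin.elim0, fun i ↦ i.elim0, fun i ↦ i.elim0⟩

/-- Removal of the last arrow. -/
def init (c : Nerve Q (p + 1)) : Nerve Q p :=
  ⟨Fin.init c.obj, Fin.init c.arr, fun i ↦ c.tgt_arr i.castSucc, fun i ↦ c.src_arr i.castSucc⟩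

/-- The string `(g_1, …, g_p, g)`. -/
def snoc (c : Nerve Q p) (g : G) (h : Q.tgt g = c.base) : Nerve Q (p + 1) where
  obj := Fin.snoc (α := fun _ ↦ M) c.obj (Q.src g)
  arr := Fin.snoc (α := fun _ ↦ G) c.arr g
  tgt_arr i := by
    refine Fin.lastCases ?_ (fun j ↦ ?_) i
    · rw [Fin.snoc_last, Fin.snoc_castSucc]; exact h
    · rw [Fin.snoc_castSucc, Fin.snoc_castSucc]; exact c.tgt_arr j
  src_arr i := by
    refine Fin.lastCases ?_ (fun j ↦ ?_) i
    · rw [Fin.snoc_last, Fin.succ_last, Fin.snoc_last]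
    · rw [Fin.snoc_castSucc, Fin.succ_castSucc, Fin.snoc_castSucc]; exact c.src_arr j

lemma init_snoc (c : Nerve Q p) (g : G) (h : Q.tgt g = c.base) : (c.snoc g h).init = c := by
  ext i <;> simp [init, snoc]

lemma base_snoc (c : Nerve Q p) (g : G) (h : Q.tgt g = c.base) :
    (c.snoc g h).base = Q.src g := by simp [base, snoc]

lemma last_snoc (c : Nerve Q p) (g : G) (h : Q.tgt g = c.base) :
    (c.snoc g h).arr (Fin.last p) = g := by simp [snoc]

lemma tgt_last (c : Nerve Q (p + 1)) : Q.tgt (c.arr (Fin.last p)) = c.init.base :=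
  c.tgt_arr (Fin.last p)

lemma snoc_init (c : Nerve Q (p + 1)) {d : Nerve Q p} (hd : d = c.init) {g : G}
    (hg : g = c.arr (Fin.last p)) (h : Q.tgt g = d.base) : d.snoc g h = c := by
  subst hd hg
  ext i
  · refine Fin.lastCases ?_ (fun j ↦ ?_) i
    · simpa [snoc] using c.src_arr (Fin.last p)
    · simp [snoc, init, Fin.init]
  · refine Fin.lastCases ?_ (fun j ↦ ?_) i
    · simp [snoc]
    · simp [snoc, init]

lemma continuous_init : Continuous (init : Nerve Q (p + 1) → Nerve Q p) := by
  rw [← continuousOn_univ, continuousOn_iff]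
  exact ⟨fun i ↦ (continuous_obj i.castSucc).continuousOn,
    fun i ↦ (continuous_arr i.castSucc).continuousOn⟩

lemma continuous_base : Continuous (base : Nerve Q p → M) := continuous_obj _

variable (Q p) in
/-- The model vector space of `G^(p)`: a model of `M` for `x_0` and, for each arrow `g_i`, a model
of the fibre of `t` through `g_i`. -/
abbrev Model : Type _ := EM × (Fin p → Q.isSubmersion_tgt.complement)

/-- The charts of `G^(0) = M`. -/
def chartZero (x : M) : OpenPartialHomeomorph (Nerve Q 0) (Model Q 0) where
  toFun c := (chartAt EM x c.base, 0)
  invFun u := ofObj ((chartAt EM x).symm u.1)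
  source := {c | c.base ∈ (chartAt EM x).source}
  target := {u | u.1 ∈ (chartAt EM x).target}
  map_source' c hc := (chartAt EM x).map_source hc
  map_target' u hu := (chartAt EM x).map_target hu
  left_inv' c hc := by
    ext i
    · rw [Fin.fin_one_eq_zero i]
      exact (chartAt EM x).left_inv hc
    · exact i.elim0
  right_inv' u hu := Prod.ext ((chartAt EM x).right_inv hu) (Subsingleton.elim _ _)
  open_source := (chartAt EM x).open_source.preimage continuous_base
  open_target := (chartAt EM x).open_target.preimage continuous_fst
  continuousOn_toFun := by
    refine ContinuousOn.prodMk ?_ continuousOn_const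
    exact (chartAt EM x).continuousOn.comp continuous_base.continuousOn fun c hc ↦ hc
  continuousOn_invFun := by
    rw [continuousOn_iff]
    refine ⟨fun _ ↦ ?_, fun i ↦ i.elim0⟩
    exact (chartAt EM x).symm.continuousOn.comp continuous_fst.continuousOn fun c hc ↦ hc

/-- A chart of `G` and a chart of `M` in which the submersion `t` is a linear projection. -/
structure SubChart (Q : SubmersiveQuiver EM M EG G) where
  dom : OpenPartialHomeomorph G EG
  cod : OpenPartialHomeomorph M EM
  equiv : EG ≃L[ℝ] EM × Q.isSubmersion_tgt.complement
  dom_mem : dom ∈ IsManifold.maximalAtlas 𝓘(ℝ, EG) ∞ G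
  cod_mem : cod ∈ IsManifold.maximalAtlas 𝓘(ℝ, EM) ∞ M
  maps : ∀ g ∈ dom.source, Q.tgt g ∈ cod.source
  eq : ∀ w ∈ dom.target, cod (Q.tgt (dom.symm w)) = (equiv w).1

/-- Such a pair of charts around `g`. -/
def subChart (g : G) : SubChart Q :=
  have h := Q.isSubmersion_tgt.isSubmersionOfComplement_complement g
  { dom := h.domChart
    cod := h.codChart
    equiv := h.equiv
    dom_mem := h.domChart_mem_maximalAtlas
    cod_mem := h.codChart_mem_maximalAtlas
    maps := fun _ hg ↦ h.source_subset_preimage_source hg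
    eq := fun w hw ↦ by simpa using h.writtenInCharts (by simpa using hw) }

lemma mem_subChart (g : G) : g ∈ (subChart (Q := Q) g).dom.source :=
  (Q.isSubmersion_tgt.isSubmersionOfComplement_complement g).mem_domChart_source

/-- The last arrow of the string with coordinates `u`, obtained from the last object of the shorter
string and the coordinate along the fibre of `t`. -/
def newArr (e : OpenPartialHomeomorph (Nerve Q p) (Model Q p)) (S : SubChart Q)
    (u : Model Q (p + 1)) : G :=
  S.dom.symm (S.equiv.symm (S.cod (e.symm (u.1, Fin.init u.2)).base, u.2 (Fin.last p)))

/-- The set of coordinates of the chart `chartSnoc`. -/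
def snocTarget (e : OpenPartialHomeomorph (Nerve Q p) (Model Q p)) (S : SubChart Q) :
    Set (Model Q (p + 1)) :=
  {u | (u.1, Fin.init u.2) ∈ e.target ∧ (e.symm (u.1, Fin.init u.2)).base ∈ S.cod.source ∧
    S.equiv.symm (S.cod (e.symm (u.1, Fin.init u.2)).base, u.2 (Fin.last p)) ∈ S.dom.target}

lemma tgt_newArr {e : OpenPartialHomeomorph (Nerve Q p) (Model Q p)} {S : SubChart Q}
    {u : Model Q (p + 1)} (hu : u ∈ snocTarget e S) :
    Q.tgt (newArr e S u) = (e.symm (u.1, Fin.init u.2)).base := by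
  obtain ⟨h1, h2, h3⟩ := hu
  refine S.cod.injOn (S.maps _ (S.dom.map_target h3)) h2 ?_
  refine (S.eq _ h3).trans ?_
  simp

lemma continuous_pr : Continuous (fun u : Model Q (p + 1) ↦ ((u.1, Fin.init u.2) : Model Q p)) :=
  continuous_fst.prodMk (continuous_pi fun i ↦ (continuous_apply i.castSucc).comp continuous_snd)

open Classical in
/-- The chart `(c, g) ↦ (e c, fibre coordinate of g)` of `G^(p+1) = G^(p) ×_M G` built from a chart
`e` of `G^(p)`; the string `c₀` is only used as a value outside of the target of the chart. -/
def chartSnoc (c₀ : Nerve Q (p + 1)) (e : OpenPartialHomeomorph (Nerve Q p) (Model Q p))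
    (S : SubChart Q) : OpenPartialHomeomorph (Nerve Q (p + 1)) (Model Q (p + 1)) where
  toFun c := ((e c.init).1, Fin.snoc (α := fun _ ↦ Q.isSubmersion_tgt.complement)
    (e c.init).2 (S.equiv (S.dom (c.arr (Fin.last p)))).2)
  invFun u := if h : Q.tgt (newArr e S u) = (e.symm (u.1, Fin.init u.2)).base then
    (e.symm (u.1, Fin.init u.2)).snoc (newArr e S u) h else c₀
  source := {c | c.init ∈ e.source ∧ c.arr (Fin.last p) ∈ S.dom.source}
  target := snocTarget e S
  map_source' c hc := by
    obtain ⟨h1, h2⟩ := hc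
    have h3 : c.init.base ∈ S.cod.source := by rw [← tgt_last]; exact S.maps _ h2
    have h4 : S.equiv.symm (S.cod c.init.base, (S.equiv (S.dom (c.arr (Fin.last p)))).2) =
        S.dom (c.arr (Fin.last p)) := by
      rw [ContinuousLinearEquiv.symm_apply_eq]
      refine Prod.ext ?_ rfl
      rw [← S.eq _ (S.dom.map_source h2), S.dom.left_inv h2, tgt_last]
    refine ⟨?_, ?_, ?_⟩
    · simpa using e.map_source h1
    · simpa [e.left_inv h1] using h3
    · simp only [Fin.init_snoc, Fin.snoc_last, e.left_inv h1, Prod.mk.eta, h4]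
      exact S.dom.map_source h2
  map_target' u hu := by
    rw [dif_pos (tgt_newArr hu)]
    refine ⟨?_, ?_⟩
    · rw [init_snoc]; exact e.map_target hu.1
    · rw [last_snoc]; exact S.dom.map_target hu.2.2
  left_inv' c hc := by
    obtain ⟨h1, h2⟩ := hc
    have h4 : S.equiv.symm (S.cod c.init.base, (S.equiv (S.dom (c.arr (Fin.last p)))).2) =
        S.dom (c.arr (Fin.last p)) := by
      rw [ContinuousLinearEquiv.symm_apply_eq]
      refine Prod.ext ?_ rfl
      rw [← S.eq _ (S.dom.map_source h2), S.dom.left_inv h2, tgt_last]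
    have h5 : e.symm ((e c.init).1, Fin.init (Fin.snoc
        (α := fun _ ↦ Q.isSubmersion_tgt.complement)
        (e c.init).2 (S.equiv (S.dom (c.arr (Fin.last p)))).2)) = c.init := by
      simp [e.left_inv h1]
    have h6 : newArr e S ((e c.init).1, Fin.snoc (α := fun _ ↦ Q.isSubmersion_tgt.complement)
        (e c.init).2 (S.equiv (S.dom (c.arr (Fin.last p)))).2) = c.arr (Fin.last p) := by
      rw [newArr]
      simp only [Fin.init_snoc, Fin.snoc_last, e.left_inv h1, Prod.mk.eta, h4, S.dom.left_inv h2]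
    have h7 : Q.tgt (newArr e S ((e c.init).1,
        Fin.snoc (α := fun _ ↦ Q.isSubmersion_tgt.complement)
        (e c.init).2 (S.equiv (S.dom (c.arr (Fin.last p)))).2)) = (e.symm ((e c.init).1,
          Fin.init (Fin.snoc
        (α := fun _ ↦ Q.isSubmersion_tgt.complement)
        (e c.init).2 (S.equiv (S.dom (c.arr (Fin.last p)))).2))).base := by
      rw [h6, h5, tgt_last]
    rw [dif_pos h7]
    exact snoc_init c h5 h6 h7
  right_inv' u hu := by
    rw [dif_pos (tgt_newArr hu)]
    simp only [init_snoc, last_snoc, e.right_inv hu.1]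
    refine Prod.ext rfl ?_
    simp only [newArr, S.dom.right_inv hu.2.2, ContinuousLinearEquiv.apply_symm_apply,
      Fin.snoc_init_self]
  open_source := (e.open_source.preimage continuous_init).inter
    (S.dom.open_source.preimage (continuous_arr _))
  open_target := by
    have hb : ContinuousOn (fun u : Model Q (p + 1) ↦ (e.symm (u.1, Fin.init u.2)).base)
        {u | (u.1, Fin.init u.2) ∈ e.target} :=
      continuous_base.comp_continuousOn
        (e.symm.continuousOn.comp continuous_pr.continuousOn fun u hu ↦ hu)
    have ho : IsOpen {u : Model Q (p + 1) | (u.1, Fin.init u.2) ∈ e.target} :=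
      e.open_target.preimage continuous_pr
    have ho2 := hb.isOpen_inter_preimage ho S.cod.open_source
    have hc : ContinuousOn (fun u : Model Q (p + 1) ↦
        S.equiv.symm (S.cod (e.symm (u.1, Fin.init u.2)).base, u.2 (Fin.last p)))
        ({u : Model Q (p + 1) | (u.1, Fin.init u.2) ∈ e.target} ∩
          (fun u : Model Q (p + 1) ↦ (e.symm (u.1, Fin.init u.2)).base) ⁻¹' S.cod.source) := by
      refine S.equiv.symm.continuous.comp_continuousOn (ContinuousOn.prodMk ?_ ?_)
      · exact S.cod.continuousOn.comp (hb.mono inter_subset_left) fun u hu ↦ hu.2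
      · exact ((continuous_apply _).comp continuous_snd).continuousOn
    have := hc.isOpen_inter_preimage ho2 S.dom.open_target
    convert this using 1
    ext u
    simp [snocTarget, and_assoc]
  continuousOn_toFun := by
    have h1 : ContinuousOn (fun c : Nerve Q (p + 1) ↦ e c.init)
        {c | c.init ∈ e.source ∧ c.arr (Fin.last p) ∈ S.dom.source} :=
      e.continuousOn.comp continuous_init.continuousOn fun c hc ↦ hc.1
    refine (continuous_fst.comp_continuousOn h1).prodMk (continuousOn_pi.2 fun i ↦ ?_)
    refine Fin.lastCases ?_ (fun j ↦ ?_) i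
    · simp only [Fin.snoc_last]
      exact (continuous_snd.comp S.equiv.continuous).comp_continuousOn
        (S.dom.continuousOn.comp (continuous_arr _).continuousOn fun c hc ↦ hc.2)
    · simp only [Fin.snoc_castSucc]
      exact ((continuous_apply j).comp continuous_snd).comp_continuousOn h1
  continuousOn_invFun := by
    have he : ContinuousOn (fun u : Model Q (p + 1) ↦ e.symm (u.1, Fin.init u.2))
        (snocTarget e S) :=
      e.symm.continuousOn.comp continuous_pr.continuousOn fun u hu ↦ hu.1
    have hg : ContinuousOn (newArr e S) (snocTarget e S) := by
      refine S.dom.symm.continuousOn.comp (S.equiv.symm.continuous.comp_continuousOn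
        (ContinuousOn.prodMk ?_ ?_)) fun u hu ↦ hu.2.2
      · exact S.cod.continuousOn.comp (continuous_base.comp_continuousOn he) fun u hu ↦ hu.2.1
      · exact ((continuous_apply _).comp continuous_snd).continuousOn
    rw [continuousOn_iff] at he ⊢
    constructor
    · intro i
      refine Fin.lastCases ?_ (fun j ↦ ?_) i
      · refine (Q.src.contMDiff.continuous.comp_continuousOn hg).congr fun u hu ↦ ?_
        simp [dif_pos (tgt_newArr hu), snoc]
      · refine (he.1 j).congr fun u hu ↦ ?_
        simp [dif_pos (tgt_newArr hu), snoc]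
    · intro i
      refine Fin.lastCases ?_ (fun j ↦ ?_) i
      · refine hg.congr fun u hu ↦ ?_
        simp [dif_pos (tgt_newArr hu), snoc]
      · refine (he.2 j).congr fun u hu ↦ ?_
        simp [dif_pos (tgt_newArr hu), snoc]

/-- The chart of `G^(p)` around a string, by recursion on `p`. -/
def chart : ∀ {p : ℕ}, Nerve Q p → OpenPartialHomeomorph (Nerve Q p) (Model Q p)
  | 0, c => chartZero c.base
  | p + 1, c => chartSnoc c (chart c.init) (subChart (c.arr (Fin.last p)))

lemma mem_chart_source : ∀ {p : ℕ} (c : Nerve Q p), c ∈ (chart c).source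
  | 0, c => ChartedSpace.mem_chart_source c.base
  | _ + 1, c => ⟨mem_chart_source c.init, mem_subChart _⟩

/-- The smooth structure of `G^(p)` as an iterated fibre product of `s` and `t`. -/
instance : ChartedSpace (Model Q p) (Nerve Q p) where
  atlas := range chart
  chartAt := chart
  mem_chart_source := mem_chart_source
  chart_mem_atlas c := mem_range_self c

section smooth
variable [IsManifold 𝓘(ℝ, EM) ∞ M] [IsManifold 𝓘(ℝ, EG) ∞ G]

lemma contDiff_pr : ContDiff ℝ ∞ (fun u : Model Q (p + 1) ↦ ((u.1, Fin.init u.2) : Model Q p)) :=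
  contDiff_fst.prodMk (contDiff_pi.2 fun i ↦ (contDiff_apply ℝ _ i.castSucc).comp contDiff_snd)

lemma contMDiffOn_newArr {e : OpenPartialHomeomorph (Nerve Q p) (Model Q p)} {S : SubChart Q}
    (he : ContMDiffOn 𝓘(ℝ, Model Q p) 𝓘(ℝ, EM) ∞ (fun u ↦ (e.symm u).base) e.target) :
    ContMDiffOn 𝓘(ℝ, Model Q (p + 1)) 𝓘(ℝ, EG) ∞ (newArr e S) (snocTarget e S) := by
  have h1 : ContMDiffOn 𝓘(ℝ, Model Q (p + 1)) 𝓘(ℝ, EM) ∞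
      (fun u : Model Q (p + 1) ↦ (e.symm (u.1, Fin.init u.2)).base) (snocTarget e S) :=
    he.comp contDiff_pr.contMDiff.contMDiffOn fun u hu ↦ hu.1
  have h2 : ContMDiffOn 𝓘(ℝ, Model Q (p + 1)) 𝓘(ℝ, EM) ∞
      (fun u : Model Q (p + 1) ↦ S.cod (e.symm (u.1, Fin.init u.2)).base) (snocTarget e S) :=
    (contMDiffOn_of_mem_maximalAtlas S.cod_mem).comp h1 fun u hu ↦ hu.2.1
  have h3 : ContDiff ℝ ∞ (fun u : Model Q (p + 1) ↦ u.2 (Fin.last p)) :=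
    (contDiff_apply ℝ _ (Fin.last p)).comp contDiff_snd
  have h4 : ContMDiffOn 𝓘(ℝ, Model Q (p + 1)) 𝓘(ℝ, EG) ∞ (fun u : Model Q (p + 1) ↦
      S.equiv.symm (S.cod (e.symm (u.1, Fin.init u.2)).base, u.2 (Fin.last p)))
      (snocTarget e S) :=
    (S.equiv.symm.contDiff.comp_contDiffOn
      (h2.contDiffOn.prodMk h3.contDiffOn)).contMDiffOn
  exact (contMDiffOn_symm_of_mem_maximalAtlas S.dom_mem).comp h4 fun u hu ↦ hu.2.2

lemma chartSnoc_apply (c₀ : Nerve Q (p + 1)) (e : OpenPartialHomeomorph (Nerve Q p) (Model Q p))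
    (S : SubChart Q) (c : Nerve Q (p + 1)) :
    chartSnoc c₀ e S c = ((e c.init).1, Fin.snoc (α := fun _ ↦ Q.isSubmersion_tgt.complement)
      (e c.init).2 (S.equiv (S.dom (c.arr (Fin.last p)))).2) := rfl

lemma chartSnoc_symm {c₀ : Nerve Q (p + 1)} {e : OpenPartialHomeomorph (Nerve Q p) (Model Q p)}
    {S : SubChart Q} {u : Model Q (p + 1)} (hu : u ∈ snocTarget e S) :
    (chartSnoc c₀ e S).symm u =
      (e.symm (u.1, Fin.init u.2)).snoc (newArr e S u) (tgt_newArr hu) :=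
  dif_pos (tgt_newArr hu)

lemma contMDiffOn_base_chart_symm : ∀ {p : ℕ} (c : Nerve Q p),
    ContMDiffOn 𝓘(ℝ, Model Q p) 𝓘(ℝ, EM) ∞ (fun u ↦ ((chart c).symm u).base) (chart c).target
  | 0, c => (contMDiffOn_chart_symm (x := c.base)).comp
      contDiff_fst.contMDiff.contMDiffOn fun u hu ↦ hu
  | p + 1, c => by
    refine (Q.src.contMDiff.comp_contMDiffOn
      (contMDiffOn_newArr (contMDiffOn_base_chart_symm c.init))).congr fun u hu ↦ ?_
    rw [chart, chartSnoc_symm hu, base_snoc]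
    rfl

lemma contDiffOn_chart_chart_symm : ∀ {p : ℕ} (c d : Nerve Q p),
    ContDiffOn ℝ ∞ (fun u ↦ chart d ((chart c).symm u))
      ((chart c).target ∩ (chart c).symm ⁻¹' (chart d).source)
  | 0, c, d => by
    refine ContDiffOn.prodMk (ContMDiffOn.contDiffOn ?_) contDiffOn_const
    refine (contMDiffOn_chart (x := d.base)).comp ?_ fun u hu ↦ hu.2
    exact (contMDiffOn_base_chart_symm c).mono inter_subset_left
  | p + 1, c, d => by
    set S := subChart (Q := Q) (c.arr (Fin.last p))
    set T := subChart (Q := Q) (d.arr (Fin.last p))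
    have hs : ∀ u ∈ (chart c).target ∩ (chart c).symm ⁻¹' (chart d).source,
        u ∈ snocTarget (chart c.init) S ∧
        (chart c.init).symm (u.1, Fin.init u.2) ∈ (chart d.init).source ∧
        newArr (chart c.init) S u ∈ T.dom.source := by
      rintro u ⟨h1, h2⟩
      refine ⟨h1, ?_⟩
      have h2' : (chart c).symm u ∈ (chartSnoc d (chart d.init) T).source := h2
      have h3 : (chart c).symm u = _ := chartSnoc_symm (c₀ := c) h1
      rw [h3] at h2'
      simpa [chartSnoc, init_snoc, last_snoc] using h2'
    have h1 : ContDiffOn ℝ ∞ (fun u : Model Q (p + 1) ↦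
        chart d.init ((chart c.init).symm (u.1, Fin.init u.2)))
        ((chart c).target ∩ (chart c).symm ⁻¹' (chart d).source) :=
      (contDiffOn_chart_chart_symm c.init d.init).comp contDiff_pr.contDiffOn
        fun u hu ↦ ⟨(hs u hu).1.1, (hs u hu).2.1⟩
    have h2 : ContDiffOn ℝ ∞ (fun u : Model Q (p + 1) ↦
        (T.equiv (T.dom (newArr (chart c.init) S u))).2)
        ((chart c).target ∩ (chart c).symm ⁻¹' (chart d).source) := by
      refine (contDiff_snd.comp T.equiv.contDiff).comp_contDiffOn (ContMDiffOn.contDiffOn ?_)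
      refine (contMDiffOn_of_mem_maximalAtlas T.dom_mem).comp ?_ fun u hu ↦ (hs u hu).2.2
      exact (contMDiffOn_newArr (contMDiffOn_base_chart_symm c.init)).mono fun u hu ↦ (hs u hu).1
    have h3 : ContDiffOn ℝ ∞ (fun u : Model Q (p + 1) ↦
        (((chart d.init ((chart c.init).symm (u.1, Fin.init u.2))).1,
          Fin.snoc (α := fun _ ↦ Q.isSubmersion_tgt.complement)
            (chart d.init ((chart c.init).symm (u.1, Fin.init u.2))).2
            (T.equiv (T.dom (newArr (chart c.init) S u))).2) : Model Q (p + 1)))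
        ((chart c).target ∩ (chart c).symm ⁻¹' (chart d).source) := by
      refine (contDiff_fst.comp_contDiffOn h1).prodMk (contDiffOn_pi.2 fun i ↦ ?_)
      refine Fin.lastCases ?_ (fun j ↦ ?_) i
      · simpa only [Fin.snoc_last] using h2
      · simp only [Fin.snoc_castSucc]
        exact ((contDiff_apply ℝ _ j).comp contDiff_snd).comp_contDiffOn h1
    refine h3.congr fun u hu ↦ ?_
    have h4 : (chart c).symm u = _ := chartSnoc_symm (c₀ := c) (hs u hu).1
    rw [h4]
    rw [chart, chartSnoc_apply]
    simp only [init_snoc, last_snoc]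
    rfl

instance : IsManifold 𝓘(ℝ, Model Q p) ∞ (Nerve Q p) := by
  refine isManifold_of_contDiffOn _ _ _ ?_
  rintro _ _ ⟨c, rfl⟩ ⟨d, rfl⟩
  refine (contDiffOn_chart_chart_symm c d).congr_mono (fun u _ ↦ by simp) ?_
  intro u hu
  simpa using hu

lemma contMDiff_base : ContMDiff 𝓘(ℝ, Model Q p) 𝓘(ℝ, EM) ∞ (base : Nerve Q p → M) := by
  intro c
  have h1 : ContMDiffOn 𝓘(ℝ, Model Q p) 𝓘(ℝ, EM) ∞
      ((fun u ↦ ((chart c).symm u).base) ∘ chart c) (chart c).source :=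
    (contMDiffOn_base_chart_symm c).comp (contMDiffOn_chart (x := c))
      fun d hd ↦ (chart c).map_source hd
  have h2 : ContMDiffOn 𝓘(ℝ, Model Q p) 𝓘(ℝ, EM) ∞ (base : Nerve Q p → M) (chart c).source :=
    h1.congr fun d hd ↦ by simp [(chart c).left_inv hd]
  exact h2.contMDiffAt ((chart c).open_source.mem_nhds (mem_chart_source c))

variable (Q p) in
/-- The smooth map `G^(p) → M`, `(g_1, …, g_p) ↦ s(g_p)` (the identity of `M` when `p = 0`). -/
def baseMap : C^∞⟮𝓘(ℝ, Model Q p), Nerve Q p; 𝓘(ℝ, EM), M⟯ := ⟨base, contMDiff_base⟩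

end smooth
end Nerve

end Nerves

section Connections

variable {EM : Type*} [NormedAddCommGroup EM] [NormedSpace ℝ EM]
  {M : Type*} [TopologicalSpace M] [ChartedSpace EM M]
  {EN : Type*} [NormedAddCommGroup EN] [NormedSpace ℝ EN]
  {N : Type*} [TopologicalSpace N] [ChartedSpace EN N]
  {F : Type*} [NormedAddCommGroup F] [NormedSpace ℝ F]

instance instAddCommGroupPullback {B B' : Type*} (f : B' → B) (E : B → Type*)
    [∀ x, AddCommGroup (E x)] (x : B') : AddCommGroup ((f *ᵖ E) x) :=
  inferInstanceAs (AddCommGroup (E (f x)))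

instance instIsTopologicalAddGroupPullback {B B' : Type*} (f : B' → B) (E : B → Type*)
    [∀ x, AddCommGroup (E x)] [∀ x, TopologicalSpace (E x)] [∀ x, IsTopologicalAddGroup (E x)]
    (x : B') : IsTopologicalAddGroup ((f *ᵖ E) x) :=
  inferInstanceAs (IsTopologicalAddGroup (E (f x)))

instance instContinuousSMulPullback {B B' : Type*} (f : B' → B) (E : B → Type*)
    [∀ x, AddCommGroup (E x)] [∀ x, Module ℝ (E x)] [∀ x, TopologicalSpace (E x)]
    [∀ x, ContinuousSMul ℝ (E x)] (x : B') : ContinuousSMul ℝ ((f *ᵖ E) x) :=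
  inferInstanceAs (ContinuousSMul ℝ (E (f x)))

lemma mvfderiv_congr_nhds {f g : N → F} {y : N} (h : f =ᶠ[nhds y] g) :
    mvfderiv 𝓘(ℝ, EN) f y = mvfderiv 𝓘(ℝ, EN) g y := by
  ext v
  simp only [mvfderiv, h.mfderiv_eq]
  rfl

variable {V : M → Type*} [TopologicalSpace (TotalSpace F V)] [∀ x, AddCommGroup (V x)]
  [∀ x, Module ℝ (V x)] [∀ x, TopologicalSpace (V x)] [∀ x, IsTopologicalAddGroup (V x)]
  [∀ x, ContinuousSMul ℝ (V x)] [FiberBundle F V] [VectorBundle ℝ F V]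

variable (F V) in
/-- The isomorphism of the fibre at `x` with the model fibre in the preferred trivialization at
`x`. -/
def frameAt (x : M) : V x ≃L[ℝ] F :=
  (trivializationAt F V x).continuousLinearEquivAt ℝ x (mem_baseSet_trivializationAt F V x)

/-- The local section of `V` around `x` that is constant, equal to `a`, in the preferred
trivialization at `x`. -/
def frameSection (x : M) (a : F) (y : M) : V y := (trivializationAt F V x).symmL ℝ y a

lemma mdifferentiableAt_frameSection (x : M) (a : F) :
    MDiffAt (T% (frameSection (V := V) x a)) x := by
  rw [mdifferentiableAt_section]
  refine (mdifferentiableAt_const (c := a)).congr_of_eventuallyEq ?_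
  filter_upwards [(trivializationAt F V x).open_baseSet.mem_nhds
    (mem_baseSet_trivializationAt F V x)] with y hy
  simp [frameSection, Trivialization.symmL_apply _ hy, Trivialization.apply_mk_symm _ hy]

/-- The connection form at `x` in the preferred trivialization at `x`: the covariant derivative at
`x` of the section with value `a` at `x` that is constant in this trivialization. -/
def connectionTerm (D : CovariantDerivative 𝓘(ℝ, EM) F V) (x : M) :
    V x →ₗ[ℝ] (TangentSpace 𝓘(ℝ, EM) x →L[ℝ] V x) where
  toFun a := D (frameSection x (frameAt F V x a)) x
  map_add' a b := by
    have h : frameSection (V := V) x (frameAt F V x (a + b)) =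
        frameSection x (frameAt F V x a) + frameSection x (frameAt F V x b) := by
      funext y; simp [frameSection]
    rw [h]
    exact D.isCovariantDerivativeOnUniv.add (mdifferentiableAt_frameSection _ _)
      (mdifferentiableAt_frameSection _ _)
  map_smul' r a := by
    have h : frameSection (V := V) x (frameAt F V x (r • a)) =
        r • frameSection x (frameAt F V x a) := by
      funext y; simp [frameSection]
    rw [h]
    exact D.isCovariantDerivativeOnUniv.smul_const r (mdifferentiableAt_frameSection _ _)

/-- A section `σ` of `f^*V` written in the preferred trivialization of `V` at `f y₀`. -/
def coordSection (f : N → M) (σ : Π y, (f *ᵖ V) y) (y₀ y : N) : F :=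
  (trivializationAt F V (f y₀) ⟨f y, σ y⟩).2

lemma mdifferentiableAt_coordSection {f : C^∞⟮𝓘(ℝ, EN), N; 𝓘(ℝ, EM), M⟯}
    {σ : Π y, (f *ᵖ V) y} {y : N} (h : MDifferentiableAt 𝓘(ℝ, EN) (𝓘(ℝ, EN).prod 𝓘(ℝ, F)) (fun z ↦ TotalSpace.mk' F z (σ z)) y) :
    MDifferentiableAt 𝓘(ℝ, EN) 𝓘(ℝ, F) (coordSection (F := F) f σ y) y := 
  (mdifferentiableAt_section 𝓘(ℝ, EN) σ).1 h

/-- The pullback `∇^f` of a connection on `V` to the bundle `f^*V`. In a local frame `(e_i)` of `V`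
around `f y`, it is `∇^f_X (∑ σ^i f^*e_i) = ∑ (X σ^i) f^*e_i + ∑ σ^i f^*(∇_{df X} e_i)`. It is the
connection with `∇^f_X (f^*ξ) = f^*(∇_{df X} ξ)`. -/
def CovariantDerivative.pullback (D : CovariantDerivative 𝓘(ℝ, EM) F V)
    (f : C^∞⟮𝓘(ℝ, EN), N; 𝓘(ℝ, EM), M⟯) : CovariantDerivative 𝓘(ℝ, EN) F (f *ᵖ V) where
  toFun σ y :=
    ((frameAt F V (f y)).symm : F →L[ℝ] V (f y)) ∘L
        mvfderiv 𝓘(ℝ, EN) (coordSection (F := F) f σ y) y +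
      (connectionTerm D (f y) (σ y)) ∘L mfderiv 𝓘(ℝ, EN) 𝓘(ℝ, EM) f y
  isCovariantDerivativeOnUniv := {
    add := by
      intro σ τ y hσ hτ _
      have h : coordSection (F := F) f (σ + τ) y =ᶠ[nhds y]
          coordSection (F := F) f σ y + coordSection (F := F) f τ y := by
        filter_upwards [(f.contMDiff.continuous.isOpen_preimage _
          (trivializationAt F V (f y)).open_baseSet).mem_nhds
          (mem_baseSet_trivializationAt F V (f y))] with z hz
        exact ((trivializationAt F V (f y)).linear ℝ hz).1 _ _
      rw [mvfderiv_congr_nhds h, mvfderiv_add (mdifferentiableAt_coordSection hσ)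
        (mdifferentiableAt_coordSection hτ)]
      have key : ∀ (a b : F) (s t : V (f y)) (w : TangentSpace 𝓘(ℝ, EM) (f y)),
          (frameAt F V (f y)).symm (a + b) + connectionTerm D (f y) (s + t) w =
          ((frameAt F V (f y)).symm a + connectionTerm D (f y) s w) +
          ((frameAt F V (f y)).symm b + connectionTerm D (f y) t w) := by
        intro a b s t w
        rw [map_add, map_add, add_apply]
        abel
      exact ContinuousLinearMap.ext fun v ↦ key _ _ _ _ _
    leibniz := by
      intro σ g y hσ hg _
      have h : coordSection (F := F) f (g • σ) y =ᶠ[nhds y]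
          g • coordSection (F := F) f σ y := by
        filter_upwards [(f.contMDiff.continuous.isOpen_preimage _
          (trivializationAt F V (f y)).open_baseSet).mem_nhds
          (mem_baseSet_trivializationAt F V (f y))] with z hz
        exact ((trivializationAt F V (f y)).linear ℝ hz).2 _ _
      have hs : (frameAt F V (f y)).symm (coordSection (F := F) f σ y y) = σ y :=
        (frameAt F V (f y)).symm_apply_apply (σ y)
      rw [mvfderiv_congr_nhds h, mvfderiv_smul hg (mdifferentiableAt_coordSection hσ)]
      have key : ∀ (r r' : ℝ) (a b : F) (s : V (f y)) (w : TangentSpace 𝓘(ℝ, EM) (f y)),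
          (frameAt F V (f y)).symm b = s →
          (frameAt F V (f y)).symm (r • a + r' • b) + connectionTerm D (f y) (r • s) w =
          r • ((frameAt F V (f y)).symm a + connectionTerm D (f y) s w) + r' • s := by
        intro r r' a b s w hb
        rw [map_add, map_smul, map_smul, map_smul, hb, smul_apply, smul_add]
        abel
      exact ContinuousLinearMap.ext fun v ↦ key _ _ _ _ _ _ hs }

end Connections

section Forms

variable {EN : Type*} [NormedAddCommGroup EN] [NormedSpace ℝ EN]
  {N : Type*} [TopologicalSpace N] [ChartedSpace EN N]
  {F : Type*} [NormedAddCommGroup F] [NormedSpace ℝ F]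
  {W : N → Type*} [TopologicalSpace (TotalSpace F W)] [∀ x, AddCommGroup (W x)]
  [∀ x, Module ℝ (W x)] [∀ x, TopologicalSpace (W x)] [∀ x, IsTopologicalAddGroup (W x)]
  [∀ x, ContinuousSMul ℝ (W x)] [FiberBundle F W] [VectorBundle ℝ F W]

variable (EN W) in
/-- (Not necessarily smooth) `q`-forms on `N` with values in the vector bundle `W → N`. -/
abbrev VForm (q : ℕ) : Type _ := ∀ x : N, TangentSpace 𝓘(ℝ, EN) x [⋀^Fin q]→L[ℝ] W x

variable (F) in
/-- `α` is a smooth section of the bundle of alternating maps, i.e. `α ∈ Ω^q(N; W)`. -/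
def VForm.IsSmooth [IsManifold 𝓘(ℝ, EN) ∞ N] {q : ℕ} (α : VForm EN W q) : Prop :=
  ContMDiff 𝓘(ℝ, EN) (𝓘(ℝ, EN).prod 𝓘(ℝ, EN [⋀^Fin q]→L[ℝ] F)) ∞
    fun x ↦ (TotalSpace.mk' (EN [⋀^Fin q]→L[ℝ] F) x (α x) :
      TotalSpace (EN [⋀^Fin q]→L[ℝ] F) fun x ↦ TangentSpace 𝓘(ℝ, EN) x [⋀^Fin q]→L[ℝ] W x)

variable (F) in
/-- `α` written in the preferred chart of `N` and the preferred trivialization of `W` at `x`: a form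
on (an open subset of) the model space with values in the model fibre. -/
def VForm.coordForm {q : ℕ} (α : VForm EN W q) (x : N) (u : EN) : EN [⋀^Fin q]→L[ℝ] F :=
  ((trivializationAt F W x).continuousLinearMapAt ℝ ((chartAt EN x).symm u)
    ).compContinuousAlternatingMap
    ((α ((chartAt EN x).symm u)).compContinuousLinearMap
      (mfderiv 𝓘(ℝ, EN) 𝓘(ℝ, EN) (chartAt EN x).symm u))

/-- The connection form `A` of `D` at `x` in the preferred chart and trivialization at `x`:
`A(v) a = ∇_v e_a`, where `e_a` is the section constant equal to `a`. -/
def christoffel [FiniteDimensional ℝ F] (D : CovariantDerivative 𝓘(ℝ, EN) F W) (x : N) :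
    EN →L[ℝ] F →L[ℝ] F :=
  ContinuousLinearMap.flip (LinearMap.toContinuousLinearMap
    { toFun a := ((frameAt F W x : W x →L[ℝ] F) ∘L connectionTerm D x ((frameAt F W x).symm a)) ∘L
        mfderiv 𝓘(ℝ, EN) 𝓘(ℝ, EN) (chartAt EN x).symm (chartAt EN x x)
      map_add' a b := by
        refine ContinuousLinearMap.ext fun v ↦ ?_
        change frameAt F W x (connectionTerm D x ((frameAt F W x).symm (a + b)) _) =
          frameAt F W x (connectionTerm D x ((frameAt F W x).symm a) _) +
            frameAt F W x (connectionTerm D x ((frameAt F W x).symm b) _)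
        rw [map_add, map_add, add_apply, map_add]
      map_smul' r a := by
        refine ContinuousLinearMap.ext fun v ↦ ?_
        change frameAt F W x (connectionTerm D x ((frameAt F W x).symm (r • a)) _) =
          r • frameAt F W x (connectionTerm D x ((frameAt F W x).symm a) _)
        rw [map_smul, map_smul, smul_apply, map_smul] })

/-- The exterior covariant derivative `d^∇ α` of a `W`-valued form. At `x`, it is written in the
preferred chart and trivialization at `x` as `dα + A ∧ α`, where `d` is the exterior derivative on
the model space, `A` the connection form, and
`(A ∧ α)(v_0, …, v_q) = ∑ (-1)^i A(v_i) α(v_0, …, v_i omitted, …, v_q)`. -/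
def extCovDeriv [FiniteDimensional ℝ F] (D : CovariantDerivative 𝓘(ℝ, EN) F W) {q : ℕ}
    (α : VForm EN W q) : VForm EN W (q + 1) := fun x ↦
  ((frameAt F W x).symm : F →L[ℝ] W x).compContinuousAlternatingMap
    ((extDeriv (α.coordForm F x) (chartAt EN x x) +
      ContinuousAlternatingMap.alternatizeUncurryFin
        (((ContinuousLinearMap.compContinuousAlternatingMapCLM ℝ EN F F (Fin q)).flip
          (α.coordForm F x (chartAt EN x x))) ∘L christoffel D x)).compContinuousLinearMap
      (mfderiv 𝓘(ℝ, EN) 𝓘(ℝ, EN) (chartAt EN x) x))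

end Forms

section LieGroupoids

/-- A Lie groupoid `G ⇉ M`. The multiplication is smooth on the manifold `G^(2)` of composable
pairs. -/
structure LieGroupoid (EM : Type*) [NormedAddCommGroup EM] [NormedSpace ℝ EM]
    (M : Type*) [TopologicalSpace M] [ChartedSpace EM M]
    (EG : Type*) [NormedAddCommGroup EG] [NormedSpace ℝ EG]
    (G : Type*) [TopologicalSpace G] [ChartedSpace EG G]
    extends SubmersiveQuiver EM M EG G where
  one : C^∞⟮𝓘(ℝ, EM), M; 𝓘(ℝ, EG), G⟯
  inv : C^∞⟮𝓘(ℝ, EG), G; 𝓘(ℝ, EG), G⟯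
  /-- The product `g h`, defined when `s(g) = t(h)`. -/
  mul : ∀ g h : G, src g = tgt h → G
  src_one : ∀ x, src (one x) = x
  tgt_one : ∀ x, tgt (one x) = x
  src_inv : ∀ g, src (inv g) = tgt g
  tgt_inv : ∀ g, tgt (inv g) = src g
  src_mul : ∀ g h e, src (mul g h e) = src h
  tgt_mul : ∀ g h e, tgt (mul g h e) = tgt g
  one_mul : ∀ g, mul (one (tgt g)) g (src_one _) = g
  mul_one : ∀ g, mul g (one (src g)) (tgt_one _).symm = g
  mul_inv : ∀ g, mul g (inv g) (tgt_inv g).symm = one (tgt g)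
  inv_mul : ∀ g, mul (inv g) g (src_inv g) = one (src g)
  mul_assoc : ∀ g h k (e : src g = tgt h) (e' : src h = tgt k),
    mul (mul g h e) k ((src_mul g h e).trans e') = mul g (mul h k e') (e.trans (tgt_mul h k e').symm)
  contMDiff_mul : ContMDiff 𝓘(ℝ, Nerve.Model toSubmersiveQuiver 2) 𝓘(ℝ, EG) ∞
    fun c : Nerve toSubmersiveQuiver 2 ↦
      mul (c.arr 0) (c.arr 1) ((c.src_arr 0).trans (c.tgt_arr 1).symm)

variable {EM : Type*} [NormedAddCommGroup EM] [NormedSpace ℝ EM]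
  {M : Type*} [TopologicalSpace M] [ChartedSpace EM M]
  {EG : Type*} [NormedAddCommGroup EG] [NormedSpace ℝ EG]
  {G : Type*} [TopologicalSpace G] [ChartedSpace EG G]

namespace LieGroupoid

/-- The level `G^(p)` of the nerve. -/
abbrev level (𝒢 : LieGroupoid EM M EG G) (p : ℕ) : Type _ := Nerve 𝒢.toSubmersiveQuiver p

/-- The model vector space of `G^(p)`. -/
abbrev LevelModel (𝒢 : LieGroupoid EM M EG G) (p : ℕ) : Type _ :=
  Nerve.Model 𝒢.toSubmersiveQuiver p

/-- The face map `f_i : G^(p+1) → G^(p)`: it omits `g_1` for `i = 0`, replaces `g_i, g_{i+1}` by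
their product for `1 ≤ i ≤ p`, and omits `g_{p+1}` for `i = p + 1`. For `p = 0`, `f_0 = s` and
`f_1 = t`. (The index `j` starts at `0`: `c.arr j` is the arrow `g_{j+1}`.) -/
def face (𝒢 : LieGroupoid EM M EG G) {p : ℕ} (i : Fin (p + 2)) (c : 𝒢.level (p + 1)) :
    𝒢.level p where
  obj k := c.obj (i.succAbove k)
  arr j :=
    if (j : ℕ) + 1 < i then c.arr j.castSucc
    else if (j : ℕ) + 1 = i then
      𝒢.mul (c.arr j.castSucc) (c.arr j.succ)
        ((c.src_arr j.castSucc).trans (c.tgt_arr j.succ).symm)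
    else c.arr j.succ
  tgt_arr j := by
    split_ifs with h1 h2
    · rw [c.tgt_arr, Fin.succAbove_of_castSucc_lt]
      simp only [Fin.lt_def, Fin.val_castSucc]; omega
    · rw [𝒢.tgt_mul, c.tgt_arr, Fin.succAbove_of_castSucc_lt]
      simp only [Fin.lt_def, Fin.val_castSucc]; omega
    · rw [c.tgt_arr, Fin.succAbove_of_le_castSucc]
      · rfl
      · simp only [Fin.le_def, Fin.val_castSucc]; omega
  src_arr j := by
    split_ifs with h1 h2
    · rw [c.src_arr, Fin.succAbove_of_castSucc_lt]
      · rfl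
      · simp only [Fin.lt_def, Fin.val_castSucc, Fin.val_succ]; omega
    · rw [𝒢.src_mul, c.src_arr, Fin.succAbove_of_le_castSucc]
      simp only [Fin.le_def, Fin.val_castSucc, Fin.val_succ]; omega
    · rw [c.src_arr, Fin.succAbove_of_le_castSucc]
      simp only [Fin.le_def, Fin.val_castSucc, Fin.val_succ]; omega

lemma base_face_castSucc (𝒢 : LieGroupoid EM M EG G) {p : ℕ} (i : Fin (p + 1))
    (c : 𝒢.level (p + 1)) : (𝒢.face i.castSucc c).base = c.base := by
  change c.obj (i.castSucc.succAbove (Fin.last p)) = c.obj (Fin.last (p + 1))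
  rw [Fin.succAbove_of_le_castSucc, Fin.succ_last]
  simp only [Fin.le_def, Fin.val_castSucc, Fin.val_last]; omega

lemma tgt_last (𝒢 : LieGroupoid EM M EG G) {p : ℕ} (c : 𝒢.level (p + 1)) :
    𝒢.tgt (c.arr (Fin.last p)) = (𝒢.face (Fin.last (p + 1)) c).base := by
  rw [c.tgt_arr]
  change _ = c.obj ((Fin.last (p + 1)).succAbove (Fin.last p))
  rw [Fin.succAbove_last]

lemma src_last (𝒢 : LieGroupoid EM M EG G) {p : ℕ} (c : 𝒢.level (p + 1)) :
    𝒢.src (c.arr (Fin.last p)) = c.base := c.src_arr (Fin.last p)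

end LieGroupoid

variable {F : Type*} [NormedAddCommGroup F] [NormedSpace ℝ F]
  {V : M → Type*} [TopologicalSpace (TotalSpace F V)] [∀ x, AddCommGroup (V x)]
  [∀ x, Module ℝ (V x)] [∀ x, TopologicalSpace (V x)] [∀ x, IsTopologicalAddGroup (V x)]
  [∀ x, ContinuousSMul ℝ (V x)] [FiberBundle F V] [VectorBundle ℝ F V]

variable (V) in
/-- The identification of the fibres over equal points. -/
def fiberTransport {x y : M} (h : x = y) : V x →L[ℝ] V y := h ▸ ContinuousLinearMap.id ℝ (V x)

variable (F V) in
/-- A representation of a Lie groupoid on the vector bundle `V → M`: a smooth map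
`s^*V = G ×_M V → V`, `(g, v) ↦ g · v`, linear from `V_{s(g)}` to `V_{t(g)}`, with `1_x · v = v` and
`(g h) · v = g · (h · v)`. -/
structure LieGroupoid.Representation (𝒢 : LieGroupoid EM M EG G) where
  act : ∀ {x y : M} (g : G), 𝒢.src g = x → 𝒢.tgt g = y → (V x →L[ℝ] V y)
  one_act : ∀ (x : M) (v : V x), act (𝒢.one x) (𝒢.src_one x) (𝒢.tgt_one x) v = v
  mul_act : ∀ {x y z : M} (g h : G) (hx : 𝒢.src h = x) (hy : 𝒢.tgt h = y) (gy : 𝒢.src g = y)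
    (gz : 𝒢.tgt g = z) (v : V x),
    act (𝒢.mul g h (gy.trans hy.symm)) ((𝒢.src_mul g h _).trans hx) ((𝒢.tgt_mul g h _).trans gz) v =
      act g gy gz (act h hx hy v)
  contMDiff_act : ContMDiff (𝓘(ℝ, EG).prod 𝓘(ℝ, F)) (𝓘(ℝ, EM).prod 𝓘(ℝ, F)) ∞
    fun z : TotalSpace F (𝒢.src *ᵖ V) ↦
      (TotalSpace.mk' F (𝒢.tgt z.proj) (act z.proj rfl rfl z.snd) : TotalSpace F V)

namespace LieGroupoid

variable [IsManifold 𝓘(ℝ, EM) ∞ M] [IsManifold 𝓘(ℝ, EG) ∞ G]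

/-- The smooth map `s ∘ pr_p : G^(p) → M` (the identity of `M` when `p = 0`). -/
abbrev levelBase (𝒢 : LieGroupoid EM M EG G) (p : ℕ) :
    C^∞⟮𝓘(ℝ, 𝒢.LevelModel p), 𝒢.level p; 𝓘(ℝ, EM), M⟯ := Nerve.baseMap 𝒢.toSubmersiveQuiver p

variable (V) in
/-- `V`-valued `q`-forms on the level `p` of the nerve, with coefficients in `(s ∘ pr_p)^*V`; the
smooth ones make up `Ω^{p,q}(G; V)`. -/
abbrev NerveForm (𝒢 : LieGroupoid EM M EG G) (p q : ℕ) : Type _ :=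
  VForm (𝒢.LevelModel p) (𝒢.levelBase p *ᵖ V) q

/-- The exterior covariant derivative on `Ω^{p,q}(G; V)` with respect to the pullback of the
connection `D` along `s ∘ pr_p`. -/
def dNabla [FiniteDimensional ℝ F] (𝒢 : LieGroupoid EM M EG G)
    (D : CovariantDerivative 𝓘(ℝ, EM) F V) {p q : ℕ} (α : 𝒢.NerveForm V p q) :
    𝒢.NerveForm V p (q + 1) :=
  extCovDeriv (D.pullback (𝒢.levelBase p)) α

variable (V) in
/-- (Not necessarily smooth) `1`-forms on `G` with values in `Hom(t^*V, s^*V)`. -/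
abbrev HomForm (𝒢 : LieGroupoid EM M EG G) : Type _ :=
  ∀ g : G, TangentSpace 𝓘(ℝ, EG) g →L[ℝ] (𝒢.tgt *ᵖ V) g →L[ℝ] (𝒢.src *ᵖ V) g

variable (F) in
/-- `Θ ∈ Ω^1(G; Hom(t^*V, s^*V))`, i.e. `Θ` is smooth. -/
def HomForm.IsSmooth {𝒢 : LieGroupoid EM M EG G} (Θ : 𝒢.HomForm V) : Prop :=
  ContMDiff 𝓘(ℝ, EG) (𝓘(ℝ, EG).prod 𝓘(ℝ, EG →L[ℝ] F →L[ℝ] F)) ∞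
    fun g ↦ (TotalSpace.mk' (EG →L[ℝ] F →L[ℝ] F) g (Θ g) :
      TotalSpace (EG →L[ℝ] F →L[ℝ] F)
        fun g ↦ TangentSpace 𝓘(ℝ, EG) g →L[ℝ] (𝒢.tgt *ᵖ V) g →L[ℝ] (𝒢.src *ᵖ V) g)

namespace Representation

variable {𝒢 : LieGroupoid EM M EG G}

/-- The pullback of a form along the face map `f_i`. -/
def facePullback {p q : ℕ} (i : Fin (p + 2)) (α : 𝒢.NerveForm V p q) (c : 𝒢.level (p + 1)) :
    TangentSpace 𝓘(ℝ, 𝒢.LevelModel (p + 1)) c [⋀^Fin q]→L[ℝ] V (𝒢.face i c).base :=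
  ContinuousAlternatingMap.compContinuousLinearMap (α (𝒢.face i c))
    (mfderiv 𝓘(ℝ, 𝒢.LevelModel (p + 1)) 𝓘(ℝ, 𝒢.LevelModel p) (𝒢.face i) c)

/-- The simplicial differential
`δ = ∑_{i ≤ p} (-1)^i (f_i)^* + (-1)^(p+1) Φ_* (f_{p+1})^*`, where `Φ_*` acts on the values by
`v ↦ g_{p+1}⁻¹ · v`. For `p = 0`, `δ γ = s^*γ - g⁻¹ · t^*γ`. -/
def delta (ρ : 𝒢.Representation F V) {p q : ℕ} (α : 𝒢.NerveForm V p q) :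
    𝒢.NerveForm V (p + 1) q := fun c ↦
  (∑ i : Fin (p + 1), (-1 : ℝ) ^ (i : ℕ) •
    (fiberTransport V (𝒢.base_face_castSucc i c)).compContinuousAlternatingMap
      (facePullback i.castSucc α c)) +
  (-1 : ℝ) ^ (p + 1) •
    (ρ.act (𝒢.inv (c.arr (Fin.last p))) ((𝒢.src_inv _).trans (𝒢.tgt_last c))
      ((𝒢.tgt_inv _).trans (𝒢.src_last c))).compContinuousAlternatingMap
      (facePullback (Fin.last (p + 1)) α c)

/-- The isomorphism `φ : t^*V → s^*V`, `φ(g, v) = (g, g⁻¹ · v)`. -/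
def phi (ρ : 𝒢.Representation F V) (g : G) : (𝒢.tgt *ᵖ V) g →L[ℝ] (𝒢.src *ᵖ V) g :=
  ρ.act (𝒢.inv g) (𝒢.src_inv g) (𝒢.tgt_inv g)

/-- `Θ(X) ξ = φ(∇^t_X ξ) - ∇^s_X φ(ξ)` at every `g ∈ G`, for all `X ∈ T_g G` and all sections `ξ` of
`t^*V` that are differentiable at `g`. -/
def IsInvarianceForm (ρ : 𝒢.Representation F V) (D : CovariantDerivative 𝓘(ℝ, EM) F V)
    (Θ : 𝒢.HomForm V) : Prop :=
  ∀ (ξ : ∀ g, (𝒢.tgt *ᵖ V) g) (g : G),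
    MDifferentiableAt 𝓘(ℝ, EG) (𝓘(ℝ, EG).prod 𝓘(ℝ, F)) (fun h ↦ TotalSpace.mk' F h (ξ h)) g →
    ∀ X : TangentSpace 𝓘(ℝ, EG) g,
      Θ g X (ξ g) = ρ.phi g (D.pullback 𝒢.tgt ξ g X) -
        D.pullback 𝒢.src (fun h ↦ ρ.phi h (ξ h)) g X

/-- The value of `(pr_{p+1})^*Θ ∧ (f_{p+1})^*α` on tangent vectors `X_0, …, X_q` at a point of
`G^(p+1)`: `∑ (-1)^i Θ(d pr_{p+1} X_i) ((f_{p+1})^*α)(X_0, …, X_i omitted, …, X_q)`. -/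
def wedgeLast (Θ : 𝒢.HomForm V) {p q : ℕ} (α : 𝒢.NerveForm V p q) (c : 𝒢.level (p + 1))
    (X : Fin (q + 1) → TangentSpace 𝓘(ℝ, 𝒢.LevelModel (p + 1)) c) : V c.base :=
  ∑ i : Fin (q + 1), (-1 : ℝ) ^ (i : ℕ) •
    fiberTransport V (𝒢.src_last c)
      (Θ (c.arr (Fin.last p))
        (mfderiv 𝓘(ℝ, 𝒢.LevelModel (p + 1)) 𝓘(ℝ, EG)
          (fun c : 𝒢.level (p + 1) ↦ c.arr (Fin.last p)) c (X i))
        (fiberTransport V (𝒢.tgt_last c).symm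
          (facePullback (Fin.last (p + 1)) α c (i.removeNth X))))

/-- `d^∇` is a cochain map: `d^∇ δ = δ d^∇` on `Ω^{p,q}(G; V)`, for all `p` and `q`. -/
def IsCochainMap [FiniteDimensional ℝ F] (ρ : 𝒢.Representation F V)
    (D : CovariantDerivative 𝓘(ℝ, EM) F V) : Prop :=
  ∀ (p q : ℕ) (α : 𝒢.NerveForm V p q), α.IsSmooth F →
    𝒢.dNabla D (ρ.delta α) = ρ.delta (𝒢.dNabla D α)

/-- Multiplicative forms: the cocycles in `Ω^{1,q}(G; V) = Ω^q(G; s^*V)`. -/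
def IsMultiplicative (ρ : 𝒢.Representation F V) {q : ℕ} (α : 𝒢.NerveForm V 1 q) : Prop :=
  α.IsSmooth F ∧ ρ.delta α = 0

end Representation
end LieGroupoid
end LieGroupoids
end

/-! Every summand of `δ α` has the form `Ψ_* f^*α`, with `f` a smooth map and `Ψ` a smooth family of
linear maps from the fibre at `f c` to the fibre at `c`. For such forms there is a Leibniz rule,
`extCovDeriv_map`: `d^∇ (Ψ_* f^*α) = Ψ_* f^* (d^∇ α) + (∇Ψ) ∧ f^*α`, where `∇Ψ` is measured on
frames `e` by `∇_X (Ψ e) - Ψ (∇_{df X} e)`. The commutator of `d^∇` and `δ` is therefore the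
alternating sum of the terms `∇Ψ` of the faces.

For `i ≤ p` the face `f_i` keeps the last object, `Ψ` is the identification of equal fibres, and it
is parallel because pullback of connections is functorial (`covd_faceFiber_castSucc`). The last face
followed by the base map is `t ∘ pr`, and there `Ψ = pr^*φ`, whose derivative is `-pr^*Θ` by the
definition of `Θ` applied to a section pulled back from `M` (`covd_faceFiber_last`). The sign
`(-1)^(p+1)` of the last face turns `-Θ` into `(-1)^p Θ`.

The form `Θ` exists because the derivative terms of the Leibniz rules for `∇^t` and `∇^s` cancel,
which makes its defining expression tensorial; it is unique because every vector is the value of a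
differentiable section. If `Θ = 0`, the commutator vanishes. Conversely, the commutator for `p = q =
0`, applied to global smooth sections of `V` with prescribed values, recovers `Θ` at every arrow;
such sections come from bump functions, for which `M` has to be Hausdorff. Multiplicative forms are
preserved since `δ d^∇ α = d^∇ δ α = d^∇ 0 = 0`.

The analytic core is `extDeriv_eq_extCovDeriv_pullback`, which computes the ordinary exterior
derivative of a form obtained from a bundle-valued form by pulling back along a map `h` from a
normed space and trivializing its values. With `h` a map composed with an inverse chart it gives the
Leibniz rule above. With `h` an inverse chart it gives the formula for `d^∇` in a chart and
trivialization fixed near a point, hence the smoothness of `d^∇ α`; the definition alone uses a new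
chart at every point. -/

noncomputable section

/-! ### Alternating maps depending on a parameter: smoothness of pullbacks and a Leibniz rule -/

section AlternatingCalculus

variable {E E' F H : Type*} [NormedAddCommGroup E] [NormedSpace ℝ E] [NormedAddCommGroup E']
  [NormedSpace ℝ E'] [NormedAddCommGroup F] [NormedSpace ℝ F] [NormedAddCommGroup H]
  [NormedSpace ℝ H] {q : ℕ}

namespace ContinuousMultilinearMap

variable (E F q) in
/-- Alternatization of continuous multilinear maps as a continuous linear map. -/
def alternatizationL :
    (ContinuousMultilinearMap ℝ (fun _ : Fin q ↦ E) F) →L[ℝ] (E [⋀^Fin q]→L[ℝ] F) :=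
  LinearMap.mkContinuous
    { toFun := alternatization
      map_add' := map_add _
      map_smul' := fun r f ↦ by
        ext v
        simp [alternatization_apply_apply, Finset.smul_sum, smul_comm r] }
    -- The bound is the number of permutations: each summand has norm at most `‖f‖ * ∏ i, ‖v i‖`.
    (Nat.factorial q) fun f ↦ by
      refine ContinuousAlternatingMap.opNorm_le_bound _ (by positivity) fun v ↦ ?_
      simp only [LinearMap.coe_mk, AddHom.coe_mk, alternatization_apply_apply]
      refine (norm_sum_le_of_le _ (f := fun σ : Equiv.Perm (Fin q) ↦ σ.sign • f (v ∘ σ))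
        (n := fun _ ↦ ‖f‖ * ∏ i, ‖v i‖) fun σ _ ↦ ?_).trans ?_
      · have h1 : ‖σ.sign • f (v ∘ σ)‖ = ‖f (v ∘ σ)‖ := by
          rcases Int.units_eq_one_or σ.sign with h | h <;> simp [h]
        rw [h1, ← Equiv.prod_comp σ (fun i ↦ ‖v i‖)]
        exact f.le_opNorm _
      · simp [Fintype.card_perm, mul_assoc]

/-- All `q!` signed permutations of an alternating map agree. Up to this factor, alternatization is
thus a continuous linear left inverse of the inclusion of alternating into multilinear maps, and
smoothness can be checked for multilinear maps. -/
lemma alternatizationL_coe (f : E [⋀^Fin q]→L[ℝ] F) :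
    alternatizationL E F q f.toContinuousMultilinearMap = (Nat.factorial q : ℝ) • f := by
  ext v
  have h (σ : Equiv.Perm (Fin q)) : σ.sign • f (v ∘ σ) = f v := by
    have := f.toAlternatingMap.map_perm v σ
    change f (v ∘ σ) = σ.sign • f v at this
    rw [this, smul_smul, Int.units_mul_self, one_smul]
  change alternatization f.toContinuousMultilinearMap v = _
  rw [alternatization_apply_apply]
  refine (Finset.sum_congr rfl fun σ _ ↦ h σ).trans ?_
  simp [Fintype.card_perm, Nat.cast_smul_eq_nsmul]

end ContinuousMultilinearMap

-- As a multilinear map the pullback is linear in `α` and multilinear in `q` copies of `g`, hence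
-- smooth in both. Alternatization divided by `q!` carries this back to alternating maps.
open ContinuousMultilinearMap in
lemma ContDiffAt.continuousAlternatingMap_compContinuousLinearMap {n : WithTop ℕ∞}
    {α : H → E' [⋀^Fin q]→L[ℝ] F} {g : H → E →L[ℝ] E'} {u : H}
    (hα : ContDiffAt ℝ n α u) (hg : ContDiffAt ℝ n g u) :
    ContDiffAt ℝ n (fun x ↦ (α x).compContinuousLinearMap (g x)) u := by
  have h : (fun x ↦ (α x).compContinuousLinearMap (g x)) = fun x ↦
      ((Nat.factorial q : ℝ)⁻¹) • alternatizationL E F q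
        (compContinuousLinearMapContinuousMultilinear ℝ (fun _ : Fin q ↦ E) (fun _ : Fin q ↦ E') F
          (fun _ ↦ g x) (α x).toContinuousMultilinearMap) := by
    funext x
    have h1 : compContinuousLinearMapContinuousMultilinear ℝ (fun _ : Fin q ↦ E)
        (fun _ : Fin q ↦ E') F (fun _ ↦ g x) (α x).toContinuousMultilinearMap =
        ((α x).compContinuousLinearMap (g x)).toContinuousMultilinearMap := rfl
    rw [h1, alternatizationL_coe, smul_smul, inv_mul_cancel₀ (by positivity), one_smul]
  rw [h]
  refine ((alternatizationL E F q).contDiff.contDiffAt.comp u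
    (ContDiffAt.clm_apply ?_ ?_)).const_smul _
  · exact (ContinuousMultilinearMap.contDiff _).contDiffAt.comp u (contDiffAt_pi.2 fun _ ↦ hg)
  · exact (ContinuousAlternatingMap.toContinuousMultilinearMapCLM ℝ).contDiff.contDiffAt.comp u hα

lemma isBoundedBilinearMap_compContinuousAlternatingMap :
    IsBoundedBilinearMap ℝ fun z : (E' →L[ℝ] F) × (E [⋀^Fin q]→L[ℝ] E') ↦
      z.1.compContinuousAlternatingMap z.2 :=
  (ContinuousLinearMap.compContinuousAlternatingMapCLM ℝ E E' F (Fin q)).isBoundedBilinearMap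

lemma ContDiffAt.compContinuousAlternatingMap {n : WithTop ℕ∞} {P : H → E' →L[ℝ] F}
    {α : H → E [⋀^Fin q]→L[ℝ] E'} {u : H} (hP : ContDiffAt ℝ n P u) (hα : ContDiffAt ℝ n α u) :
    ContDiffAt ℝ n (fun x ↦ (P x).compContinuousAlternatingMap (α x)) u :=
  ContDiffAt.comp u (g := fun z : (E' →L[ℝ] F) × (E [⋀^Fin q]→L[ℝ] E') ↦
      z.1.compContinuousAlternatingMap z.2) (f := fun x ↦ (P x, α x))
    isBoundedBilinearMap_compContinuousAlternatingMap.contDiff.contDiffAt (hP.prodMk hα)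

/-- The Leibniz rule for the exterior derivative of `P α`, where the function `P` takes values in
linear maps. -/
lemma extDeriv_compContinuousAlternatingMap {P : H → E' →L[ℝ] F} {α : H → H [⋀^Fin q]→L[ℝ] E'}
    {u : H} (hP : DifferentiableAt ℝ P u) (hα : DifferentiableAt ℝ α u) (v : Fin (q + 1) → H) :
    extDeriv (fun x ↦ (P x).compContinuousAlternatingMap (α x)) u v =
      P u (extDeriv α u v) +
        ∑ i : Fin (q + 1), (-1 : ℝ) ^ (i : ℕ) • fderiv ℝ P u (v i) (α u (i.removeNth v)) := by
  have h1 : DifferentiableAt ℝ (fun x ↦ (P x).compContinuousAlternatingMap (α x)) u :=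
    DifferentiableAt.comp u (g := fun z : (E' →L[ℝ] F) × (H [⋀^Fin q]→L[ℝ] E') ↦
        z.1.compContinuousAlternatingMap z.2) (f := fun x ↦ (P x, α x))
      (isBoundedBilinearMap_compContinuousAlternatingMap.differentiableAt (P u, α u))
      (hP.prodMk hα)
  have h2 (w : Fin q → H) : DifferentiableAt ℝ (fun x ↦ α x w) u :=
    (ContinuousAlternatingMap.apply ℝ H E' w).differentiableAt.comp u hα
  rw [extDeriv_apply h1, extDeriv_apply hα, map_sum, ← Finset.sum_add_distrib]
  refine Finset.sum_congr rfl fun i _ ↦ ?_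
  have h3 : fderiv ℝ (fun x ↦ (P x).compContinuousAlternatingMap (α x) (i.removeNth v)) u (v i) =
      P u (fderiv ℝ (fun x ↦ α x (i.removeNth v)) u (v i)) +
        fderiv ℝ P u (v i) (α u (i.removeNth v)) := by
    have := fderiv_clm_apply hP (h2 (i.removeNth v))
    simp only [ContinuousLinearMap.compContinuousAlternatingMap_coe, Function.comp_apply]
    rw [this]
    simp
  rw [h3]
  simp [← Int.cast_smul_eq_zsmul ℝ]

end AlternatingCalculus

/-! ### Derivatives of maps between manifolds, on vectors of the model spaces -/

section ManifoldDerivative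

variable (E E' E'' : Type*) [NormedAddCommGroup E] [NormedSpace ℝ E] [NormedAddCommGroup E']
  [NormedSpace ℝ E'] [NormedAddCommGroup E''] [NormedSpace ℝ E'']
  {N N' N'' : Type*} [TopologicalSpace N] [ChartedSpace E N] [TopologicalSpace N']
  [ChartedSpace E' N'] [TopologicalSpace N''] [ChartedSpace E'' N'']

/-- The derivative of a map between manifolds, as a map between the model spaces. -/
def tderiv (f : N → N') (x : N) : E →L[ℝ] E' := mfderiv 𝓘(ℝ, E) 𝓘(ℝ, E') f x

lemma tderiv_comp {g : N' → N''} {f : N → N'} (x : N)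
    (hg : MDifferentiableAt 𝓘(ℝ, E') 𝓘(ℝ, E'') g (f x))
    (hf : MDifferentiableAt 𝓘(ℝ, E) 𝓘(ℝ, E') f x) (v : E) :
    tderiv E E'' (fun z ↦ g (f z)) x v = tderiv E' E'' g (f x) (tderiv E E' f x v) :=
  congr($(mfderiv_comp x hg hf) v)

lemma tderiv_eq_fderiv (f : E → E') (x : E) : tderiv E E' f x = fderiv ℝ f x := mfderiv_eq_fderiv

lemma tderiv_congr {f g : N → N'} {x : N} (h : f =ᶠ[nhds x] g) :
    tderiv E E' f x = tderiv E E' g x := by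
  have := h.mfderiv_eq (I := 𝓘(ℝ, E)) (I' := 𝓘(ℝ, E'))
  ext v
  exact congr($this v)

/-- Regularity of finite order at a point persists on a neighbourhood, whereas for order `∞` the
neighbourhood may shrink with the order; hence the passage through order `1`. -/
lemma ContMDiffAt.eventually_mdifferentiableAt [IsManifold 𝓘(ℝ, E) 1 N] [IsManifold 𝓘(ℝ, E') 1 N']
    {f : N → N'} {x : N} (hf : ContMDiffAt 𝓘(ℝ, E) 𝓘(ℝ, E') ∞ f x) :
    ∀ᶠ z in nhds x, MDifferentiableAt 𝓘(ℝ, E) 𝓘(ℝ, E') f z := by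
  have h1 : ContMDiffAt 𝓘(ℝ, E) 𝓘(ℝ, E') 1 f x := hf.of_le (by simp)
  rw [contMDiffAt_iff_contMDiffAt_nhds (by simp)] at h1
  exact h1.mono fun z hz ↦ hz.mdifferentiableAt (by simp)

variable {E}

lemma tderiv_chart_symm_tderiv_chart [IsManifold 𝓘(ℝ, E) ∞ N] {x z : N}
    (hz : z ∈ (chartAt E x).source) (v : E) :
    tderiv E E (chartAt E x).symm (chartAt E x z) (tderiv E E (chartAt E x) z v) = v := by
  have h : IsManifold 𝓘(ℝ, E) 1 N := .of_le (n := ∞) (by simp)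
  exact congr($((mdifferentiable_chart (I := 𝓘(ℝ, E)) x).symm_comp_deriv hz) v)

end ManifoldDerivative

/-! ### Bundle-valued forms in charts and trivializations -/

section FormsInCoordinates

variable {EN : Type*} [NormedAddCommGroup EN] [NormedSpace ℝ EN]
  {N : Type*} [TopologicalSpace N] [ChartedSpace EN N]
  {F : Type*} [NormedAddCommGroup F] [NormedSpace ℝ F]
  {W : N → Type*} [TopologicalSpace (TotalSpace F W)] [∀ x, AddCommGroup (W x)]
  [∀ x, Module ℝ (W x)] [∀ x, TopologicalSpace (W x)] [∀ x, IsTopologicalAddGroup (W x)]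
  [∀ x, ContinuousSMul ℝ (W x)] [FiberBundle F W] [VectorBundle ℝ F W]
  {q : ℕ}

/-- The value of a form at a point, on vectors of the model space. -/
def VForm.val (α : VForm EN W q) (x : N) : EN [⋀^Fin q]→L[ℝ] W x := α x

/-- `connectionTerm` on vectors of the model space. -/
def covTerm (D : CovariantDerivative 𝓘(ℝ, EN) F W) (x : N) : W x →ₗ[ℝ] EN →L[ℝ] W x :=
  connectionTerm D x

lemma VForm.coordForm_chart_apply (α : VForm EN W q) {x z : N} (hz : z ∈ (chartAt EN x).source)
    (w : Fin q → EN) :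
    α.coordForm F x (chartAt EN x z) w = (trivializationAt F W x).continuousLinearMapAt ℝ z
      (α.val z fun i ↦ tderiv EN EN (chartAt EN x).symm (chartAt EN x z) (w i)) := by
  -- The fibres at `(chartAt EN x).symm (chartAt EN x z)` and at `z` are different types.
  -- Generalizing the first point to a variable allows substitution.
  have key : ∀ z' : N, z' = z → ∀ w' : Fin q → EN,
      (trivializationAt F W x).continuousLinearMapAt ℝ z' (α.val z' w') =
      (trivializationAt F W x).continuousLinearMapAt ℝ z (α.val z w') := by
    rintro _ rfl _; rfl
  exact key _ ((chartAt EN x).left_inv hz) _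

lemma VForm.coordForm_apply (α : VForm EN W q) (x : N) (u : EN) (w : Fin q → EN) :
    α.coordForm F x u w = (trivializationAt F W x).continuousLinearMapAt ℝ ((chartAt EN x).symm u)
      (α.val ((chartAt EN x).symm u)
        fun i ↦ tderiv EN EN (chartAt EN x).symm u (w i)) := rfl

variable [IsManifold 𝓘(ℝ, EN) ∞ N]

lemma contMDiffAt_comp_chart_iff {G : Type*} [NormedAddCommGroup G] [NormedSpace ℝ G] {f : N → G}
    {g : EN → G} {x : N} (h : ∀ᶠ z in nhds x, f z = g (chartAt EN x z)) :
    ContMDiffAt 𝓘(ℝ, EN) 𝓘(ℝ, G) ∞ f x ↔ ContDiffAt ℝ ∞ g (chartAt EN x x) := by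
  have hx := mem_chart_source EN x
  have ht := (chartAt EN x).map_source hx
  constructor
  · intro hf
    have h1 : ContMDiffAt 𝓘(ℝ, EN) 𝓘(ℝ, EN) ∞ (chartAt EN x).symm (chartAt EN x x) :=
      (contMDiffOn_chart_symm (x := x)).contMDiffAt ((chartAt EN x).open_target.mem_nhds ht)
    have h2 : ContMDiffAt 𝓘(ℝ, EN) 𝓘(ℝ, G) ∞ (f ∘ (chartAt EN x).symm) (chartAt EN x x) :=
      ContMDiffAt.comp _ (by rwa [(chartAt EN x).left_inv hx]) h1
    refine h2.contDiffAt.congr_of_eventuallyEq ?_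
    have h3 := (chartAt EN x).symm.continuousAt (x := chartAt EN x x) ht
    rw [ContinuousAt, (chartAt EN x).left_inv hx] at h3
    filter_upwards [h3.eventually h, (chartAt EN x).open_target.mem_nhds ht] with u hu hu'
    rw [Function.comp_apply, hu, (chartAt EN x).right_inv hu']
  · intro hg
    have h1 : ContMDiffAt 𝓘(ℝ, EN) 𝓘(ℝ, EN) ∞ (chartAt EN x) x :=
      (contMDiffOn_chart (x := x)).contMDiffAt ((chartAt EN x).open_source.mem_nhds hx)
    exact (hg.contMDiffAt.comp x h1).congr_of_eventuallyEq h

lemma symmL_tangent_eq_mfderiv {x z : N} (hz : z ∈ (chartAt EN x).source) :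
    (trivializationAt EN (TangentSpace 𝓘(ℝ, EN)) x).symmL ℝ z =
      tderiv EN EN (chartAt EN x).symm (chartAt EN x z) := by
  have := TangentBundle.symmL_trivializationAt (I := 𝓘(ℝ, EN)) hz
  rw [this]
  simp only [modelWithCornersSelf_coe, range_id, mfderivWithin_univ]
  rfl

/-- The trivialization at `x` of the bundle of alternating maps conjugates by the trivializations of
`W` and of `TN`, and the latter is the derivative of the chart. In the chart this is exactly
`coordForm`. -/
lemma VForm.isSmooth_iff {α : VForm EN W q} :
    α.IsSmooth F ↔ ∀ x, ContDiffAt ℝ ∞ (α.coordForm F x) (chartAt EN x x) := by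
  refine forall_congr' fun x ↦ ?_
  rw [contMDiffAt_section]
  refine contMDiffAt_comp_chart_iff ?_
  filter_upwards [(chartAt EN x).open_source.mem_nhds (mem_chart_source EN x)] with z hz
  ext w
  rw [coordForm_chart_apply α hz, ← symmL_tangent_eq_mfderiv hz]
  rfl

lemma frameAt_symm_eq_symmL (x : N) (a : F) :
    (frameAt F W x).symm a = (trivializationAt F W x).symmL ℝ x a :=
  congrFun ((trivializationAt F W x).symm_continuousLinearEquivAt_eq
    (mem_baseSet_trivializationAt F W x)) a

lemma continuousLinearMapAt_eq_frameAt (x : N) (w : W x) :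
    (trivializationAt F W x).continuousLinearMapAt ℝ x w = frameAt F W x w := by
  rw [Trivialization.continuousLinearMapAt_apply,
    Trivialization.linearMapAt_apply, if_pos (mem_baseSet_trivializationAt F W x)]
  rfl

section Pullback

variable {E : Type*} [NormedAddCommGroup E] [NormedSpace ℝ E] {h : E → N} {u : E} {y : N}

/-- The centre `y` of the chart is kept apart from `h u`: in the applications `h` contains an
inverse chart, and `h u = y` is not a definitional equality. -/
lemma contDiffAt_chart_comp (hh : ContMDiffAt 𝓘(ℝ, E) 𝓘(ℝ, EN) ∞ h u) (hy : h u = y) :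
    ContDiffAt ℝ ∞ (fun z ↦ chartAt EN y (h z)) u := by
  subst hy
  have h1 : ContMDiffAt 𝓘(ℝ, EN) 𝓘(ℝ, EN) ∞ (chartAt EN (h u)) (h u) :=
    (contMDiffOn_chart (x := h u)).contMDiffAt
      ((chartAt EN (h u)).open_source.mem_nhds (mem_chart_source EN (h u)))
  exact (h1.comp u hh).contDiffAt

lemma fderiv_chart_comp {z : E} (hz : h z ∈ (chartAt EN y).source)
    (hd : MDifferentiableAt 𝓘(ℝ, E) 𝓘(ℝ, EN) h z) (w : E) :
    fderiv ℝ (fun z ↦ chartAt EN y (h z)) z w =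
      tderiv EN EN (chartAt EN y) (h z) (tderiv E EN h z w) := by
  have hN : IsManifold 𝓘(ℝ, EN) 1 N := .of_le (n := ∞) (by simp)
  rw [← tderiv_eq_fderiv]
  exact tderiv_comp E EN EN z
    ((mdifferentiable_chart (I := 𝓘(ℝ, EN)) y).mdifferentiableAt hz) hd w

/-- A form on a normed space obtained from a `W`-valued form by pulling back along a smooth map `h`
and mapping the values to `F` by linear maps `Ψ`, expressed by the coordinates of the form. -/
lemma eventuallyEq_comp_coordForm {α : VForm EN W q}
    (hh : ContMDiffAt 𝓘(ℝ, E) 𝓘(ℝ, EN) ∞ h u) (hy : h u = y) (Ψ : ∀ z, W (h z) →L[ℝ] F)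
    {β : E → E [⋀^Fin q]→L[ℝ] F}
    (hβ : ∀ᶠ z in nhds u, ∀ w, β z w = Ψ z (α.val (h z) fun i ↦ tderiv E EN h z (w i))) :
    β =ᶠ[nhds u] fun z ↦
      (Ψ z ∘L (trivializationAt F W y).symmL ℝ (h z)).compContinuousAlternatingMap
      ((α.coordForm F y (chartAt EN y (h z))).compContinuousLinearMap
        (fderiv ℝ (fun z ↦ chartAt EN y (h z)) z)) := by
  have hN : IsManifold 𝓘(ℝ, EN) 1 N := .of_le (n := ∞) (by simp)
  have hys : h u ∈ (chartAt EN y).source := hy ▸ mem_chart_source EN (h u)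
  have hyb : h u ∈ (trivializationAt F W y).baseSet :=
    hy ▸ mem_baseSet_trivializationAt F W (h u)
  filter_upwards [hβ, hh.eventually_mdifferentiableAt,
    hh.continuousAt.preimage_mem_nhds ((chartAt EN y).open_source.mem_nhds hys),
    hh.continuousAt.preimage_mem_nhds
      ((trivializationAt F W y).open_baseSet.mem_nhds hyb)] with z h1 h2 h3 h4
  ext w
  rw [h1]
  change _ = Ψ z ((trivializationAt F W y).symmL ℝ (h z)
    (α.coordForm F y (chartAt EN y (h z)) fun i ↦
      fderiv ℝ (fun z ↦ chartAt EN y (h z)) z (w i)))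
  rw [VForm.coordForm_chart_apply α h3, Trivialization.symmL_continuousLinearMapAt _ h4]
  simp only [fderiv_chart_comp h3 h2, tderiv_chart_symm_tderiv_chart h3]

/-- Near `u` the form `β` is `P · k^*Ω`, where `Ω` is `α` in coordinates, `k` is `h` in the chart
and `P` is `Ψ` in the trivialization; all three are smooth. -/
lemma contDiffAt_of_eq_pullback {α : VForm EN W q} (hα : α.IsSmooth F)
    (hh : ContMDiffAt 𝓘(ℝ, E) 𝓘(ℝ, EN) ∞ h u) (hy : h u = y) (Ψ : ∀ z, W (h z) →L[ℝ] F)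
    (hP : ContDiffAt ℝ ∞ (fun z ↦ Ψ z ∘L (trivializationAt F W y).symmL ℝ (h z)) u)
    {β : E → E [⋀^Fin q]→L[ℝ] F}
    (hβ : ∀ᶠ z in nhds u, ∀ w, β z w = Ψ z (α.val (h z) fun i ↦ tderiv E EN h z (w i))) :
    ContDiffAt ℝ ∞ β u := by
  have hkc := contDiffAt_chart_comp hh hy
  have hΩd := VForm.isSmooth_iff.1 hα y
  have hΩk : ContDiffAt ℝ ∞ (fun z ↦ α.coordForm F y (chartAt EN y (h z))) u :=
    ContDiffAt.comp u (g := α.coordForm F y) (f := fun z ↦ chartAt EN y (h z))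
      (by subst hy; exact hΩd) hkc
  have hdk : ContDiffAt ℝ ∞ (fderiv ℝ fun z ↦ chartAt EN y (h z)) u :=
    hkc.fderiv_right (m := ∞) (by simp)
  have h1 := hΩk.continuousAlternatingMap_compContinuousLinearMap hdk
  exact (hP.compContinuousAlternatingMap h1).congr_of_eventuallyEq
    (eventuallyEq_comp_coordForm hh hy Ψ hβ)

variable [FiniteDimensional ℝ F]

/-- In the term `A ∧ α` the chart and the frame at `x` cancel against their inverses, so only the
derivative term still refers to coordinates. -/
lemma extCovDeriv_val_apply (D : CovariantDerivative 𝓘(ℝ, EN) F W) (α : VForm EN W q) (x : N)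
    (m : Fin (q + 1) → EN) :
    (extCovDeriv D α).val x m =
      (frameAt F W x).symm (extDeriv (α.coordForm F x) (chartAt EN x x)
        (fun i ↦ tderiv EN EN (chartAt EN x) x (m i))) +
      ∑ i : Fin (q + 1), (-1 : ℝ) ^ (i : ℕ) • covTerm D x (α.val x (i.removeNth m)) (m i) := by
  have hx := mem_chart_source EN x
  have hc : ∀ (v : EN) (w : Fin q → EN),
      (frameAt F W x).symm (christoffel D x (tderiv EN EN (chartAt EN x) x v)
        (α.coordForm F x (chartAt EN x x) (fun j ↦ tderiv EN EN (chartAt EN x) x (w j)))) =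
      covTerm D x (α.val x w) v := by
    intro v w
    change (frameAt F W x).symm (frameAt F W x (covTerm D x ((frameAt F W x).symm
      (α.coordForm F x (chartAt EN x x) (fun j ↦ tderiv EN EN (chartAt EN x) x (w j))))
      (tderiv EN EN (chartAt EN x).symm (chartAt EN x x) (tderiv EN EN (chartAt EN x) x v)))) = _
    rw [VForm.coordForm_chart_apply α hx, continuousLinearMapAt_eq_frameAt]
    simp only [tderiv_chart_symm_tderiv_chart hx, ContinuousLinearEquiv.symm_apply_apply]
  have h1 : (extCovDeriv D α).val x m = (frameAt F W x).symm
      (extDeriv (α.coordForm F x) (chartAt EN x x)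
        (fun i ↦ tderiv EN EN (chartAt EN x) x (m i)) +
      ContinuousAlternatingMap.alternatizeUncurryFin
        (((ContinuousLinearMap.compContinuousAlternatingMapCLM ℝ EN F F (Fin q)).flip
          (α.coordForm F x (chartAt EN x x))) ∘L christoffel D x)
        (fun i ↦ tderiv EN EN (chartAt EN x) x (m i))) := rfl
  rw [h1, ContinuousAlternatingMap.alternatizeUncurryFin_apply, map_add, map_sum]
  congr 1
  refine Finset.sum_congr rfl fun i _ ↦ ?_
  rw [← Int.cast_smul_eq_zsmul ℝ, map_smul, ← hc]
  push_cast
  rfl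

/-- The exterior derivative of a form on a normed space obtained from a `W`-valued form by pulling
back along a smooth map `h` and mapping the values to `F` by linear maps `Ψ`. -/
lemma extDeriv_eq_extCovDeriv_pullback (D : CovariantDerivative 𝓘(ℝ, EN) F W) {α : VForm EN W q}
    (hα : α.IsSmooth F) (hh : ContMDiffAt 𝓘(ℝ, E) 𝓘(ℝ, EN) ∞ h u) (hy : h u = y)
    (Ψ : ∀ z, W (h z) →L[ℝ] F) {Ψ₀ : W y →L[ℝ] F}
    (hΨ₀ : ∀ σ : ∀ z, W z, Ψ u (σ (h u)) = Ψ₀ (σ y))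
    (hP : DifferentiableAt ℝ (fun z ↦ Ψ z ∘L (trivializationAt F W y).symmL ℝ (h z)) u)
    {β : E → E [⋀^Fin q]→L[ℝ] F}
    (hβ : ∀ᶠ z in nhds u, ∀ w, β z w = Ψ z (α.val (h z) fun i ↦ tderiv E EN h z (w i)))
    (v : Fin (q + 1) → E) :
    extDeriv β u v =
      Ψ₀ ((extCovDeriv D α).val y fun i ↦ tderiv E EN h u (v i)) +
      ∑ i : Fin (q + 1), (-1 : ℝ) ^ (i : ℕ) •
        (fderiv ℝ (fun z ↦ Ψ z ∘L (trivializationAt F W y).symmL ℝ (h z)) u (v i)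
          (frameAt F W y (α.val y fun j ↦ tderiv E EN h u (i.removeNth v j))) -
        Ψ₀ (covTerm D y (α.val y fun j ↦ tderiv E EN h u (i.removeNth v j))
          (tderiv E EN h u (v i)))) := by
  have hN : IsManifold 𝓘(ℝ, EN) 1 N := .of_le (n := ∞) (by simp)
  have hev := eventuallyEq_comp_coordForm hh hy Ψ hβ
  subst hy
  set P : E → F →L[ℝ] F := fun z ↦ Ψ z ∘L (trivializationAt F W (h u)).symmL ℝ (h z) with hPdef
  let Ω := α.coordForm F (h u)
  let k : E → EN := fun z ↦ chartAt EN (h u) (h z)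
  have hPu : ∀ a, P u a = Ψ₀ ((frameAt F W (h u)).symm a) := fun a ↦ by
    rw [frameAt_symm_eq_symmL]
    exact hΨ₀ fun z ↦ (trivializationAt F W (h u)).symmL ℝ z a
  have hys : h u ∈ (chartAt EN (h u)).source := mem_chart_source EN (h u)
  have hkc : ContDiffAt ℝ ∞ k u := contDiffAt_chart_comp hh rfl
  have hΩd : ContDiffAt ℝ ∞ Ω (k u) := VForm.isSmooth_iff.1 hα (h u)
  have hfd0 : ∀ w, fderiv ℝ k u w = _ :=
    fderiv_chart_comp hys hh.eventually_mdifferentiableAt.self_of_nhds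
  -- Near `u`, `β = P · k^*Ω`. The Leibniz rule splits off the derivative of `P`, and naturality of
  -- `d` under `k` leaves `P · k^*(dΩ)`.
  rw [hev.extDeriv_eq, extDeriv_compContinuousAlternatingMap hP]
  swap
  · refine ((hΩd.comp u hkc).differentiableAt
      (by simp)).continuousAlternatingMapCompContinuousLinearMap ?_
    exact (hkc.fderiv_right (m := 1)
      (by rw [one_add_one_eq_two]; exact ENat.LEInfty.out)).differentiableAt (by simp)
  rw [extDeriv_pullback (r := ∞) (hΩd.differentiableAt (by simp)) hkc
    (by simpa using ENat.LEInfty.out)]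
  -- At `h u` the form `dΩ` is `d^∇ α` without its connection term, which is therefore subtracted.
  have hT1 : P u ((extDeriv Ω (k u)).compContinuousLinearMap (fderiv ℝ k u) v) =
      Ψ₀ ((extCovDeriv D α).val (h u) fun i ↦ tderiv E EN h u (v i)) -
      ∑ i : Fin (q + 1), (-1 : ℝ) ^ (i : ℕ) • Ψ₀ (covTerm D (h u)
          (α.val (h u) fun j ↦ tderiv E EN h u (i.removeNth v j)) (tderiv E EN h u (v i))) := by
    rw [extCovDeriv_val_apply, map_add, map_sum, eq_sub_iff_add_eq, hPu]
    simp only [map_smul, ← hfd0]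
    rfl
  have hT2 : ∀ i : Fin (q + 1), (Ω (k u)).compContinuousLinearMap (fderiv ℝ k u) (i.removeNth v) =
      frameAt F W (h u) (α.val (h u) fun j ↦ tderiv E EN h u (i.removeNth v j)) := by
    intro i
    change α.coordForm F (h u) (chartAt EN (h u) (h u)) (fun j ↦ fderiv ℝ k u (i.removeNth v j)) = _
    rw [VForm.coordForm_chart_apply α hys, continuousLinearMapAt_eq_frameAt]
    simp only [hfd0, tderiv_chart_symm_tderiv_chart hys]
  have key : ∀ a b c : F, a - b + c = a + (c - b) := fun a b c ↦ by abel
  rw [hT1]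
  simp only [← hT2, smul_sub, Finset.sum_sub_distrib]
  exact key _ _ _

end Pullback

end FormsInCoordinates

/-! ### Connections in local frames -/

section ConnectionsInFrames

variable {EN : Type*} [NormedAddCommGroup EN] [NormedSpace ℝ EN]
  {N : Type*} [TopologicalSpace N] [ChartedSpace EN N]
  {F : Type*} [NormedAddCommGroup F] [NormedSpace ℝ F]
  {W : N → Type*} [TopologicalSpace (TotalSpace F W)] [∀ x, AddCommGroup (W x)]
  [∀ x, Module ℝ (W x)] [∀ x, TopologicalSpace (W x)] [∀ x, IsTopologicalAddGroup (W x)]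
  [∀ x, ContinuousSMul ℝ (W x)] [FiberBundle F W] [VectorBundle ℝ F W]

/-- The value of the covariant derivative on vectors of the model space. -/
def covd (D : CovariantDerivative 𝓘(ℝ, EN) F W) (σ : ∀ x, W x) (x : N) : EN →L[ℝ] W x := D σ x

lemma covTerm_apply (D : CovariantDerivative 𝓘(ℝ, EN) F W) (x : N) (w : W x) :
    covTerm D x w = covd D (frameSection x (frameAt F W x w)) x := rfl

lemma covd_congr (D : CovariantDerivative 𝓘(ℝ, EN) F W) {σ τ : ∀ x, W x} {x : N}
    (hσ : MDifferentiableAt 𝓘(ℝ, EN) (𝓘(ℝ, EN).prod 𝓘(ℝ, F)) (fun z ↦ TotalSpace.mk' F z (σ z)) x)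
    (hτ : MDifferentiableAt 𝓘(ℝ, EN) (𝓘(ℝ, EN).prod 𝓘(ℝ, F)) (fun z ↦ TotalSpace.mk' F z (τ z)) x)
    (h : ∀ᶠ z in nhds x, σ z = τ z) : covd D σ x = covd D τ x :=
  D.isCovariantDerivativeOnUniv.congr_of_eventuallyEq hσ hτ Filter.univ_mem h

lemma continuousLinearMapAt_eq_snd {x₀ x : N} (hx : x ∈ (trivializationAt F W x₀).baseSet)
    (w : W x) :
    (trivializationAt F W x₀).continuousLinearMapAt ℝ x w = (trivializationAt F W x₀ ⟨x, w⟩).2 := by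
  rw [Trivialization.continuousLinearMapAt_apply,
    Trivialization.linearMapAt_apply, if_pos hx]

lemma continuousLinearMapAt_frameSection {x₀ x : N}
    (hx : x ∈ (trivializationAt F W x₀).baseSet) (a : F) :
    (trivializationAt F W x₀).continuousLinearMapAt ℝ x (frameSection x₀ a x) = a :=
  (trivializationAt F W x₀).continuousLinearMapAt_symmL hx a

lemma frameSection_self (x : N) (w : W x) : frameSection x (frameAt F W x w) x = w := by
  have := (frameAt F W x).symm_apply_apply w
  rwa [frameAt_symm_eq_symmL] at this

lemma eventually_mem_baseSet {x₀ x : N} (hx : x ∈ (trivializationAt F W x₀).baseSet) :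
    ∀ᶠ z in nhds x, z ∈ (trivializationAt F W x₀).baseSet :=
  (trivializationAt F W x₀).open_baseSet.mem_nhds hx

variable [IsManifold 𝓘(ℝ, EN) ∞ N] [ContMDiffVectorBundle ∞ F W 𝓘(ℝ, EN)]

lemma contMDiffAt_section_iff_clm {n : WithTop ℕ∞} [ContMDiffVectorBundle n F W 𝓘(ℝ, EN)]
    {x₀ x : N} (hx : x ∈ (trivializationAt F W x₀).baseSet) {σ : ∀ x, W x} :
    ContMDiffAt 𝓘(ℝ, EN) (𝓘(ℝ, EN).prod 𝓘(ℝ, F)) n (fun z ↦ TotalSpace.mk' F z (σ z)) x ↔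
      ContMDiffAt 𝓘(ℝ, EN) 𝓘(ℝ, F) n
        (fun z ↦ (trivializationAt F W x₀).continuousLinearMapAt ℝ z (σ z)) x := by
  rw [(trivializationAt F W x₀).contMDiffAt_section_iff hx]
  refine Filter.EventuallyEq.contMDiffAt_iff ?_
  filter_upwards [eventually_mem_baseSet hx] with z hz
  rw [continuousLinearMapAt_eq_snd hz]

lemma mdifferentiableAt_section_iff_clm
    {x₀ x : N} (hx : x ∈ (trivializationAt F W x₀).baseSet) {σ : ∀ x, W x} :
    MDifferentiableAt 𝓘(ℝ, EN) (𝓘(ℝ, EN).prod 𝓘(ℝ, F)) (fun z ↦ TotalSpace.mk' F z (σ z)) x ↔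
      MDifferentiableAt 𝓘(ℝ, EN) 𝓘(ℝ, F)
        (fun z ↦ (trivializationAt F W x₀).continuousLinearMapAt ℝ z (σ z)) x := by
  rw [(trivializationAt F W x₀).mdifferentiableAt_section_iff 𝓘(ℝ, EN) σ hx]
  refine Filter.EventuallyEq.mdifferentiableAt_iff ?_
  filter_upwards [eventually_mem_baseSet hx] with z hz
  rw [continuousLinearMapAt_eq_snd hz]

lemma contMDiffAt_frameSection {x₀ x : N} (hx : x ∈ (trivializationAt F W x₀).baseSet) (a : F) :
    ContMDiffAt 𝓘(ℝ, EN) (𝓘(ℝ, EN).prod 𝓘(ℝ, F)) ∞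
      (fun z ↦ TotalSpace.mk' F z (frameSection (V := W) x₀ a z)) x := by
  rw [contMDiffAt_section_iff_clm hx]
  refine (contMDiffAt_const (c := a)).congr_of_eventuallyEq ?_
  filter_upwards [eventually_mem_baseSet hx] with z hz
  exact continuousLinearMapAt_frameSection hz a

lemma mdifferentiableAt_frameSection_of_mem {x₀ x : N}
    (hx : x ∈ (trivializationAt F W x₀).baseSet) (a : F) :
    MDifferentiableAt 𝓘(ℝ, EN) (𝓘(ℝ, EN).prod 𝓘(ℝ, F))
      (fun z ↦ TotalSpace.mk' F z (frameSection (V := W) x₀ a z)) x :=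
  (contMDiffAt_frameSection hx a).mdifferentiableAt (by simp)

variable [FiniteDimensional ℝ F]

/-- A covariant derivative in the preferred trivialization at `x₀`: `∇σ = dσ + Aσ`. -/
lemma covd_eq (D : CovariantDerivative 𝓘(ℝ, EN) F W) {x₀ x : N}
    (hx : x ∈ (trivializationAt F W x₀).baseSet) {σ : ∀ x, W x}
    (hσ : MDifferentiableAt 𝓘(ℝ, EN) (𝓘(ℝ, EN).prod 𝓘(ℝ, F))
      (fun z ↦ TotalSpace.mk' F z (σ z)) x) :
    covd D σ x = (trivializationAt F W x₀).symmL ℝ x ∘L tderiv EN F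
        (fun z ↦ (trivializationAt F W x₀).continuousLinearMapAt ℝ z (σ z)) x +
      covd D (frameSection x₀ ((trivializationAt F W x₀).continuousLinearMapAt ℝ x (σ x))) x := by
  have hN : IsManifold 𝓘(ℝ, EN) 1 N := .of_le (n := ∞) (by simp)
  set e := trivializationAt F W x₀ with he
  have hsec : ∀ {σ : ∀ x, W x}, MDifferentiableAt 𝓘(ℝ, EN) (𝓘(ℝ, EN).prod 𝓘(ℝ, F))
      (fun z ↦ TotalSpace.mk' F z (σ z)) x → MDifferentiableAt 𝓘(ℝ, EN) 𝓘(ℝ, F)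
      (fun z ↦ e.continuousLinearMapAt ℝ z (σ z)) x :=
    fun h ↦ (mdifferentiableAt_section_iff_clm hx).1 h
  -- The difference of `∇` and the flat derivative of the trivialization is tensorial, so it depends
  -- only on `σ x`. It may be evaluated on the section with this value that is constant in the
  -- trivialization, where the flat derivative vanishes.
  let Φ : (∀ x, W x) → (EN →L[ℝ] W x) := fun σ ↦ covd D σ x - e.symmL ℝ x ∘L tderiv EN F
    (fun z ↦ e.continuousLinearMapAt ℝ z (σ z)) x
  have hΦ : TensorialAt 𝓘(ℝ, EN) F Φ x := by
    constructor
    · intro f σ hf hσ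
      ext v
      have h1 : covd D (f • σ) x v = f x • covd D σ x v + mvfderiv 𝓘(ℝ, EN) f x v • σ x :=
        congr($(D.isCovariantDerivativeOnUniv.leibniz hσ hf) v)
      have h2 : tderiv EN F (fun z ↦ e.continuousLinearMapAt ℝ z ((f • σ) z)) x v =
          f x • tderiv EN F (fun z ↦ e.continuousLinearMapAt ℝ z (σ z)) x v +
          mvfderiv 𝓘(ℝ, EN) f x v • e.continuousLinearMapAt ℝ x (σ x) := by
        have h3 : (fun z ↦ e.continuousLinearMapAt ℝ z ((f • σ) z)) =
            f • fun z ↦ e.continuousLinearMapAt ℝ z (σ z) := by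
          funext z; exact map_smul _ _ _
        rw [h3]
        exact congr($(mvfderiv_smul hf (hsec hσ)) v)
      change covd D (f • σ) x v - e.symmL ℝ x (tderiv EN F _ x v) =
        f x • (covd D σ x v - e.symmL ℝ x (tderiv EN F _ x v))
      rw [h1, h2, map_add, map_smul, map_smul, e.symmL_continuousLinearMapAt hx, smul_sub]
      abel
    · intro σ τ hσ hτ
      ext v
      have h1 : covd D (σ + τ) x v = covd D σ x v + covd D τ x v :=
        congr($(D.isCovariantDerivativeOnUniv.add hσ hτ) v)
      have h2 : tderiv EN F (fun z ↦ e.continuousLinearMapAt ℝ z ((σ + τ) z)) x v =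
          tderiv EN F (fun z ↦ e.continuousLinearMapAt ℝ z (σ z)) x v +
          tderiv EN F (fun z ↦ e.continuousLinearMapAt ℝ z (τ z)) x v := by
        have h3 : (fun z ↦ e.continuousLinearMapAt ℝ z ((σ + τ) z)) =
            (fun z ↦ e.continuousLinearMapAt ℝ z (σ z)) +
              fun z ↦ e.continuousLinearMapAt ℝ z (τ z) := by
          funext z; exact map_add _ _ _
        rw [h3]
        exact congr($(mvfderiv_add (hsec hσ) (hsec hτ)) v)
      change covd D (σ + τ) x v - e.symmL ℝ x (tderiv EN F _ x v) =
        (covd D σ x v - e.symmL ℝ x (tderiv EN F _ x v)) +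
        (covd D τ x v - e.symmL ℝ x (tderiv EN F _ x v))
      rw [h1, h2, map_add]
      abel
  have h1 := hΦ.pointwise hσ (mdifferentiableAt_frameSection_of_mem hx
    (e.continuousLinearMapAt ℝ x (σ x))) (by
      rw [frameSection]; exact (e.symmL_continuousLinearMapAt hx _).symm)
  have h2 : tderiv EN F (fun z ↦ e.continuousLinearMapAt ℝ z (frameSection x₀
      (e.continuousLinearMapAt ℝ x (σ x)) z)) x = 0 := by
    rw [tderiv_congr EN F (g := fun _ ↦ e.continuousLinearMapAt ℝ x (σ x))]
    · exact mfderiv_const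
    · filter_upwards [eventually_mem_baseSet hx] with z hz
      exact continuousLinearMapAt_frameSection hz _
  simp only [Φ, h2, ContinuousLinearMap.comp_zero, sub_zero] at h1
  rw [← h1]
  abel

lemma covd_eq_self (D : CovariantDerivative 𝓘(ℝ, EN) F W) {x : N} {σ : ∀ x, W x}
    (hσ : MDifferentiableAt 𝓘(ℝ, EN) (𝓘(ℝ, EN).prod 𝓘(ℝ, F))
      (fun z ↦ TotalSpace.mk' F z (σ z)) x) (v : EN) :
    covd D σ x v = (frameAt F W x).symm (tderiv EN F
        (fun z ↦ (trivializationAt F W x).continuousLinearMapAt ℝ z (σ z)) x v) +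
      covTerm D x (σ x) v := by
  rw [covd_eq D (mem_baseSet_trivializationAt F W x) hσ, frameAt_symm_eq_symmL, covTerm_apply,
    continuousLinearMapAt_eq_frameAt]
  rfl

end ConnectionsInFrames

/-! ### Pullback connections: frames, sections and functoriality -/

section PullbackConnections

variable {EM : Type*} [NormedAddCommGroup EM] [NormedSpace ℝ EM]
  {M : Type*} [TopologicalSpace M] [ChartedSpace EM M]
  {EN : Type*} [NormedAddCommGroup EN] [NormedSpace ℝ EN]
  {N : Type*} [TopologicalSpace N] [ChartedSpace EN N]
  {EN' : Type*} [NormedAddCommGroup EN'] [NormedSpace ℝ EN']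
  {N' : Type*} [TopologicalSpace N'] [ChartedSpace EN' N']
  {F : Type*} [NormedAddCommGroup F] [NormedSpace ℝ F]
  {V : M → Type*} [TopologicalSpace (TotalSpace F V)] [∀ x, AddCommGroup (V x)]
  [∀ x, Module ℝ (V x)] [∀ x, TopologicalSpace (V x)] [∀ x, IsTopologicalAddGroup (V x)]
  [∀ x, ContinuousSMul ℝ (V x)] [FiberBundle F V] [VectorBundle ℝ F V]

lemma frameSection_continuousLinearMapAt {W : N → Type*} [TopologicalSpace (TotalSpace F W)]
    [∀ x, AddCommGroup (W x)] [∀ x, Module ℝ (W x)] [∀ x, TopologicalSpace (W x)]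
    [FiberBundle F W] [VectorBundle ℝ F W] {x₀ x : N}
    (hx : x ∈ (trivializationAt F W x₀).baseSet) (w : W x) :
    frameSection x₀ ((trivializationAt F W x₀).continuousLinearMapAt ℝ x w) x = w :=
  (trivializationAt F W x₀).symmL_continuousLinearMapAt hx w

lemma fiberTransport_section (σ : ∀ x, V x) {x y : M} (h : x = y) :
    fiberTransport V h (σ x) = σ y := by
  subst h; rfl

lemma mem_baseSet_pullback {f : C^∞⟮𝓘(ℝ, EN), N; 𝓘(ℝ, EM), M⟯} {y₀ y : N} :
    y ∈ (trivializationAt F (f *ᵖ V) y₀).baseSet ↔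
      f y ∈ (trivializationAt F V (f y₀)).baseSet := Iff.rfl

lemma continuousLinearMapAt_pullback {f : C^∞⟮𝓘(ℝ, EN), N; 𝓘(ℝ, EM), M⟯} {y₀ y : N}
    (hy : f y ∈ (trivializationAt F V (f y₀)).baseSet) (w : V (f y)) :
    (trivializationAt F (f *ᵖ V) y₀).continuousLinearMapAt ℝ y w =
      (trivializationAt F V (f y₀)).continuousLinearMapAt ℝ (f y) w := by
  rw [continuousLinearMapAt_eq_snd hy]
  exact continuousLinearMapAt_eq_snd (mem_baseSet_pullback.2 hy) _

/-- The trivialization of `f^*V` at `y₀` is that of `V` at `f y₀`. Frames of pullback bundles can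
hence be differentiated as pullbacks of sections of `V`. -/
lemma frameSection_pullback {f : C^∞⟮𝓘(ℝ, EN), N; 𝓘(ℝ, EM), M⟯} {y₀ y : N}
    (hy : f y ∈ (trivializationAt F V (f y₀)).baseSet) (a : F) :
    frameSection (V := f *ᵖ V) y₀ a y = frameSection (V := V) (f y₀) a (f y) := by
  have h1 : (trivializationAt F (f *ᵖ V) y₀).continuousLinearMapAt ℝ y
      (frameSection (V := V) (f y₀) a (f y)) = a :=
    (continuousLinearMapAt_pullback hy _).trans (continuousLinearMapAt_frameSection hy a)
  have h2 := frameSection_continuousLinearMapAt (W := f *ᵖ V) (mem_baseSet_pullback.2 hy)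
    (frameSection (V := V) (f y₀) a (f y))
  exact (congrArg (fun b ↦ frameSection (V := f *ᵖ V) y₀ b y) h1).symm.trans h2

variable [IsManifold 𝓘(ℝ, EM) ∞ M] [IsManifold 𝓘(ℝ, EN) ∞ N] [IsManifold 𝓘(ℝ, EN') ∞ N']
  [ContMDiffVectorBundle ∞ F V 𝓘(ℝ, EM)]

/-- The pullback of a section is differentiable at a point if the section is. -/
lemma mdifferentiableAt_pullback_section {f : C^∞⟮𝓘(ℝ, EN), N; 𝓘(ℝ, EM), M⟯} {η : ∀ x, V x} {y : N}
    (hη : MDifferentiableAt 𝓘(ℝ, EM) (𝓘(ℝ, EM).prod 𝓘(ℝ, F))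
      (fun z ↦ TotalSpace.mk' F z (η z)) (f y)) :
    MDifferentiableAt 𝓘(ℝ, EN) (𝓘(ℝ, EN).prod 𝓘(ℝ, F))
      (fun z ↦ TotalSpace.mk' F (E := f *ᵖ V) z (η (f z))) y := by
  have hb := mem_baseSet_trivializationAt F V (f y)
  rw [mdifferentiableAt_section_iff_clm hb] at hη
  have hf : MDifferentiableAt 𝓘(ℝ, EN) 𝓘(ℝ, EM) f y := f.contMDiff.mdifferentiableAt (by simp)
  refine (mdifferentiableAt_section_iff_clm (W := f *ᵖ V)
    (mem_baseSet_trivializationAt F (f *ᵖ V) y)).2 ((hη.comp y hf).congr_of_eventuallyEq ?_)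
  filter_upwards [f.contMDiff.continuous.continuousAt.eventually (eventually_mem_baseSet hb)]
    with z hz
  exact continuousLinearMapAt_pullback hz _

lemma contMDiffAt_pullback_section {f : C^∞⟮𝓘(ℝ, EN), N; 𝓘(ℝ, EM), M⟯} {η : ∀ x, V x} {y : N}
    (hη : ContMDiffAt 𝓘(ℝ, EM) (𝓘(ℝ, EM).prod 𝓘(ℝ, F)) ∞
      (fun z ↦ TotalSpace.mk' F z (η z)) (f y)) :
    ContMDiffAt 𝓘(ℝ, EN) (𝓘(ℝ, EN).prod 𝓘(ℝ, F)) ∞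
      (fun z ↦ TotalSpace.mk' F (E := f *ᵖ V) z (η (f z))) y := by
  have hb := mem_baseSet_trivializationAt F V (f y)
  rw [contMDiffAt_section_iff_clm hb] at hη
  refine (contMDiffAt_section_iff_clm (W := f *ᵖ V)
    (mem_baseSet_trivializationAt F (f *ᵖ V) y)).2
    ((hη.comp y f.contMDiff.contMDiffAt).congr_of_eventuallyEq ?_)
  filter_upwards [f.contMDiff.continuous.continuousAt.eventually (eventually_mem_baseSet hb)]
    with z hz
  exact continuousLinearMapAt_pullback hz _

variable [FiniteDimensional ℝ F]

lemma covd_pullback_apply (D : CovariantDerivative 𝓘(ℝ, EM) F V)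
    (f : C^∞⟮𝓘(ℝ, EN), N; 𝓘(ℝ, EM), M⟯) (σ : ∀ y, (f *ᵖ V) y) (y : N) (v : EN) :
    covd (D.pullback f) σ y v = (frameAt F V (f y)).symm
      (tderiv EN F (fun z ↦ (trivializationAt F V (f y)).continuousLinearMapAt ℝ (f z) (σ z)) y v) +
      covTerm D (f y) (σ y) (tderiv EN EM f y v) := by
  have h : (fun z ↦ (trivializationAt F V (f y)).continuousLinearMapAt ℝ (f z) (σ z)) =ᶠ[nhds y]
      coordSection (F := F) f σ y := by
    filter_upwards [f.contMDiff.continuous.continuousAt.eventually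
      (eventually_mem_baseSet (mem_baseSet_trivializationAt F V (f y)))] with z hz
    exact continuousLinearMapAt_eq_snd hz _
  rw [tderiv_congr EN F h]
  rfl

/-- `∇^f (f^*η) = f^*(∇η)`. -/
lemma covd_pullback_section (D : CovariantDerivative 𝓘(ℝ, EM) F V)
    (f : C^∞⟮𝓘(ℝ, EN), N; 𝓘(ℝ, EM), M⟯) {η : ∀ x, V x} {y : N}
    (hη : MDifferentiableAt 𝓘(ℝ, EM) (𝓘(ℝ, EM).prod 𝓘(ℝ, F))
      (fun z ↦ TotalSpace.mk' F z (η z)) (f y)) (v : EN) :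
    covd (D.pullback f) (fun z ↦ η (f z)) y v = covd D η (f y) (tderiv EN EM f y v) := by
  have hb := mem_baseSet_trivializationAt F V (f y)
  refine (covd_pullback_apply D f _ y v).trans ?_
  rw [covd_eq_self D hη]
  have h1 := tderiv_comp EN EM F y ((mdifferentiableAt_section_iff_clm hb).1 hη)
    (f.contMDiff.mdifferentiableAt (by simp)) v
  exact congr((frameAt F V (f y)).symm $h1 + covTerm D (f y) (η (f y)) (tderiv EN EM f y v))

/-- The pullback of a connection along a composition `b = b' ∘ f`. -/
lemma covd_pullback_comp (D : CovariantDerivative 𝓘(ℝ, EM) F V)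
    {b : C^∞⟮𝓘(ℝ, EN), N; 𝓘(ℝ, EM), M⟯} {b' : C^∞⟮𝓘(ℝ, EN'), N'; 𝓘(ℝ, EM), M⟯} {f : N → N'}
    (hf : ContMDiff 𝓘(ℝ, EN) 𝓘(ℝ, EN') ∞ f) (hb : ∀ c, b' (f c) = b c)
    {σ : ∀ y, (b' *ᵖ V) y} {c : N}
    (hσ : MDifferentiableAt 𝓘(ℝ, EN') (𝓘(ℝ, EN').prod 𝓘(ℝ, F))
      (fun z ↦ TotalSpace.mk' F z (σ z)) (f c)) (v : EN) :
    covd (D.pullback b) (fun z ↦ fiberTransport V (hb z) (σ (f z))) c v =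
      fiberTransport V (hb c) (covd (D.pullback b') σ (f c) (tderiv EN EN' f c v)) := by
  -- Once `b` is literally `b' ∘ f`, the fibres coincide and the transports disappear. What remains
  -- is the chain rule, once for the coordinates of `σ` and once for `b'`.
  have hbeq : b = b'.comp ⟨f, hf⟩ := by
    ext z; exact (hb z).symm
  subst hbeq
  change covd (D.pullback (b'.comp ⟨f, hf⟩)) (fun z ↦ σ (f z)) c v =
    covd (D.pullback b') σ (f c) (tderiv EN EN' f c v)
  refine (covd_pullback_apply D (b'.comp ⟨f, hf⟩) (fun z ↦ σ (f z)) c v).trans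
    (Eq.trans ?_ (covd_pullback_apply D b' σ (f c) (tderiv EN EN' f c v)).symm)
  have hcb := mem_baseSet_trivializationAt F V (b' (f c))
  have h1 : MDifferentiableAt 𝓘(ℝ, EN') 𝓘(ℝ, F)
      (fun z ↦ (trivializationAt F V (b' (f c))).continuousLinearMapAt ℝ (b' z) (σ z)) (f c) := by
    refine ((mdifferentiableAt_section_iff_clm (W := b' *ᵖ V)
      (mem_baseSet_trivializationAt F (b' *ᵖ V) (f c))).1 hσ).congr_of_eventuallyEq ?_
    filter_upwards [b'.contMDiff.continuous.continuousAt.eventually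
      (eventually_mem_baseSet (mem_baseSet_trivializationAt F V (b' (f c))))] with z hz
    exact (continuousLinearMapAt_pullback hz _).symm
  have h2 : MDifferentiableAt 𝓘(ℝ, EN) 𝓘(ℝ, EN') f c := hf.mdifferentiableAt (by simp)
  have h3 := tderiv_comp EN EN' F c h1 h2 v
  have h4 := tderiv_comp EN EN' EM c (b'.contMDiff.mdifferentiableAt (by simp)) h2 v
  exact congr((frameAt F V (b' (f c))).symm $h3 + covTerm D (b' (f c)) (σ (f c)) $h4)

end PullbackConnections

/-! ### Linear maps on a finite-dimensional space, tested on vectors -/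

section FiniteDimensionalTarget

variable {E F G : Type*} [NormedAddCommGroup E] [NormedSpace ℝ E] [NormedAddCommGroup F]
  [NormedSpace ℝ F] [FiniteDimensional ℝ F] [NormedAddCommGroup G] [NormedSpace ℝ G]

/-- The values of a linear map on a basis determine the map as a sum of rank one operators. -/
lemma sum_coord_smulRight (L : F →ₗ[ℝ] G) :
    ∑ i, ((Module.finBasis ℝ F).coord i).toContinuousLinearMap.smulRight
      (L (Module.finBasis ℝ F i)) = L.toContinuousLinearMap := by
  ext a
  have h := congrArg L ((Module.finBasis ℝ F).sum_repr a)
  rw [map_sum] at h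
  simpa using h

lemma contDiffAt_sum_smulRight {ι : Type*} [Fintype ι] {n : WithTop ℕ∞} (c : ι → F →L[ℝ] ℝ)
    {g : ι → E → G} {u : E} (h : ∀ i, ContDiffAt ℝ n (g i) u) :
    ContDiffAt ℝ n (fun z ↦ ∑ i, (c i).smulRight (g i z)) u :=
  ContDiffAt.sum fun i _ ↦
    (ContinuousLinearMap.smulRightL ℝ F G (c i)).contDiff.contDiffAt.comp u (h i)

/-- Since `F` has finite dimension, `P z` is a finite sum of rank one operators built from its
values on a basis. -/
lemma contDiffAt_clm_of_apply {n : WithTop ℕ∞} {P : E → F →L[ℝ] G} {u : E}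
    (h : ∀ a, ContDiffAt ℝ n (fun z ↦ P z a) u) : ContDiffAt ℝ n P u := by
  have h1 : P = fun z ↦ ∑ i, ((Module.finBasis ℝ F).coord i).toContinuousLinearMap.smulRight
      (P z (Module.finBasis ℝ F i)) := by
    funext z
    exact (sum_coord_smulRight (P z : F →ₗ[ℝ] G)).symm
  rw [h1]
  exact contDiffAt_sum_smulRight _ fun i ↦ h _

end FiniteDimensionalTarget

/-! ### Smooth connection forms -/

section SmoothConnections

variable {EN : Type*} [NormedAddCommGroup EN] [NormedSpace ℝ EN]
  {N : Type*} [TopologicalSpace N] [ChartedSpace EN N]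
  {EM : Type*} [NormedAddCommGroup EM] [NormedSpace ℝ EM]
  {M : Type*} [TopologicalSpace M] [ChartedSpace EM M]
  {F : Type*} [NormedAddCommGroup F] [NormedSpace ℝ F]
  {W : N → Type*} [TopologicalSpace (TotalSpace F W)] [∀ x, AddCommGroup (W x)]
  [∀ x, Module ℝ (W x)] [∀ x, TopologicalSpace (W x)] [∀ x, IsTopologicalAddGroup (W x)]
  [∀ x, ContinuousSMul ℝ (W x)] [FiberBundle F W] [VectorBundle ℝ F W]
  {V : M → Type*} [TopologicalSpace (TotalSpace F V)] [∀ x, AddCommGroup (V x)]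
  [∀ x, Module ℝ (V x)] [∀ x, TopologicalSpace (V x)] [∀ x, IsTopologicalAddGroup (V x)]
  [∀ x, ContinuousSMul ℝ (V x)] [FiberBundle F V] [VectorBundle ℝ F V]

/-- The covariant derivative of a section in the preferred chart and trivialization at `x₀`. -/
def covdCoord (D : CovariantDerivative 𝓘(ℝ, EN) F W) (σ : ∀ x, W x) (x₀ : N) (u : EN) :
    EN →L[ℝ] F :=
  (trivializationAt F W x₀).continuousLinearMapAt ℝ ((chartAt EN x₀).symm u) ∘L
    covd D σ ((chartAt EN x₀).symm u) ∘L tderiv EN EN (chartAt EN x₀).symm u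

/-- The connection forms of `D` in the preferred charts and trivializations are smooth. -/
def CovariantDerivative.IsSmooth (D : CovariantDerivative 𝓘(ℝ, EN) F W) : Prop :=
  ∀ (x₀ : N) (a : F), ContDiffAt ℝ ∞ (covdCoord D (frameSection x₀ a) x₀) (chartAt EN x₀ x₀)

variable [IsManifold 𝓘(ℝ, EN) ∞ N] [IsManifold 𝓘(ℝ, EM) ∞ M]

lemma contMDiffAt_chart_symm (x : N) :
    ContMDiffAt 𝓘(ℝ, EN) 𝓘(ℝ, EN) ∞ (chartAt EN x).symm (chartAt EN x x) :=
  (contMDiffOn_chart_symm (x := x)).contMDiffAt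
    ((chartAt EN x).open_target.mem_nhds ((chartAt EN x).map_source (mem_chart_source EN x)))

lemma eventually_chart_symm {x : N} {p : N → Prop} (h : ∀ᶠ z in nhds x, p z) :
    ∀ᶠ u in nhds (chartAt EN x x), p ((chartAt EN x).symm u) :=
  (contMDiffAt_chart_symm x).continuousAt.eventually
    (by rwa [(chartAt EN x).left_inv (mem_chart_source EN x)])

variable [ContMDiffVectorBundle ∞ F W 𝓘(ℝ, EN)] [ContMDiffVectorBundle ∞ F V 𝓘(ℝ, EM)]

/-- A section of the bundle of linear maps `TN → W` is smooth if and only if it is smooth in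
coordinates. -/
lemma contMDiffAt_tangentHom_iff (A : ∀ x, TangentSpace 𝓘(ℝ, EN) x →L[ℝ] W x) (x₀ : N) :
    ContMDiffAt 𝓘(ℝ, EN) (𝓘(ℝ, EN).prod 𝓘(ℝ, EN →L[ℝ] F)) ∞
      (fun x ↦ (TotalSpace.mk' (EN →L[ℝ] F) x (A x) : TotalSpace (EN →L[ℝ] F)
        fun x ↦ TangentSpace 𝓘(ℝ, EN) x →L[ℝ] W x)) x₀ ↔
    ContDiffAt ℝ ∞ (fun u ↦ (trivializationAt F W x₀).continuousLinearMapAt ℝ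
      ((chartAt EN x₀).symm u) ∘L (show EN →L[ℝ] W ((chartAt EN x₀).symm u) from
        A ((chartAt EN x₀).symm u)) ∘L tderiv EN EN (chartAt EN x₀).symm u)
      (chartAt EN x₀ x₀) := by
  rw [contMDiffAt_section]
  refine contMDiffAt_comp_chart_iff ?_
  filter_upwards [(chartAt EN x₀).open_source.mem_nhds (mem_chart_source EN x₀)] with z hz
  ext w
  have key : ∀ z', z' = z → (trivializationAt F W x₀).continuousLinearMapAt ℝ z'
      ((show EN →L[ℝ] W z' from A z') (tderiv EN EN (chartAt EN x₀).symm (chartAt EN x₀ z) w)) =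
      (trivializationAt F W x₀).continuousLinearMapAt ℝ z
      ((show EN →L[ℝ] W z from A z) (tderiv EN EN (chartAt EN x₀).symm (chartAt EN x₀ z) w)) := by
    rintro _ rfl; rfl
  refine Eq.trans ?_ (key _ ((chartAt EN x₀).left_inv hz)).symm
  rw [← symmL_tangent_eq_mfderiv hz]
  rfl

variable [FiniteDimensional ℝ F]

lemma covdCoord_congr (D : CovariantDerivative 𝓘(ℝ, EN) F W) {σ τ : ∀ x, W x} {x₀ : N}
    (hσ : ContMDiffAt 𝓘(ℝ, EN) (𝓘(ℝ, EN).prod 𝓘(ℝ, F)) ∞ (fun z ↦ TotalSpace.mk' F z (σ z)) x₀)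
    (h : ∀ᶠ z in nhds x₀, σ z = τ z) :
    covdCoord D σ x₀ =ᶠ[nhds (chartAt EN x₀ x₀)] covdCoord D τ x₀ := by
  have hN : IsManifold 𝓘(ℝ, EN) 1 N := .of_le (n := ∞) (by simp)
  have hW : ContMDiffVectorBundle 1 F W 𝓘(ℝ, EN) := .of_le (n := ∞) (by simp)
  have hσ' : ContMDiffAt 𝓘(ℝ, EN) (𝓘(ℝ, EN).prod 𝓘(ℝ, F)) 1
    (fun z ↦ TotalSpace.mk' F z (σ z)) x₀ := hσ.of_le (by simp)
  rw [contMDiffAt_iff_contMDiffAt_nhds (by simp)] at hσ'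
  filter_upwards [eventually_chart_symm hσ', eventually_chart_symm h.eventually_nhds] with u h1 h2
  have h3 := h1.mdifferentiableAt (by simp)
  rw [covdCoord, covdCoord, covd_congr D h3 (h3.congr_of_eventuallyEq ?_) h2]
  filter_upwards [h2] with z hz
  rw [hz]

/-- There is a global smooth section that agrees near `x₀` with a section constant in the
preferred trivialization. -/
lemma exists_contMDiff_section_eq_frameSection [FiniteDimensional ℝ EN] [T2Space N] (x₀ : N)
    (a : F) : ∃ τ : ∀ x, W x, ContMDiff 𝓘(ℝ, EN) (𝓘(ℝ, EN).prod 𝓘(ℝ, F)) ∞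
      (fun z ↦ TotalSpace.mk' F z (τ z)) ∧ ∀ᶠ z in nhds x₀, frameSection x₀ a z = τ z := by
  have hb := eventually_mem_baseSet (mem_baseSet_trivializationAt F W x₀)
  obtain ⟨f, -, hf⟩ : ∃ f : SmoothBumpFunction 𝓘(ℝ, EN) x₀, True ∧
      tsupport f ⊆ (trivializationAt F W x₀).baseSet :=
    (SmoothBumpFunction.nhds_basis_tsupport (E := EN) (I := 𝓘(ℝ, EN)) x₀).mem_iff.1 hb
  -- The bump function is `1` near `x₀` and has its support in the domain of the trivialization, so
  -- the product stays smooth where the frame stops being so.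
  refine ⟨(f : N → ℝ) • frameSection x₀ a, ?_, ?_⟩
  · refine ContMDiffOn.smul_section_of_tsupport (u := (trivializationAt F W x₀).baseSet)
      f.contMDiff.contMDiffOn (trivializationAt F W x₀).open_baseSet hf fun x hx ↦ ?_
    exact (contMDiffAt_frameSection hx a).contMDiffWithinAt
  · have h1 : (f : N → ℝ) =ᶠ[nhds x₀] 1 := f.eventuallyEq_one
    filter_upwards [h1] with z hz
    rw [Pi.smul_apply', hz, Pi.one_apply, one_smul]

/-- A covariant derivative of class `C^∞` has smooth connection forms. -/
lemma CovariantDerivative.isSmooth_of_contMDiff [FiniteDimensional ℝ EN] [T2Space N]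
    (D : CovariantDerivative 𝓘(ℝ, EN) F W) [hD : D.ContMDiffCovariantDerivative ∞] :
    D.IsSmooth := by
  intro x₀ a
  -- The smoothness class of `D` is tested on globally smooth sections. The local frame is replaced
  -- by such a section with the same germ at `x₀`.
  obtain ⟨τ, hτ, hτ'⟩ := exists_contMDiff_section_eq_frameSection (EN := EN) (W := W) x₀ a
  have h1 := hD.contMDiff.contMDiff (σ := τ) hτ.contMDiffOn
  have h2 := (contMDiffAt_tangentHom_iff (fun x ↦ D τ x) x₀).1
    (h1.contMDiffAt Filter.univ_mem)
  exact ContDiffAt.congr_of_eventuallyEq h2 (covdCoord_congr D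
    (contMDiffAt_frameSection (mem_baseSet_trivializationAt F W x₀) a) hτ')

/-- The pullback of a connection with smooth connection forms has smooth connection forms. -/
lemma CovariantDerivative.IsSmooth.pullback {D : CovariantDerivative 𝓘(ℝ, EM) F V}
    (hD : D.IsSmooth) (f : C^∞⟮𝓘(ℝ, EN), N; 𝓘(ℝ, EM), M⟯) : (D.pullback f).IsSmooth := by
  have hN : IsManifold 𝓘(ℝ, EN) 1 N := .of_le (n := ∞) (by simp)
  have hM : IsManifold 𝓘(ℝ, EM) 1 M := .of_le (n := ∞) (by simp)
  intro x₀ a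
  set k : EN → EM := fun u ↦ chartAt EM (f x₀) (f ((chartAt EN x₀).symm u)) with hk
  have hx₀ : (chartAt EN x₀).symm (chartAt EN x₀ x₀) = x₀ :=
    (chartAt EN x₀).left_inv (mem_chart_source EN x₀)
  have hh : ContMDiffAt 𝓘(ℝ, EN) 𝓘(ℝ, EM) ∞ (fun u ↦ f ((chartAt EN x₀).symm u))
      (chartAt EN x₀ x₀) := f.contMDiff.contMDiffAt.comp _ (contMDiffAt_chart_symm x₀)
  have hkc : ContDiffAt ℝ ∞ k (chartAt EN x₀ x₀) := contDiffAt_chart_comp hh (by rw [hx₀])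
  have hdk : ContDiffAt ℝ ∞ (fderiv ℝ k) (chartAt EN x₀ x₀) := hkc.fderiv_right (m := ∞) (by simp)
  have hk0 : k (chartAt EN x₀ x₀) = chartAt EM (f x₀) (f x₀) := by rw [hk]; simp only [hx₀]
  -- With `k` the map `f` in charts, this is the pullback by `k` of the connection form of `D`. Near
  -- `x₀` it is the connection form of the pullback connection, because the frames of `f^*V` are
  -- pulled back from `V`.
  have h1 : ContDiffAt ℝ ∞ (fun u ↦ covdCoord D (frameSection (f x₀) a) (f x₀) (k u) ∘L fderiv ℝ k u)
      (chartAt EN x₀ x₀) :=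
    (ContDiffAt.comp (chartAt EN x₀ x₀) (g := covdCoord D (frameSection (f x₀) a) (f x₀))
      (hk0 ▸ hD (f x₀) a) hkc).clm_comp hdk
  refine h1.congr_of_eventuallyEq ?_
  have hev := f.contMDiff.continuous.continuousAt.eventually
    (eventually_mem_baseSet (mem_baseSet_trivializationAt F V (f x₀)))
  have hev2 := f.contMDiff.continuous.continuousAt.eventually
    ((chartAt EM (f x₀)).open_source.mem_nhds (mem_chart_source EM (f x₀)))
  filter_upwards [eventually_chart_symm hev, eventually_chart_symm hev.eventually_nhds,
    eventually_chart_symm hev2, (contMDiffAt_chart_symm x₀).eventually_mdifferentiableAt,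
    hh.eventually_mdifferentiableAt] with u h2 h3 h4 h5 h6
  ext v
  set z := (chartAt EN x₀).symm u with hz
  have h7 : covd (D.pullback f) (frameSection (V := f *ᵖ V) x₀ a) z =
      covd (D.pullback f) (fun y ↦ frameSection (V := V) (f x₀) a (f y)) z := by
    refine covd_congr _ (mdifferentiableAt_frameSection_of_mem (W := f *ᵖ V)
      (mem_baseSet_pullback.2 h2) a)
      (mdifferentiableAt_pullback_section (mdifferentiableAt_frameSection_of_mem h2 a)) ?_
    filter_upwards [h3] with y hy
    exact frameSection_pullback hy a
  have h8 : tderiv EM EM (chartAt EM (f x₀)).symm (k u) (fderiv ℝ k u v) =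
      tderiv EN EM f z (tderiv EN EN (chartAt EN x₀).symm u v) := by
    rw [hk, fderiv_chart_comp (h := fun u ↦ f ((chartAt EN x₀).symm u)) h4 h6,
      tderiv_chart_symm_tderiv_chart h4]
    exact tderiv_comp EN EN EM u (f.contMDiff.mdifferentiableAt (by simp)) h5 v
  have key : ∀ y, y = f z → ∀ X, (trivializationAt F V (f x₀)).continuousLinearMapAt ℝ y
      (covd D (frameSection (f x₀) a) y X) =
      (trivializationAt F V (f x₀)).continuousLinearMapAt ℝ (f z)
      (covd D (frameSection (f x₀) a) (f z) X) := by
    rintro _ rfl _; rfl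
  have h9 : covd (D.pullback f) (frameSection (V := f *ᵖ V) x₀ a) z
      (tderiv EN EN (chartAt EN x₀).symm u v) = covd D (frameSection (f x₀) a) (f z)
        (tderiv EM EM (chartAt EM (f x₀)).symm (k u) (fderiv ℝ k u v)) := by
    rw [h7, h8]
    exact covd_pullback_section D f (mdifferentiableAt_frameSection_of_mem h2 a) _
  refine Eq.trans ?_ (key _ ((chartAt EM (f x₀)).left_inv h4) _).symm
  refine Eq.trans ?_ (continuousLinearMapAt_pullback h2 _)
  exact congrArg ((trivializationAt F (f *ᵖ V) x₀).continuousLinearMapAt ℝ z) h9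

/-- The connection form of `D` at the point with coordinates `u`, in the preferred chart and
trivialization at `x₀`. -/
def connForm (D : CovariantDerivative 𝓘(ℝ, EN) F W) (x₀ : N) (u : EN) : F →L[ℝ] EN →L[ℝ] F :=
  ∑ i, ((Module.finBasis ℝ F).coord i).toContinuousLinearMap.smulRight
    (covdCoord D (frameSection x₀ (Module.finBasis ℝ F i)) x₀ u)

/-- The sum over a basis is linear in `a` at every point. The covariant derivative of frame sections
is known to be so only over the base set, where these sections are differentiable and `D` is
additive on them. -/
lemma connForm_apply (D : CovariantDerivative 𝓘(ℝ, EN) F W) {x₀ : N} {u : EN}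
    (hu : (chartAt EN x₀).symm u ∈ (trivializationAt F W x₀).baseSet) (a : F) :
    connForm D x₀ u a = covdCoord D (frameSection x₀ a) x₀ u := by
  let L : F →ₗ[ℝ] EN →L[ℝ] F :=
    { toFun a := covdCoord D (frameSection x₀ a) x₀ u
      map_add' a b := by
        have h : frameSection (V := W) x₀ (a + b) = frameSection x₀ a + frameSection x₀ b := by
          funext y; simp [frameSection]
        have h1 : covd D (frameSection x₀ a + frameSection x₀ b) ((chartAt EN x₀).symm u) =
            covd D (frameSection x₀ a) ((chartAt EN x₀).symm u) +
            covd D (frameSection x₀ b) ((chartAt EN x₀).symm u) :=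
          D.isCovariantDerivativeOnUniv.add (mdifferentiableAt_frameSection_of_mem hu a)
            (mdifferentiableAt_frameSection_of_mem hu b)
        rw [h, covdCoord, h1, ContinuousLinearMap.add_comp, ContinuousLinearMap.comp_add]
        rfl
      map_smul' r a := by
        have h : frameSection (V := W) x₀ (r • a) = r • frameSection x₀ a := by
          funext y; simp [frameSection]
        have h1 : covd D (r • frameSection x₀ a) ((chartAt EN x₀).symm u) =
            r • covd D (frameSection x₀ a) ((chartAt EN x₀).symm u) :=
          D.isCovariantDerivativeOnUniv.smul_const r (mdifferentiableAt_frameSection_of_mem hu a)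
        rw [h, covdCoord, h1, ContinuousLinearMap.smul_comp, ContinuousLinearMap.comp_smul]
        rfl }
  exact congr($(sum_coord_smulRight L) a)

lemma CovariantDerivative.IsSmooth.contDiffAt_connForm {D : CovariantDerivative 𝓘(ℝ, EN) F W}
    (hD : D.IsSmooth) (x₀ : N) : ContDiffAt ℝ ∞ (connForm D x₀) (chartAt EN x₀ x₀) :=
  contDiffAt_sum_smulRight _ fun _ ↦ hD x₀ _

/-- The covariant derivative of a smooth section is smooth. -/
lemma CovariantDerivative.IsSmooth.contDiffAt_covdCoord {D : CovariantDerivative 𝓘(ℝ, EN) F W}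
    (hD : D.IsSmooth) {σ : ∀ x, W x} {x₀ : N}
    (hσ : ContMDiffAt 𝓘(ℝ, EN) (𝓘(ℝ, EN).prod 𝓘(ℝ, F)) ∞ (fun z ↦ TotalSpace.mk' F z (σ z)) x₀) :
    ContDiffAt ℝ ∞ (covdCoord D σ x₀) (chartAt EN x₀ x₀) := by
  have hN : IsManifold 𝓘(ℝ, EN) 1 N := .of_le (n := ∞) (by simp)
  have hb := mem_baseSet_trivializationAt F W x₀
  have hx₀ : (chartAt EN x₀).symm (chartAt EN x₀ x₀) = x₀ :=
    (chartAt EN x₀).left_inv (mem_chart_source EN x₀)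
  set s : EN → F := fun u ↦ (trivializationAt F W x₀).continuousLinearMapAt ℝ
    ((chartAt EN x₀).symm u) (σ ((chartAt EN x₀).symm u)) with hs
  have h0 := (contMDiffAt_section_iff_clm hb).1 hσ
  have h1 : ContDiffAt ℝ ∞ s (chartAt EN x₀ x₀) :=
    (ContMDiffAt.comp (chartAt EN x₀ x₀) (g := fun z ↦
      (trivializationAt F W x₀).continuousLinearMapAt ℝ z (σ z))
      (by rwa [hx₀]) (contMDiffAt_chart_symm x₀)).contDiffAt
  -- In coordinates `∇σ = ds + A s`, and both terms are smooth.
  have h2 : ContDiffAt ℝ ∞ (fun u ↦ fderiv ℝ s u + connForm D x₀ u (s u)) (chartAt EN x₀ x₀) :=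
    (h1.fderiv_right (m := ∞) (by simp)).add ((hD.contDiffAt_connForm x₀).clm_apply h1)
  refine h2.congr_of_eventuallyEq ?_
  filter_upwards [eventually_chart_symm (eventually_mem_baseSet hb),
    (contMDiffAt_chart_symm x₀).eventually_mdifferentiableAt,
    eventually_chart_symm h0.eventually_mdifferentiableAt] with u h3 h4 h5
  ext v
  have h6 := tderiv_comp EN EN F u h5 h4 v
  rw [tderiv_eq_fderiv] at h6
  rw [add_apply, hs, h6, connForm_apply D h3, covdCoord,
    covd_eq D h3 ((mdifferentiableAt_section_iff_clm h3).2 h5)]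
  change (trivializationAt F W x₀).continuousLinearMapAt ℝ _
    ((trivializationAt F W x₀).symmL ℝ _ _ + _) = _
  rw [map_add, Trivialization.continuousLinearMapAt_symmL _ h3]
  rfl

end SmoothConnections

/-! ### Smoothness and linearity of the exterior derivative and of the wedge with a connection form
-/

section ExteriorDerivative

variable {E F : Type*} [NormedAddCommGroup E] [NormedSpace ℝ E] [NormedAddCommGroup F]
  [NormedSpace ℝ F] {q : ℕ} {u : E}

lemma fderiv_clm_apply_const {P : E → F →L[ℝ] F} (hP : DifferentiableAt ℝ P u) (a : F) :
    fderiv ℝ (fun z ↦ P z a) u = (fderiv ℝ P u).flip a := by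
  rw [fderiv_clm_apply hP (differentiableAt_const a)]
  simp

set_option synthInstance.maxHeartbeats 400000 in
set_option maxHeartbeats 1000000 in
lemma ContDiffAt.alternatizeUncurryFin {f : E → E →L[ℝ] E [⋀^Fin q]→L[ℝ] F}
    (hf : ContDiffAt ℝ ∞ f u) :
    ContDiffAt ℝ ∞ (fun z ↦ ContinuousAlternatingMap.alternatizeUncurryFin (f z)) u :=
  ContDiffAt.comp u (g := ContinuousAlternatingMap.alternatizeUncurryFinCLM (n := q) ℝ E F)
    (ContinuousLinearMap.contDiff _).contDiffAt hf

set_option synthInstance.maxHeartbeats 400000 in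
lemma ContDiffAt.extDeriv {η : E → E [⋀^Fin q]→L[ℝ] F} (hη : ContDiffAt ℝ ∞ η u) :
    ContDiffAt ℝ ∞ (_root_.extDeriv η) u :=
  (hη.fderiv_right (m := ∞) (by simp)).alternatizeUncurryFin

set_option synthInstance.maxHeartbeats 400000 in
set_option maxHeartbeats 1000000 in
lemma extDeriv_linearCombination {ι : Type*} [Fintype ι] (c : ι → ℝ)
    {η : ι → E → E [⋀^Fin q]→L[ℝ] F} (hη : ∀ i, DifferentiableAt ℝ (η i) u) :
    extDeriv (fun u ↦ ∑ i, c i • η i u) u = ∑ i, c i • extDeriv (η i) u := by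
  have h : HasFDerivAt (fun u ↦ ∑ i, c i • η i u) (∑ i, c i • fderiv ℝ (η i) u) u :=
    HasFDerivAt.fun_sum fun i _ ↦ (hη i).hasFDerivAt.const_smul (c i)
  rw [extDeriv, h.fderiv]
  change ContinuousAlternatingMap.alternatizeUncurryFinCLM ℝ E F _ = _
  rw [map_sum]
  exact Finset.sum_congr rfl fun i _ ↦ map_smul _ _ _

set_option synthInstance.maxHeartbeats 400000 in
set_option maxHeartbeats 1000000 in
lemma ContDiffAt.wedge_flip {A : E → F →L[ℝ] E →L[ℝ] F} {η : E → E [⋀^Fin q]→L[ℝ] F}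
    (hA : ContDiffAt ℝ ∞ A u) (hη : ContDiffAt ℝ ∞ η u) :
    ContDiffAt ℝ ∞ (fun z ↦ ContinuousAlternatingMap.alternatizeUncurryFin
      (((ContinuousLinearMap.compContinuousAlternatingMapCLM ℝ E F F (Fin q)).flip (η z)) ∘L
        (A z).flip)) u :=
  (((ContinuousLinearMap.compContinuousAlternatingMapCLM ℝ E F F
    (Fin q)).flip.contDiff.contDiffAt.comp u hη).clm_comp
    ((ContinuousLinearMap.flipₗᵢ ℝ F E F).contDiff.contDiffAt.comp u hA)).alternatizeUncurryFin

end ExteriorDerivative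

/-! ### The exterior covariant derivative: linearity, behaviour under maps, smoothness -/

section ExteriorCovariantDerivative

variable {EN : Type*} [NormedAddCommGroup EN] [NormedSpace ℝ EN]
  {N : Type*} [TopologicalSpace N] [ChartedSpace EN N]
  {EN' : Type*} [NormedAddCommGroup EN'] [NormedSpace ℝ EN']
  {N' : Type*} [TopologicalSpace N'] [ChartedSpace EN' N']
  {F : Type*} [NormedAddCommGroup F] [NormedSpace ℝ F]
  {W : N → Type*} [TopologicalSpace (TotalSpace F W)] [∀ x, AddCommGroup (W x)]
  [∀ x, Module ℝ (W x)] [∀ x, TopologicalSpace (W x)] [∀ x, IsTopologicalAddGroup (W x)]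
  [∀ x, ContinuousSMul ℝ (W x)] [FiberBundle F W] [VectorBundle ℝ F W]
  {W' : N' → Type*} [TopologicalSpace (TotalSpace F W')] [∀ x, AddCommGroup (W' x)]
  [∀ x, Module ℝ (W' x)] [∀ x, TopologicalSpace (W' x)] [∀ x, IsTopologicalAddGroup (W' x)]
  [∀ x, ContinuousSMul ℝ (W' x)] [FiberBundle F W'] [VectorBundle ℝ F W']
  {q : ℕ}

lemma VForm.val_injective {α β : VForm EN W q} (h : ∀ x w, α.val x w = β.val x w) : α = β :=
  funext fun x ↦ ContinuousAlternatingMap.ext (h x)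

variable [IsManifold 𝓘(ℝ, EN) ∞ N] [IsManifold 𝓘(ℝ, EN') ∞ N']

section LinearCombinations

variable {ι : Type*} [Fintype ι] {c : ι → ℝ} {β : ι → VForm EN W q} {γ : VForm EN W q}

lemma VForm.coordForm_linearCombination (hγ : ∀ x w, γ.val x w = ∑ i, c i • (β i).val x w) (x : N) :
    γ.coordForm F x = fun u ↦ ∑ i, c i • (β i).coordForm F x u := by
  funext u
  ext w
  rw [ContinuousAlternatingMap.sum_apply, VForm.coordForm_apply, hγ, map_sum]
  simp only [map_smul]
  rfl

lemma VForm.IsSmooth.linearCombination (hγ : ∀ x w, γ.val x w = ∑ i, c i • (β i).val x w)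
    (hβ : ∀ i, (β i).IsSmooth F) : γ.IsSmooth F := by
  rw [VForm.isSmooth_iff]
  intro x
  rw [VForm.coordForm_linearCombination hγ]
  exact ContDiffAt.sum fun i _ ↦ ContDiffAt.const_smul (c i) (VForm.isSmooth_iff.1 (hβ i) x)

variable [FiniteDimensional ℝ F]

lemma extCovDeriv_linearCombination (D : CovariantDerivative 𝓘(ℝ, EN) F W)
    (hγ : ∀ x w, γ.val x w = ∑ i, c i • (β i).val x w) (hβ : ∀ i, (β i).IsSmooth F) (x : N)
    (v : Fin (q + 1) → EN) :
    (extCovDeriv D γ).val x v = ∑ i, c i • (extCovDeriv D (β i)).val x v := by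
  have h1 : extDeriv (γ.coordForm F x) (chartAt EN x x) =
      ∑ i, c i • extDeriv ((β i).coordForm F x) (chartAt EN x x) := by
    have hd : ∀ i, DifferentiableAt ℝ ((β i).coordForm F x) (chartAt EN x x) := fun i ↦
      (VForm.isSmooth_iff.1 (hβ i) x).differentiableAt (by simp)
    rw [VForm.coordForm_linearCombination hγ]
    exact extDeriv_linearCombination c hd
  rw [extCovDeriv_val_apply, h1, ContinuousAlternatingMap.sum_apply, map_sum]
  simp only [extCovDeriv_val_apply, smul_add, Finset.sum_add_distrib]
  congr 1
  · refine Finset.sum_congr rfl fun i _ ↦ ?_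
    exact map_smul _ _ _
  · simp only [Finset.smul_sum]
    rw [Finset.sum_comm]
    refine Finset.sum_congr rfl fun j _ ↦ ?_
    rw [hγ, map_sum, sum_apply, Finset.smul_sum]
    refine Finset.sum_congr rfl fun i _ ↦ ?_
    rw [map_smul, smul_apply, smul_comm]

end LinearCombinations

variable [ContMDiffVectorBundle ∞ F W 𝓘(ℝ, EN)] [ContMDiffVectorBundle ∞ F W' 𝓘(ℝ, EN')]

/-- A family of linear maps between the fibres of `f^*W'` and `W` that maps frames of `W'` to
smooth sections. -/
def IsSmoothFiberMap (EN F : Type*) [NormedAddCommGroup EN] [NormedSpace ℝ EN]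
    [NormedAddCommGroup F] [NormedSpace ℝ F] {N N' : Type*} [TopologicalSpace N] [ChartedSpace EN N]
    [TopologicalSpace N'] {W : N → Type*} [TopologicalSpace (TotalSpace F W)]
    [∀ x, AddCommGroup (W x)] [∀ x, Module ℝ (W x)] [∀ x, TopologicalSpace (W x)]
    [FiberBundle F W] {W' : N' → Type*} [TopologicalSpace (TotalSpace F W')]
    [∀ x, AddCommGroup (W' x)] [∀ x, Module ℝ (W' x)] [∀ x, TopologicalSpace (W' x)]
    [FiberBundle F W'] [VectorBundle ℝ F W'] (f : N → N') (Ψ : ∀ z, W' (f z) →L[ℝ] W z) : Prop :=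
  ∀ (z₀ : N) (a : F), ContMDiffAt 𝓘(ℝ, EN) (𝓘(ℝ, EN).prod 𝓘(ℝ, F)) ∞
    (fun z ↦ TotalSpace.mk' F z (Ψ z (frameSection (F := F) (V := W') (f z₀) a (f z)))) z₀

section Map

variable {f : N → N'} {Ψ : ∀ z, W' (f z) →L[ℝ] W z}

lemma contMDiffAt_comp_chart_symm (hf : ContMDiff 𝓘(ℝ, EN) 𝓘(ℝ, EN') ∞ f) (c : N) :
    ContMDiffAt 𝓘(ℝ, EN) 𝓘(ℝ, EN') ∞ (fun u ↦ f ((chartAt EN c).symm u)) (chartAt EN c c) :=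
  hf.contMDiffAt.comp _ (contMDiffAt_chart_symm c)

/-- The matrix of `Ψ` is tested on vectors `a` of `F`, and its value on `a` is `Ψ` applied to the
frame section of `a`; this is what `IsSmoothFiberMap` controls. -/
lemma IsSmoothFiberMap.contDiffAt [FiniteDimensional ℝ F] (hΨ : IsSmoothFiberMap EN F f Ψ)
    (c : N) :
    ContDiffAt ℝ ∞ (fun u ↦ ((trivializationAt F W c).continuousLinearMapAt ℝ
      ((chartAt EN c).symm u) ∘L Ψ ((chartAt EN c).symm u)) ∘L
      (trivializationAt F W' (f c)).symmL ℝ (f ((chartAt EN c).symm u))) (chartAt EN c c) := by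
  refine contDiffAt_clm_of_apply fun a ↦ ?_
  have h1 := (contMDiffAt_section_iff_clm (mem_baseSet_trivializationAt F W c)).1 (hΨ c a)
  have h2 := (contMDiffAt_comp_chart_iff (g := fun u ↦ (trivializationAt F W c).continuousLinearMapAt
    ℝ ((chartAt EN c).symm u) (Ψ ((chartAt EN c).symm u)
      (frameSection (f c) a (f ((chartAt EN c).symm u))))) ?_).1 h1
  · exact h2
  · filter_upwards [(chartAt EN c).open_source.mem_nhds (mem_chart_source EN c)] with z hz
    rw [(chartAt EN c).left_inv hz]

variable {α : VForm EN' W' q} {β : VForm EN W q}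

/-- Brings `Ψ_* f^*α` into the form required by the pullback lemmas, with `h = f ∘ chart⁻¹` and with
the fibre map followed by the trivialization at `c`. -/
lemma eventually_coordForm_map (hf : ContMDiff 𝓘(ℝ, EN) 𝓘(ℝ, EN') ∞ f)
    (hβ : ∀ z w, β.val z w = Ψ z (α.val (f z) fun i ↦ tderiv EN EN' f z (w i))) (c : N) :
    ∀ᶠ u in nhds (chartAt EN c c), ∀ w, β.coordForm F c u w =
      ((trivializationAt F W c).continuousLinearMapAt ℝ
        ((chartAt EN c).symm u) ∘L Ψ ((chartAt EN c).symm u)) (α.val (f ((chartAt EN c).symm u))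
          fun i ↦ tderiv EN EN' (fun u ↦ f ((chartAt EN c).symm u)) u (w i)) := by
  have hN : IsManifold 𝓘(ℝ, EN) 1 N := .of_le (n := ∞) (by simp)
  filter_upwards [(contMDiffAt_chart_symm c).eventually_mdifferentiableAt] with u hu w
  rw [VForm.coordForm_apply, hβ]
  simp only [← tderiv_comp EN EN EN' u (hf.mdifferentiableAt (by simp)) hu]
  rfl

variable [FiniteDimensional ℝ F]

lemma VForm.IsSmooth.map (hα : α.IsSmooth F) (hf : ContMDiff 𝓘(ℝ, EN) 𝓘(ℝ, EN') ∞ f)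
    (hΨ : IsSmoothFiberMap EN F f Ψ)
    (hβ : ∀ z w, β.val z w = Ψ z (α.val (f z) fun i ↦ tderiv EN EN' f z (w i))) :
    β.IsSmooth F := by
  rw [VForm.isSmooth_iff]
  intro c
  exact contDiffAt_of_eq_pullback (y := f c) hα (contMDiffAt_comp_chart_symm hf c)
    (by rw [(chartAt EN c).left_inv (mem_chart_source EN c)]) _ (hΨ.contDiffAt c)
    (eventually_coordForm_map hf hβ c)

/-- The exterior covariant derivative of the form `Ψ_* f^*α`. -/
lemma extCovDeriv_map (D : CovariantDerivative 𝓘(ℝ, EN) F W)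
    (D' : CovariantDerivative 𝓘(ℝ, EN') F W') (hα : α.IsSmooth F)
    (hf : ContMDiff 𝓘(ℝ, EN) 𝓘(ℝ, EN') ∞ f) (hΨ : IsSmoothFiberMap EN F f Ψ)
    (hβ : ∀ z w, β.val z w = Ψ z (α.val (f z) fun i ↦ tderiv EN EN' f z (w i))) (c : N)
    (v : Fin (q + 1) → EN) :
    (extCovDeriv D β).val c v = Ψ c ((extCovDeriv D' α).val (f c) fun i ↦ tderiv EN EN' f c (v i)) +
      ∑ i : Fin (q + 1), (-1 : ℝ) ^ (i : ℕ) •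
        (covd D (fun z ↦ Ψ z (frameSection (f c) (frameAt F W' (f c)
          (α.val (f c) fun j ↦ tderiv EN EN' f c (i.removeNth v j))) (f z))) c (v i) -
        Ψ c (covTerm D' (f c) (α.val (f c) fun j ↦ tderiv EN EN' f c (i.removeNth v j))
          (tderiv EN EN' f c (v i)))) := by
  have hN : IsManifold 𝓘(ℝ, EN) 1 N := .of_le (n := ∞) (by simp)
  have hc : (chartAt EN c).symm (chartAt EN c c) = c :=
    (chartAt EN c).left_inv (mem_chart_source EN c)
  have hd : MDifferentiableAt 𝓘(ℝ, EN) 𝓘(ℝ, EN) (chartAt EN c).symm (chartAt EN c c) :=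
    (contMDiffAt_chart_symm c).mdifferentiableAt (by simp)
  have hchain : ∀ w, tderiv EN EN' (fun u ↦ f ((chartAt EN c).symm u)) (chartAt EN c c)
      (tderiv EN EN (chartAt EN c) c w) = tderiv EN EN' f c w := fun w ↦ by
    rw [tderiv_comp EN EN EN' _ (hf.mdifferentiableAt (by simp)) hd,
      tderiv_chart_symm_tderiv_chart (mem_chart_source EN c), hc]
  -- This computes the part `dβ` of `d^∇ β`. The correction terms contain the derivative of the
  -- matrix of `Ψ`, to which the connection term of `d^∇ β` is added below to give `∇Ψ`.
  have hcore := extDeriv_eq_extCovDeriv_pullback (y := f c) D' hα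
    (contMDiffAt_comp_chart_symm hf c) (by rw [hc])
    (fun u ↦ (trivializationAt F W c).continuousLinearMapAt ℝ
        ((chartAt EN c).symm u) ∘L Ψ ((chartAt EN c).symm u))
    (Ψ₀ := (frameAt F W c : W c →L[ℝ] F) ∘L Ψ c) (fun σ ↦ by
      have key : ∀ z, z = c → (trivializationAt F W c).continuousLinearMapAt ℝ z (Ψ z (σ (f z))) =
          frameAt F W c (Ψ c (σ (f c))) := by
        rintro _ rfl; exact continuousLinearMapAt_eq_frameAt _ _
      exact key _ hc)
    ((hΨ.contDiffAt c).differentiableAt (by simp)) (eventually_coordForm_map hf hβ c)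
    (fun i ↦ tderiv EN EN (chartAt EN c) c (v i))
  rw [extCovDeriv_val_apply, hcore, map_add, map_sum]
  simp only [map_smul, map_sub, hchain, Fin.removeNth, ContinuousLinearMap.comp_apply,
    ContinuousLinearEquiv.coe_coe, ContinuousLinearEquiv.symm_apply_apply]
  rw [add_assoc, ← Finset.sum_add_distrib]
  congr 1
  refine Finset.sum_congr rfl fun i _ ↦ ?_
  rw [← smul_add, sub_add_eq_add_sub]
  -- In the frame at `c`, the covariant derivative of `Ψ` applied to the frame section through `w`
  -- is the derivative of its coordinates plus the connection term at `Ψ w`. The second is the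
  -- contribution of `A ∧ β`, the first the derivative of the matrix of `Ψ` applied to a constant
  -- vector.
  set w := α.val (f c) fun j ↦ tderiv EN EN' f c (v (i.succAbove j)) with hw
  have hσ := hΨ c (frameAt F W' (f c) w)
  rw [covd_eq_self D (hσ.mdifferentiableAt (by simp)), frameSection_self, hβ]
  have hg := ((contMDiffAt_section_iff_clm
    (mem_baseSet_trivializationAt F W c)).1 hσ).mdifferentiableAt (by simp)
  have h1 := tderiv_comp EN EN F (chartAt EN c c) (f := (chartAt EN c).symm) (by rwa [hc]) hd
    (tderiv EN EN (chartAt EN c) c (v i))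
  rw [tderiv_chart_symm_tderiv_chart (mem_chart_source EN c), hc, tderiv_eq_fderiv] at h1
  rw [← h1]
  have h2 : ∀ w', fderiv ℝ (fun u ↦ ((trivializationAt F W c).continuousLinearMapAt ℝ
      ((chartAt EN c).symm u) ∘L Ψ ((chartAt EN c).symm u)) ∘L
      (trivializationAt F W' (f c)).symmL ℝ (f ((chartAt EN c).symm u))) (chartAt EN c c) w'
      (frameAt F W' (f c) w) = fderiv ℝ (fun u ↦ (((trivializationAt F W c).continuousLinearMapAt ℝ
      ((chartAt EN c).symm u) ∘L Ψ ((chartAt EN c).symm u)) ∘L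
      (trivializationAt F W' (f c)).symmL ℝ (f ((chartAt EN c).symm u))) (frameAt F W' (f c) w))
      (chartAt EN c c) w' := by
    intro w'
    exact congr($(fderiv_clm_apply_const ((hΨ.contDiffAt c).differentiableAt (by simp)) _) w').symm
  rw [h2]
  rfl

end Map

variable [FiniteDimensional ℝ F]

/-- The exterior covariant derivative in the preferred chart and trivialization at `x₀`. -/
lemma coordForm_extCovDeriv (D : CovariantDerivative 𝓘(ℝ, EN) F W) {α : VForm EN W q}
    (hα : α.IsSmooth F) (x₀ : N) :
    ∀ᶠ u in nhds (chartAt EN x₀ x₀), (extCovDeriv D α).coordForm F x₀ u =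
      extDeriv (α.coordForm F x₀) u + ContinuousAlternatingMap.alternatizeUncurryFin
        (((ContinuousLinearMap.compContinuousAlternatingMapCLM ℝ EN F F (Fin q)).flip
          (α.coordForm F x₀ u)) ∘L (connForm D x₀ u).flip) := by
  have hN : IsManifold 𝓘(ℝ, EN) 1 N := .of_le (n := ∞) (by simp)
  have hs := contMDiffAt_chart_symm (EN := EN) x₀
  have ht := (chartAt EN x₀).open_target.mem_nhds ((chartAt EN x₀).map_source
    (mem_chart_source EN x₀))
  filter_upwards [eventually_chart_symm (eventually_mem_baseSet
    (mem_baseSet_trivializationAt F W x₀)), ht, hs.eventually_mdifferentiableAt] with u hu hut hud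
  have hu2 : ContMDiffAt 𝓘(ℝ, EN) 𝓘(ℝ, EN) ∞ (chartAt EN x₀).symm u :=
    (contMDiffOn_chart_symm (x := x₀)).contMDiffAt ((chartAt EN x₀).open_target.mem_nhds hut)
  set y := (chartAt EN x₀).symm u with hy
  have hsec : ∀ a, MDifferentiableAt 𝓘(ℝ, EN) 𝓘(ℝ, F) (fun z ↦
      (trivializationAt F W x₀).continuousLinearMapAt ℝ z (frameSection (V := W) y a z)) y :=
    fun a ↦ (mdifferentiableAt_section_iff_clm hu).1
      (mdifferentiableAt_frameSection_of_mem (mem_baseSet_trivializationAt F W y) a)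
  -- This is the transition function from the trivialization at `y` to the one at `x₀`. The
  -- definition of `d^∇ α` at `y` uses the former, the claimed formula the latter.
  have hP : DifferentiableAt ℝ (fun z ↦ (trivializationAt F W x₀).continuousLinearMapAt ℝ
      ((chartAt EN x₀).symm z) ∘L (trivializationAt F W y).symmL ℝ ((chartAt EN x₀).symm z)) u := by
    refine ContDiffAt.differentiableAt (n := ∞) (contDiffAt_clm_of_apply fun a ↦ ?_) (by simp)
    have h1 := (contMDiffAt_section_iff_clm (EN := EN) hu).1
      (contMDiffAt_frameSection (mem_baseSet_trivializationAt F W y) a)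
    exact (h1.comp u hu2).contDiffAt
  ext w
  have hcore := extDeriv_eq_extCovDeriv_pullback D hα hu2 hy.symm
    (fun z ↦ (trivializationAt F W x₀).continuousLinearMapAt ℝ ((chartAt EN x₀).symm z))
    (Ψ₀ := (trivializationAt F W x₀).continuousLinearMapAt ℝ y) (fun σ ↦ rfl) hP
    (β := α.coordForm F x₀) (Filter.Eventually.of_forall fun z w ↦ rfl) w
  rw [ContinuousAlternatingMap.add_apply, hcore, VForm.coordForm_apply,
    ContinuousAlternatingMap.alternatizeUncurryFin_apply, add_assoc, left_eq_add,
    ← Finset.sum_add_distrib]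
  refine Finset.sum_eq_zero fun i _ ↦ ?_
  set b := α.val y fun j ↦ tderiv EN EN (chartAt EN x₀).symm u (i.removeNth w j) with hb
  have h1 : fderiv ℝ (fun z ↦ (trivializationAt F W x₀).continuousLinearMapAt ℝ
      ((chartAt EN x₀).symm z) ∘L (trivializationAt F W y).symmL ℝ ((chartAt EN x₀).symm z)) u (w i)
      (frameAt F W y b) = tderiv EN F (fun z ↦
      (trivializationAt F W x₀).continuousLinearMapAt ℝ z
        (frameSection (V := W) y (frameAt F W y b) z)) y
        (tderiv EN EN (chartAt EN x₀).symm u (w i)) := by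
    refine Eq.trans ?_ (tderiv_comp EN EN F u (hsec (frameAt F W y b)) hud (w i))
    rw [tderiv_eq_fderiv]
    exact congr($(fderiv_clm_apply_const hP _) (w i)).symm
  -- The gauge transformation law: written in the trivialization at `x₀`, the connection form at `y`
  -- becomes the derivative of the transition function plus the connection form of `x₀`. The two
  -- derivatives of the transition function cancel, and `A ∧ α` for the fixed trivialization
  -- remains.
  have h2 : (trivializationAt F W x₀).continuousLinearMapAt ℝ y (covTerm D y b
      (tderiv EN EN (chartAt EN x₀).symm u (w i))) =
      tderiv EN F (fun z ↦ (trivializationAt F W x₀).continuousLinearMapAt ℝ z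
        (frameSection (V := W) y (frameAt F W y b) z)) y
        (tderiv EN EN (chartAt EN x₀).symm u (w i)) +
      connForm D x₀ u (α.coordForm F x₀ u (i.removeNth w)) (w i) := by
    rw [covTerm_apply, covd_eq D hu (mdifferentiableAt_frameSection_of_mem
      (mem_baseSet_trivializationAt F W y) _), connForm_apply D hu, frameSection_self]
    change (trivializationAt F W x₀).continuousLinearMapAt ℝ _
      ((trivializationAt F W x₀).symmL ℝ _ _ + _) = _
    rw [map_add, Trivialization.continuousLinearMapAt_symmL _ hu]
    rfl
  rw [h1, h2, ← Int.cast_smul_eq_zsmul ℝ]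
  push_cast
  have h3 : ∀ a b : F, a - (a + b) + b = 0 := fun a b ↦ by abel
  rw [← smul_add]
  exact (congrArg _ (h3 _ _)).trans (smul_zero _)

/-- The exterior covariant derivative of a smooth form is smooth. -/
lemma VForm.IsSmooth.extCovDeriv {D : CovariantDerivative 𝓘(ℝ, EN) F W} (hD : D.IsSmooth)
    {α : VForm EN W q} (hα : α.IsSmooth F) : (extCovDeriv D α).IsSmooth F := by
  rw [VForm.isSmooth_iff]
  intro x₀
  have hΩ := VForm.isSmooth_iff.1 hα x₀
  refine ContDiffAt.congr_of_eventuallyEq ?_ (coordForm_extCovDeriv D hα x₀)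
  exact hΩ.extDeriv.add ((hD.contDiffAt_connForm x₀).wedge_flip hΩ)

end ExteriorCovariantDerivative

/-! ### Smooth maps to and from the levels of the nerve -/

section SmoothNerve

variable {EM : Type*} [NormedAddCommGroup EM] [NormedSpace ℝ EM]
  {M : Type*} [TopologicalSpace M] [ChartedSpace EM M]
  {EG : Type*} [NormedAddCommGroup EG] [NormedSpace ℝ EG]
  {G : Type*} [TopologicalSpace G] [ChartedSpace EG G]
  {E : Type*} [NormedAddCommGroup E] [NormedSpace ℝ E]
  {N : Type*} [TopologicalSpace N] [ChartedSpace E N]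
  [IsManifold 𝓘(ℝ, EM) ∞ M] [IsManifold 𝓘(ℝ, EG) ∞ G]

namespace Nerve

variable {Q : SubmersiveQuiver EM M EG G} {p : ℕ}

lemma contMDiffAt_chart (c : Nerve Q p) :
    ContMDiffAt 𝓘(ℝ, Model Q p) 𝓘(ℝ, Model Q p) ∞ (chart c) c :=
  (contMDiffOn_chart (x := c)).contMDiffAt ((chart c).open_source.mem_nhds (mem_chart_source c))

/-- In the recursive charts this map drops the last fibre coordinate. -/
lemma contMDiff_init : ContMDiff 𝓘(ℝ, Model Q (p + 1)) 𝓘(ℝ, Model Q p) ∞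
    (init : Nerve Q (p + 1) → Nerve Q p) := by
  intro c
  have h1 : ContMDiffAt 𝓘(ℝ, Model Q (p + 1)) 𝓘(ℝ, Model Q p) ∞
      (fun d ↦ (((chart c d).1, Fin.init (chart c d).2) : Model Q p)) c :=
    contDiff_pr.contMDiff.contMDiffAt.comp c (contMDiffAt_chart c)
  have h2 : ∀ d : Nerve Q (p + 1),
      (((chart c d).1, Fin.init (chart c d).2) : Model Q p) = chart c.init d.init := by
    intro d
    rw [chart, chartSnoc_apply]
    simp
  have h3 : ContMDiffAt 𝓘(ℝ, Model Q p) 𝓘(ℝ, Model Q p) ∞ (chart c.init).symm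
      ((chart c c).1, Fin.init (chart c c).2) := by
    rw [h2]
    exact (contMDiffOn_chart_symm (x := c.init)).contMDiffAt
      ((chart c.init).open_target.mem_nhds ((chart c.init).map_source (mem_chart_source _)))
  refine (h3.comp c h1).congr_of_eventuallyEq ?_
  filter_upwards [(continuous_init (Q := Q) (p := p)).continuousAt.preimage_mem_nhds
    ((chart c.init).open_source.mem_nhds (mem_chart_source c.init))] with d hd
  rw [Function.comp_apply, h2, (chart c.init).left_inv hd]

/-- In the chart at `c` the last arrow is `newArr`: it is recovered smoothly from its target, the
last object of the shorter string, and its coordinate along the fibre of `t`. -/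
lemma contMDiff_arr_last : ContMDiff 𝓘(ℝ, Model Q (p + 1)) 𝓘(ℝ, EG) ∞
    (fun c : Nerve Q (p + 1) ↦ c.arr (Fin.last p)) := by
  intro c
  set S := subChart (Q := Q) (c.arr (Fin.last p)) with hS
  have h1 : ContMDiffOn 𝓘(ℝ, Model Q (p + 1)) 𝓘(ℝ, EG) ∞
      (newArr (chart c.init) S ∘ chart c) (chart c).source :=
    (contMDiffOn_newArr (contMDiffOn_base_chart_symm c.init)).comp (contMDiffOn_chart (x := c))
      fun d hd ↦ (chart c).map_source hd
  refine (h1.congr fun d hd ↦ ?_).contMDiffAt ((chart c).open_source.mem_nhds (mem_chart_source c))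
  have hu : chart c d ∈ snocTarget (chart c.init) S := (chart c).map_source hd
  have h2 : (chart c).symm (chart c d) = _ := chartSnoc_symm (c₀ := c) hu
  rw [(chart c).left_inv hd] at h2
  rw [congrArg (fun d : Nerve Q (p + 1) ↦ d.arr (Fin.last p)) h2, last_snoc]
  rfl

lemma contMDiff_arr : ∀ {p : ℕ} (i : Fin p),
    ContMDiff 𝓘(ℝ, Model Q p) 𝓘(ℝ, EG) ∞ (fun c : Nerve Q p ↦ c.arr i)
  | p + 1, i => by
    refine Fin.lastCases ?_ (fun j ↦ ?_) i
    · exact contMDiff_arr_last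
    · exact (contMDiff_arr j).comp contMDiff_init

lemma contMDiff_obj : ∀ {p : ℕ} (i : Fin (p + 1)),
    ContMDiff 𝓘(ℝ, Model Q p) 𝓘(ℝ, EM) ∞ (fun c : Nerve Q p ↦ c.obj i)
  | 0, i => by rw [Fin.fin_one_eq_zero i]; exact contMDiff_base
  | p + 1, i => by
    refine Fin.lastCases ?_ (fun j ↦ ?_) i
    · exact contMDiff_base
    · exact (contMDiff_obj j).comp contMDiff_init

/-- By recursion, the chart consists of the coordinates of `x_0` and one fibre coordinate for each
arrow. The later objects are not coordinates, being sources of arrows. -/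
lemma contMDiffAt_chart_comp : ∀ {p : ℕ} {f : N → Nerve Q p} {x : N},
    ContMDiffAt 𝓘(ℝ, E) 𝓘(ℝ, EM) ∞ (fun z ↦ (f z).obj 0) x →
    (∀ i, ContMDiffAt 𝓘(ℝ, E) 𝓘(ℝ, EG) ∞ (fun z ↦ (f z).arr i) x) → ∀ c, f x ∈ (chart c).source →
    ContMDiffAt 𝓘(ℝ, E) 𝓘(ℝ, Model Q p) ∞ (fun z ↦ chart c (f z)) x
  | 0, f, x, ho, _, c, hc => by
    have h1 : ContMDiffAt 𝓘(ℝ, E) 𝓘(ℝ, EM) ∞ (fun z ↦ chartAt EM c.base (f z).base) x :=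
      ((contMDiffOn_chart (x := c.base)).contMDiffAt
        ((chartAt EM c.base).open_source.mem_nhds hc)).comp x ho
    exact h1.prodMk_space contMDiffAt_const
  | p + 1, f, x, ho, ha, c, hc => by
    have h1 := contMDiffAt_chart_comp (f := fun z ↦ (f z).init) ho (fun i ↦ ha i.castSucc) c.init
      hc.1
    set S := subChart (Q := Q) (c.arr (Fin.last p)) with hS
    have h2 : ContMDiffAt 𝓘(ℝ, E) 𝓘(ℝ, EG) ∞ (fun z ↦ S.dom ((f z).arr (Fin.last p))) x :=
      ((contMDiffOn_of_mem_maximalAtlas S.dom_mem).contMDiffAt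
        (S.dom.open_source.mem_nhds hc.2)).comp x (ha (Fin.last p))
    have h3 : ContMDiffAt 𝓘(ℝ, E) 𝓘(ℝ, Q.isSubmersion_tgt.complement) ∞
        (fun z ↦ (S.equiv (S.dom ((f z).arr (Fin.last p)))).2) x :=
      (contDiff_snd.comp S.equiv.contDiff).contMDiff.contMDiffAt.comp x h2
    have h4 : ContMDiffAt 𝓘(ℝ, E) 𝓘(ℝ, EM) ∞ (fun z ↦ (chart c.init (f z).init).1) x :=
      contDiff_fst.contMDiff.contMDiffAt.comp x h1
    refine h4.prodMk_space (contMDiffAt_pi_space.2 fun i ↦ ?_)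
    refine Fin.lastCases ?_ (fun j ↦ ?_) i
    · simpa only [Fin.snoc_last] using h3
    · simp only [Fin.snoc_castSucc]
      exact ((contDiff_apply ℝ _ j).comp contDiff_snd).contMDiff.contMDiffAt.comp x h1

/-- A map to the nerve is smooth if its first object and its arrows depend smoothly on the point. -/
lemma contMDiff_of_obj_arr [IsManifold 𝓘(ℝ, E) ∞ N] {f : N → Nerve Q p}
    (ho : ContMDiff 𝓘(ℝ, E) 𝓘(ℝ, EM) ∞ (fun z ↦ (f z).obj 0))
    (ha : ∀ i, ContMDiff 𝓘(ℝ, E) 𝓘(ℝ, EG) ∞ (fun z ↦ (f z).arr i)) :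
    ContMDiff 𝓘(ℝ, E) 𝓘(ℝ, Model Q p) ∞ f := by
  intro x
  rw [contMDiffAt_iff_target]
  refine ⟨?_, ?_⟩
  · have h : ContinuousOn f univ := by
      rw [continuousOn_iff]
      refine ⟨fun i ↦ ?_, fun i ↦ (ha i).continuous.continuousOn⟩
      refine Fin.cases ho.continuous.continuousOn (fun j ↦ ?_) i
      have h1 : (fun z ↦ (f z).obj j.succ) = fun z ↦ Q.src ((f z).arr j) :=
        funext fun z ↦ ((f z).src_arr j).symm
      rw [h1]
      exact (Q.src.contMDiff.continuous.comp (ha j).continuous).continuousOn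
    exact (continuousOn_univ.1 h).continuousAt
  · exact contMDiffAt_chart_comp ho.contMDiffAt (fun i ↦ (ha i).contMDiffAt) (f x)
      (mem_chart_source (f x))

/-- The string of length `1` of an arrow. -/
def ofArr (Q : SubmersiveQuiver EM M EG G) (g : G) : Nerve Q 1 where
  obj := ![Q.tgt g, Q.src g]
  arr := ![g]
  tgt_arr i := by rw [Fin.fin_one_eq_zero i]; rfl
  src_arr i := by rw [Fin.fin_one_eq_zero i]; rfl

lemma contMDiff_ofArr : ContMDiff 𝓘(ℝ, EG) 𝓘(ℝ, Model Q 1) ∞ (ofArr Q) :=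
  contMDiff_of_obj_arr Q.tgt.contMDiff fun i ↦ by
    rw [Fin.fin_one_eq_zero i]; exact contMDiff_id

end Nerve

namespace LieGroupoid

variable (𝒢 : LieGroupoid EM M EG G) {p : ℕ}

/-- The pairs of successive arrows of a string. -/
def consecutive (j : Fin p) (c : 𝒢.level (p + 1)) : 𝒢.level 2 where
  obj := ![c.obj j.castSucc.castSucc, c.obj j.castSucc.succ, c.obj j.succ.succ]
  arr := ![c.arr j.castSucc, c.arr j.succ]
  tgt_arr i := by
    refine Fin.cases (c.tgt_arr _) (fun i ↦ ?_) i
    rw [Fin.fin_one_eq_zero i]; exact c.tgt_arr _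
  src_arr i := by
    refine Fin.cases (c.src_arr _) (fun i ↦ ?_) i
    rw [Fin.fin_one_eq_zero i]; exact c.src_arr _

lemma contMDiff_consecutive (j : Fin p) :
    ContMDiff 𝓘(ℝ, 𝒢.LevelModel (p + 1)) 𝓘(ℝ, 𝒢.LevelModel 2) ∞ (𝒢.consecutive j) :=
  Nerve.contMDiff_of_obj_arr (Nerve.contMDiff_obj _) fun i ↦ by
    refine Fin.cases (Nerve.contMDiff_arr _) (fun i ↦ ?_) i
    rw [Fin.fin_one_eq_zero i]; exact Nerve.contMDiff_arr _

lemma contMDiff_face (i : Fin (p + 2)) :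
    ContMDiff 𝓘(ℝ, 𝒢.LevelModel (p + 1)) 𝓘(ℝ, 𝒢.LevelModel p) ∞ (𝒢.face (p := p) i) := by
  refine Nerve.contMDiff_of_obj_arr (Nerve.contMDiff_obj _) fun j ↦ ?_
  by_cases h1 : (j : ℕ) + 1 < i
  · simp only [face, if_pos h1]
    exact Nerve.contMDiff_arr _
  · by_cases h2 : (j : ℕ) + 1 = i
    · simp only [face, if_neg h1, if_pos h2]
      exact 𝒢.contMDiff_mul.comp (𝒢.contMDiff_consecutive j)
    · simp only [face, if_neg h1, if_neg h2]
      exact Nerve.contMDiff_arr _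

end LieGroupoid

end SmoothNerve

/-! ### The action on sections and the construction of the invariance form -/

section Representations

variable {EM : Type*} [NormedAddCommGroup EM] [NormedSpace ℝ EM]
  {M : Type*} [TopologicalSpace M] [ChartedSpace EM M]
  {EG : Type*} [NormedAddCommGroup EG] [NormedSpace ℝ EG]
  {G : Type*} [TopologicalSpace G] [ChartedSpace EG G]
  {EN : Type*} [NormedAddCommGroup EN] [NormedSpace ℝ EN]
  {N : Type*} [TopologicalSpace N] [ChartedSpace EN N]
  {F : Type*} [NormedAddCommGroup F] [NormedSpace ℝ F]
  {V : M → Type*} [TopologicalSpace (TotalSpace F V)] [∀ x, AddCommGroup (V x)]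
  [∀ x, Module ℝ (V x)] [∀ x, TopologicalSpace (V x)] [∀ x, IsTopologicalAddGroup (V x)]
  [∀ x, ContinuousSMul ℝ (V x)] [FiberBundle F V] [VectorBundle ℝ F V]
  [IsManifold 𝓘(ℝ, EM) ∞ M] [IsManifold 𝓘(ℝ, EG) ∞ G] [IsManifold 𝓘(ℝ, EN) ∞ N]
  [ContMDiffVectorBundle ∞ F V 𝓘(ℝ, EM)]

/-- A section of `f^*V` is smooth if and only if it is smooth as a map to `V`. -/
lemma contMDiffAt_pullback_iff {f : C^∞⟮𝓘(ℝ, EN), N; 𝓘(ℝ, EM), M⟯} {σ : ∀ z, V (f z)} {z : N} :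
    ContMDiffAt 𝓘(ℝ, EN) (𝓘(ℝ, EN).prod 𝓘(ℝ, F)) ∞
      (fun z ↦ TotalSpace.mk' F (E := f *ᵖ V) z (σ z)) z ↔
    ContMDiffAt 𝓘(ℝ, EN) (𝓘(ℝ, EM).prod 𝓘(ℝ, F)) ∞ (fun z ↦ TotalSpace.mk' F (f z) (σ z)) z := by
  rw [Bundle.contMDiffAt_totalSpace, Bundle.contMDiffAt_totalSpace]
  exact ⟨fun h ↦ ⟨f.contMDiff.contMDiffAt, h.2⟩, fun h ↦ ⟨contMDiffAt_id, h.2⟩⟩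

lemma mdifferentiableAt_pullback_iff {f : C^∞⟮𝓘(ℝ, EN), N; 𝓘(ℝ, EM), M⟯} {σ : ∀ z, V (f z)} {z : N} :
    MDifferentiableAt 𝓘(ℝ, EN) (𝓘(ℝ, EN).prod 𝓘(ℝ, F))
      (fun z ↦ TotalSpace.mk' F (E := f *ᵖ V) z (σ z)) z ↔
    MDifferentiableAt 𝓘(ℝ, EN) (𝓘(ℝ, EM).prod 𝓘(ℝ, F))
      (fun z ↦ TotalSpace.mk' F (f z) (σ z)) z := by
  rw [mdifferentiableAt_totalSpace, mdifferentiableAt_totalSpace]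
  exact ⟨fun h ↦ ⟨f.contMDiff.mdifferentiableAt (by simp), h.2⟩, fun h ↦ ⟨mdifferentiableAt_id, h.2⟩⟩

lemma mk_fiberTransport {x y : M} (h : x = y) (w : V x) :
    (TotalSpace.mk' F y (fiberTransport V h w) : TotalSpace F V) = TotalSpace.mk' F x w := by
  subst h; rfl

namespace LieGroupoid.Representation

variable {𝒢 : LieGroupoid EM M EG G} (ρ : 𝒢.Representation F V)

lemma act_eq_transport {g : G} {x x' y y' : M} (hx : 𝒢.src g = x) (hx' : 𝒢.src g = x')
    (hy : 𝒢.tgt g = y) (hy' : 𝒢.tgt g = y') (w : V x) :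
    ρ.act g hx hy w = fiberTransport V (hy'.symm.trans hy)
      (ρ.act g hx' hy' (fiberTransport V (hx.symm.trans hx') w)) := by
  subst hx hx' hy hy'; rfl

/-- Normalizes the end points of the arrow, because smoothness of the action is given only for the
end points `src g` and `tgt g` themselves. -/
lemma mk_act {g : G} {x y : M} (hx : 𝒢.src g = x) (hy : 𝒢.tgt g = y) (w : V x) :
    (TotalSpace.mk' F y (ρ.act g hx hy w) : TotalSpace F V) =
      TotalSpace.mk' F (𝒢.tgt g) (ρ.act g rfl rfl (fiberTransport V hx.symm w)) := by
  subst hx hy; rfl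

variable {k : N → G} {b b' : N → M} {z : N}

lemma contMDiffAt_act (hx : ∀ z, 𝒢.src (k z) = b z) (hy : ∀ z, 𝒢.tgt (k z) = b' z)
    (hk : ContMDiffAt 𝓘(ℝ, EN) 𝓘(ℝ, EG) ∞ k z) {w : ∀ z, V (b z)}
    (hw : ContMDiffAt 𝓘(ℝ, EN) (𝓘(ℝ, EM).prod 𝓘(ℝ, F)) ∞
      (fun z ↦ (TotalSpace.mk' F (b z) (w z) : TotalSpace F V)) z) :
    ContMDiffAt 𝓘(ℝ, EN) (𝓘(ℝ, EM).prod 𝓘(ℝ, F)) ∞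
      (fun z ↦ (TotalSpace.mk' F (b' z) (ρ.act (k z) (hx z) (hy z) (w z)) : TotalSpace F V)) z := by
  rw [funext fun z ↦ ρ.mk_act (hx z) (hy z) (w z)]
  have h1 : ContMDiffAt 𝓘(ℝ, EN) (𝓘(ℝ, EM).prod 𝓘(ℝ, F)) ∞
      (fun z ↦ (TotalSpace.mk' F (𝒢.src (k z)) (fiberTransport V (hx z).symm (w z)) :
        TotalSpace F V)) z := by simpa only [mk_fiberTransport] using hw
  have h2 : ContMDiffAt 𝓘(ℝ, EN) (𝓘(ℝ, EG).prod 𝓘(ℝ, F)) ∞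
      (fun z ↦ (TotalSpace.mk' F (k z) (fiberTransport V (hx z).symm (w z)) :
        TotalSpace F (𝒢.src *ᵖ V))) z := by
    rw [Bundle.contMDiffAt_totalSpace] at h1 ⊢
    exact ⟨hk, h1.2⟩
  exact ρ.contMDiff_act.contMDiffAt.comp z h2

lemma mdifferentiableAt_act (hx : ∀ z, 𝒢.src (k z) = b z) (hy : ∀ z, 𝒢.tgt (k z) = b' z)
    (hk : MDifferentiableAt 𝓘(ℝ, EN) 𝓘(ℝ, EG) k z) {w : ∀ z, V (b z)}
    (hw : MDifferentiableAt 𝓘(ℝ, EN) (𝓘(ℝ, EM).prod 𝓘(ℝ, F))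
      (fun z ↦ (TotalSpace.mk' F (b z) (w z) : TotalSpace F V)) z) :
    MDifferentiableAt 𝓘(ℝ, EN) (𝓘(ℝ, EM).prod 𝓘(ℝ, F))
      (fun z ↦ (TotalSpace.mk' F (b' z) (ρ.act (k z) (hx z) (hy z) (w z)) : TotalSpace F V)) z := by
  rw [funext fun z ↦ ρ.mk_act (hx z) (hy z) (w z)]
  have h1 : MDifferentiableAt 𝓘(ℝ, EN) (𝓘(ℝ, EM).prod 𝓘(ℝ, F))
      (fun z ↦ (TotalSpace.mk' F (𝒢.src (k z)) (fiberTransport V (hx z).symm (w z)) :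
        TotalSpace F V)) z := by simpa only [mk_fiberTransport] using hw
  have h2 : MDifferentiableAt 𝓘(ℝ, EN) (𝓘(ℝ, EG).prod 𝓘(ℝ, F))
      (fun z ↦ (TotalSpace.mk' F (k z) (fiberTransport V (hx z).symm (w z)) :
        TotalSpace F (𝒢.src *ᵖ V))) z := by
    rw [mdifferentiableAt_totalSpace] at h1 ⊢
    exact ⟨hk, h1.2⟩
  exact (ρ.contMDiff_act.mdifferentiableAt (by simp)).comp z h2

lemma contMDiffAt_phi {ξ : ∀ g, (𝒢.tgt *ᵖ V) g} {g : G}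
    (hξ : ContMDiffAt 𝓘(ℝ, EG) (𝓘(ℝ, EG).prod 𝓘(ℝ, F)) ∞ (fun h ↦ TotalSpace.mk' F h (ξ h)) g) :
    ContMDiffAt 𝓘(ℝ, EG) (𝓘(ℝ, EG).prod 𝓘(ℝ, F)) ∞
      (fun h ↦ TotalSpace.mk' F (E := 𝒢.src *ᵖ V) h (ρ.phi h (ξ h))) g :=
  contMDiffAt_pullback_iff.2 (ρ.contMDiffAt_act 𝒢.src_inv 𝒢.tgt_inv 𝒢.inv.contMDiff.contMDiffAt
    (contMDiffAt_pullback_iff.1 hξ))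

/-- The identity that defines `Θ`, like the Leibniz rule, concerns sections differentiable at one
point only, so the smooth version does not suffice. -/
lemma mdifferentiableAt_phi {ξ : ∀ g, (𝒢.tgt *ᵖ V) g} {g : G}
    (hξ : MDifferentiableAt 𝓘(ℝ, EG) (𝓘(ℝ, EG).prod 𝓘(ℝ, F)) (fun h ↦ TotalSpace.mk' F h (ξ h)) g) :
    MDifferentiableAt 𝓘(ℝ, EG) (𝓘(ℝ, EG).prod 𝓘(ℝ, F))
      (fun h ↦ TotalSpace.mk' F (E := 𝒢.src *ᵖ V) h (ρ.phi h (ξ h))) g :=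
  mdifferentiableAt_pullback_iff.2 (ρ.mdifferentiableAt_act 𝒢.src_inv 𝒢.tgt_inv
    (𝒢.inv.contMDiff.mdifferentiableAt (by simp)) (mdifferentiableAt_pullback_iff.1 hξ))

variable [FiniteDimensional ℝ F] (D : CovariantDerivative 𝓘(ℝ, EM) F V)

/-- `φ(∇^t_X ξ) - ∇^s_X φ(ξ)` for a vector field `X` on `G` and a section `ξ` of `t^*V`. -/
def invarianceDefect (g : G) (X : ∀ h : G, TangentSpace 𝓘(ℝ, EG) h) (ξ : ∀ h, (𝒢.tgt *ᵖ V) h) :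
    (𝒢.src *ᵖ V) g :=
  ρ.phi g (covd (D.pullback 𝒢.tgt) ξ g (X g)) -
    covd (D.pullback 𝒢.src) (fun h ↦ ρ.phi h (ξ h)) g (X g)

lemma tensorialAt_invarianceDefect_left (g : G) (ξ : ∀ h, (𝒢.tgt *ᵖ V) h) :
    TensorialAt 𝓘(ℝ, EG) EG (fun X ↦ ρ.invarianceDefect D g X ξ) g where
  smul {f X} _ _ := by
    change ρ.phi g (covd (D.pullback 𝒢.tgt) ξ g (f g • (show EG from X g))) -
      covd (D.pullback 𝒢.src) (fun h ↦ ρ.phi h (ξ h)) g (f g • (show EG from X g)) =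
      f g • (ρ.phi g (covd (D.pullback 𝒢.tgt) ξ g (show EG from X g)) -
      covd (D.pullback 𝒢.src) (fun h ↦ ρ.phi h (ξ h)) g (show EG from X g))
    rw [map_smul, map_smul, map_smul, smul_sub]
  add {X Y} _ _ := by
    change ρ.phi g (covd (D.pullback 𝒢.tgt) ξ g ((show EG from X g) + (show EG from Y g))) -
      covd (D.pullback 𝒢.src) (fun h ↦ ρ.phi h (ξ h)) g ((show EG from X g) + (show EG from Y g)) =
      (ρ.phi g (covd (D.pullback 𝒢.tgt) ξ g (show EG from X g)) -
      covd (D.pullback 𝒢.src) (fun h ↦ ρ.phi h (ξ h)) g (show EG from X g)) +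
      (ρ.phi g (covd (D.pullback 𝒢.tgt) ξ g (show EG from Y g)) -
      covd (D.pullback 𝒢.src) (fun h ↦ ρ.phi h (ξ h)) g (show EG from Y g))
    rw [map_add, map_add, map_add]
    abel

/-- For `f ξ` the Leibniz rules of `∇^t` and `∇^s` both contribute `df(X) φ(ξ)`, the first one after
applying the fibrewise linear map `φ`. These terms cancel in the difference. -/
lemma tensorialAt_invarianceDefect_right (g : G) (X : ∀ h : G, TangentSpace 𝓘(ℝ, EG) h) :
    TensorialAt 𝓘(ℝ, EG) F (fun ξ ↦ ρ.invarianceDefect D g X ξ) g where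
  smul {f ξ} hf hξ := by
    have h1 : covd (D.pullback 𝒢.tgt) (f • ξ) g (X g) =
        f g • covd (D.pullback 𝒢.tgt) ξ g (X g) + mvfderiv 𝓘(ℝ, EG) f g (X g) • ξ g :=
      congr($((D.pullback 𝒢.tgt).isCovariantDerivativeOnUniv.leibniz hξ hf) (X g))
    have h0 : (fun h ↦ ρ.phi h ((f • ξ) h)) = f • fun h ↦ ρ.phi h (ξ h) := by
      funext h; exact map_smul _ _ _
    have h2 : covd (D.pullback 𝒢.src) (fun h ↦ ρ.phi h ((f • ξ) h)) g (X g) =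
        f g • covd (D.pullback 𝒢.src) (fun h ↦ ρ.phi h (ξ h)) g (X g) +
          mvfderiv 𝓘(ℝ, EG) f g (X g) • ρ.phi g (ξ g) := by
      rw [h0]
      exact congr($((D.pullback 𝒢.src).isCovariantDerivativeOnUniv.leibniz
        (ρ.mdifferentiableAt_phi hξ) hf) (X g))
    rw [invarianceDefect, h1, h2, map_add, map_smul, map_smul, invarianceDefect, smul_sub]
    abel
  add {ξ τ} hξ hτ := by
    have h1 : covd (D.pullback 𝒢.tgt) (ξ + τ) g (X g) =
        covd (D.pullback 𝒢.tgt) ξ g (X g) + covd (D.pullback 𝒢.tgt) τ g (X g) :=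
      congr($((D.pullback 𝒢.tgt).isCovariantDerivativeOnUniv.add hξ hτ) (X g))
    have h0 : (fun h ↦ ρ.phi h ((ξ + τ) h)) =
        (fun h ↦ ρ.phi h (ξ h)) + fun h ↦ ρ.phi h (τ h) := by
      funext h; exact map_add _ _ _
    have h2 : covd (D.pullback 𝒢.src) (fun h ↦ ρ.phi h ((ξ + τ) h)) g (X g) =
        covd (D.pullback 𝒢.src) (fun h ↦ ρ.phi h (ξ h)) g (X g) +
          covd (D.pullback 𝒢.src) (fun h ↦ ρ.phi h (τ h)) g (X g) := by
      rw [h0]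
      exact congr($((D.pullback 𝒢.src).isCovariantDerivativeOnUniv.add
        (ρ.mdifferentiableAt_phi hξ) (ρ.mdifferentiableAt_phi hτ)) (X g))
    rw [invarianceDefect, h1, h2, map_add, invarianceDefect, invarianceDefect]
    abel

variable [FiniteDimensional ℝ EG]

/-- The form `Θ(X) ξ = φ(∇^t_X ξ) - ∇^s_X φ(ξ)`. -/
def invarianceForm : 𝒢.HomForm V := fun g ↦
  haveI : IsManifold 𝓘(ℝ, EG) (1 + 1) G := .of_le (n := ∞) (by
    rw [one_add_one_eq_two]; exact ENat.LEInfty.out)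
  haveI : ContMDiffVectorBundle 1 F (𝒢.tgt *ᵖ V) 𝓘(ℝ, EG) := .of_le (n := ∞) (by simp)
  TensorialAt.mkHom₂ (ρ.invarianceDefect D g) g
    (fun ξ _ ↦ ρ.tensorialAt_invarianceDefect_left D g ξ)
    (fun X _ ↦ ρ.tensorialAt_invarianceDefect_right D g X)

lemma isInvarianceForm_invarianceForm : ρ.IsInvarianceForm D (ρ.invarianceForm D) := by
  intro ξ g hξ X
  have : IsManifold 𝓘(ℝ, EG) (1 + 1) G := .of_le (n := ∞) (by
    rw [one_add_one_eq_two]; exact ENat.LEInfty.out)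
  have : ContMDiffVectorBundle 1 F (𝒢.tgt *ᵖ V) 𝓘(ℝ, EG) := .of_le (n := ∞) (by simp)
  -- The form is built from vector fields, so the single vector `X` is first extended to a field
  -- differentiable at `g`.
  have h := TensorialAt.mkHom₂_apply (I := 𝓘(ℝ, EG))
    (fun ξ _ ↦ ρ.tensorialAt_invarianceDefect_left D g ξ)
    (fun X _ ↦ ρ.tensorialAt_invarianceDefect_right D g X)
    (FiberBundle.mdifferentiableAt_extend 𝓘(ℝ, EG) EG X) hξ
  simp only [invarianceDefect, FiberBundle.extend_apply_self] at h
  exact h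

end LieGroupoid.Representation

end Representations

set_option synthInstance.maxHeartbeats 400000 in
set_option maxHeartbeats 1000000 in
lemma ContDiffAt.clm_flip {E F₁ F₂ F₃ : Type*} [NormedAddCommGroup E] [NormedSpace ℝ E]
    [NormedAddCommGroup F₁] [NormedSpace ℝ F₁] [NormedAddCommGroup F₂] [NormedSpace ℝ F₂]
    [NormedAddCommGroup F₃] [NormedSpace ℝ F₃] {f : E → F₁ →L[ℝ] F₂ →L[ℝ] F₃} {u : E}
    (hf : ContDiffAt ℝ ∞ f u) : ContDiffAt ℝ ∞ (fun z ↦ (f z).flip) u :=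
  ContDiffAt.comp u (g := ContinuousLinearMap.flipₗᵢ ℝ F₁ F₂ F₃)
    (LinearIsometryEquiv.contDiff _).contDiffAt hf

/-! ### Uniqueness and smoothness of the invariance form -/

section InvarianceForm

variable {EM : Type*} [NormedAddCommGroup EM] [NormedSpace ℝ EM]
  {M : Type*} [TopologicalSpace M] [ChartedSpace EM M]
  {EG : Type*} [NormedAddCommGroup EG] [NormedSpace ℝ EG]
  {G : Type*} [TopologicalSpace G] [ChartedSpace EG G]
  {F : Type*} [NormedAddCommGroup F] [NormedSpace ℝ F]
  {V : M → Type*} [TopologicalSpace (TotalSpace F V)] [∀ x, AddCommGroup (V x)]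
  [∀ x, Module ℝ (V x)] [∀ x, TopologicalSpace (V x)] [∀ x, IsTopologicalAddGroup (V x)]
  [∀ x, ContinuousSMul ℝ (V x)] [FiberBundle F V] [VectorBundle ℝ F V]
  [IsManifold 𝓘(ℝ, EM) ∞ M] [IsManifold 𝓘(ℝ, EG) ∞ G]
  [ContMDiffVectorBundle ∞ F V 𝓘(ℝ, EM)]

namespace LieGroupoid

variable {𝒢 : LieGroupoid EM M EG G}

/-- The value of a form at an arrow, on vectors of the model space. -/
def HomForm.val (Θ : 𝒢.HomForm V) (g : G) : EG →L[ℝ] V (𝒢.tgt g) →L[ℝ] V (𝒢.src g) := Θ g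

/-- Trivializations of bundles of linear maps act by conjugation: the coordinate vector `a` becomes
a frame section of `t^*V`, `X` passes through the derivative of the inverse chart, and the value is
read in the frame of `s^*V`. -/
lemma HomForm.coord_apply (Θ : 𝒢.HomForm V) {g₀ g : G} (hg : g ∈ (chartAt EG g₀).source)
    (ht : 𝒢.tgt g ∈ (trivializationAt F V (𝒢.tgt g₀)).baseSet)
    (hs : 𝒢.src g ∈ (trivializationAt F V (𝒢.src g₀)).baseSet) (X : EG) (a : F) :
    (trivializationAt (EG →L[ℝ] F →L[ℝ] F)
        (fun g ↦ TangentSpace 𝓘(ℝ, EG) g →L[ℝ] (𝒢.tgt *ᵖ V) g →L[ℝ] (𝒢.src *ᵖ V) g) g₀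
        ⟨g, Θ g⟩).2 X a =
      (trivializationAt F (𝒢.src *ᵖ V) g₀).continuousLinearMapAt ℝ g
        (Θ.val g (tderiv EG EG (chartAt EG g₀).symm (chartAt EG g₀ g) X)
          (frameSection (V := 𝒢.tgt *ᵖ V) g₀ a g)) := by
  have hb : g ∈ (trivializationAt (F →L[ℝ] F)
      (fun g ↦ (𝒢.tgt *ᵖ V) g →L[ℝ] (𝒢.src *ᵖ V) g) g₀).baseSet := ⟨ht, hs⟩
  rw [← symmL_tangent_eq_mfderiv hg]
  exact congr($(continuousLinearMapAt_eq_snd hb (Θ.val g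
    ((trivializationAt EG (TangentSpace 𝓘(ℝ, EG)) g₀).symmL ℝ g X))) a)

namespace Representation

variable [FiniteDimensional ℝ F]

/-- Every vector of a fibre of `t^*V` is the value of a frame section, which is differentiable at
the point, so the defining identity prescribes all values. -/
lemma IsInvarianceForm.eq {ρ : 𝒢.Representation F V} {D : CovariantDerivative 𝓘(ℝ, EM) F V}
    {Θ Θ' : 𝒢.HomForm V} (h : ρ.IsInvarianceForm D Θ) (h' : ρ.IsInvarianceForm D Θ') : Θ' = Θ := by
  funext g
  ext X w
  have hs := frameSection_self (F := F) (W := 𝒢.tgt *ᵖ V) g w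
  have hm := mdifferentiableAt_frameSection (V := 𝒢.tgt *ᵖ V) (EM := EG) g (frameAt F (𝒢.tgt *ᵖ V) g w)
  have h1 := h _ g hm X
  have h2 := h' _ g hm X
  rw [hs] at h1 h2
  rw [h1, h2]

lemma IsInvarianceForm.isSmooth {ρ : 𝒢.Representation F V} {D : CovariantDerivative 𝓘(ℝ, EM) F V}
    (hD : D.IsSmooth) {Θ : 𝒢.HomForm V} (h : ρ.IsInvarianceForm D Θ) : Θ.IsSmooth F := by
  intro g₀
  rw [contMDiffAt_section]
  set f : G → EG →L[ℝ] F →L[ℝ] F := fun g ↦ (trivializationAt (EG →L[ℝ] F →L[ℝ] F)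
    (fun g ↦ TangentSpace 𝓘(ℝ, EG) g →L[ℝ] (𝒢.tgt *ᵖ V) g →L[ℝ] (𝒢.src *ᵖ V) g) g₀ ⟨g, Θ g⟩).2
    with hf
  refine (contMDiffAt_comp_chart_iff (g := fun u ↦ f ((chartAt EG g₀).symm u)) ?_).2 ?_
  · filter_upwards [(chartAt EG g₀).open_source.mem_nhds (mem_chart_source EG g₀)] with z hz
    rw [(chartAt EG g₀).left_inv hz]
  -- After exchanging the arguments, `a` can be fixed first. Then `Θ(·) e_a = φ(∇^t e_a) - ∇^s (φ
  -- e_a)` for the smooth frame section `e_a`, and the covariant derivatives of the smooth sections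
  -- `e_a` and `φ e_a` are smooth in coordinates.
  have hflip : ContDiffAt ℝ ∞ (fun u ↦ (f ((chartAt EG g₀).symm u)).flip) (chartAt EG g₀ g₀) := by
    refine contDiffAt_clm_of_apply fun a ↦ ?_
    have hfr : ContMDiffAt 𝓘(ℝ, EG) (𝓘(ℝ, EG).prod 𝓘(ℝ, F)) ∞
        (fun z ↦ TotalSpace.mk' F z (frameSection (V := 𝒢.tgt *ᵖ V) g₀ a z)) g₀ :=
      contMDiffAt_frameSection (mem_baseSet_trivializationAt F (𝒢.tgt *ᵖ V) g₀) a
    have h1 := (hD.pullback 𝒢.tgt).contDiffAt_covdCoord hfr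
    have h2 := (hD.pullback 𝒢.src).contDiffAt_covdCoord (ρ.contMDiffAt_phi hfr)
    -- The isomorphism `φ` is a smooth fibre map over the identity of `G`; this gives its smooth
    -- matrix.
    have h3 := IsSmoothFiberMap.contDiffAt (EN := EG) (F := F) (f := id) (W := 𝒢.src *ᵖ V)
      (W' := 𝒢.tgt *ᵖ V) (Ψ := ρ.phi) (fun g b ↦ ρ.contMDiffAt_phi (contMDiffAt_frameSection
        (mem_baseSet_trivializationAt F (𝒢.tgt *ᵖ V) g) b)) g₀
    refine ((h3.clm_comp h1).sub h2).congr_of_eventuallyEq ?_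
    filter_upwards [eventually_chart_symm (eventually_mem_baseSet
        (mem_baseSet_trivializationAt F (𝒢.tgt *ᵖ V) g₀)), eventually_chart_symm
        (eventually_mem_baseSet (mem_baseSet_trivializationAt F (𝒢.src *ᵖ V) g₀)),
        (chartAt EG g₀).open_target.mem_nhds ((chartAt EG g₀).map_source (mem_chart_source EG g₀))]
      with u ht hs hu
    ext X
    rw [ContinuousLinearMap.flip_apply, hf, Θ.coord_apply ((chartAt EG g₀).map_target hu) ht hs,
      (chartAt EG g₀).right_inv hu]
    have h4 := h _ _ (mdifferentiableAt_frameSection_of_mem (W := 𝒢.tgt *ᵖ V) ht a)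
      (tderiv EG EG (chartAt EG g₀).symm u X)
    refine (congrArg ((trivializationAt F (𝒢.src *ᵖ V) g₀).continuousLinearMapAt ℝ
      ((chartAt EG g₀).symm u)) h4).trans ?_
    rw [map_sub]
    refine congrArg₂ (· - ·) ?_ rfl
    have h5 := frameSection_continuousLinearMapAt ht
      (covd (D.pullback 𝒢.tgt) (frameSection (V := 𝒢.tgt *ᵖ V) g₀ a) ((chartAt EG g₀).symm u)
        (tderiv EG EG (chartAt EG g₀).symm u X))
    exact congrArg (fun w ↦ (trivializationAt F (𝒢.src *ᵖ V) g₀).continuousLinearMapAt ℝ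
      ((chartAt EG g₀).symm u) (ρ.phi ((chartAt EG g₀).symm u) w)) h5.symm
  exact hflip.clm_flip

end Representation
end LieGroupoid

end InvarianceForm

/-! ### Sections as forms of degree zero -/

section ZeroForms

variable {EN : Type*} [NormedAddCommGroup EN] [NormedSpace ℝ EN]
  {N : Type*} [TopologicalSpace N] [ChartedSpace EN N] [IsManifold 𝓘(ℝ, EN) ∞ N]
  {F : Type*} [NormedAddCommGroup F] [NormedSpace ℝ F]
  {W : N → Type*} [TopologicalSpace (TotalSpace F W)] [∀ x, AddCommGroup (W x)]
  [∀ x, Module ℝ (W x)] [∀ x, TopologicalSpace (W x)] [∀ x, IsTopologicalAddGroup (W x)]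
  [∀ x, ContinuousSMul ℝ (W x)] [FiberBundle F W] [VectorBundle ℝ F W]
  [ContMDiffVectorBundle ∞ F W 𝓘(ℝ, EN)]

variable (EN) in
/-- A section as a form of degree `0`. -/
def VForm.ofSection (σ : ∀ x, W x) : VForm EN W 0 := fun x ↦
  ContinuousAlternatingMap.constOfIsEmpty ℝ EN (Fin 0) (σ x)

lemma VForm.isSmooth_ofSection {σ : ∀ x, W x} (hσ : ContMDiff 𝓘(ℝ, EN) (𝓘(ℝ, EN).prod 𝓘(ℝ, F)) ∞
    (fun z ↦ TotalSpace.mk' F z (σ z))) : (VForm.ofSection EN σ).IsSmooth F := by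
  rw [VForm.isSmooth_iff]
  intro x
  have h1 := (contMDiffAt_section_iff_clm (mem_baseSet_trivializationAt F W x)).1
    (hσ.contMDiffAt (x := x))
  have h2 := (contMDiffAt_comp_chart_iff (g := fun u ↦ (trivializationAt F W x).continuousLinearMapAt
    ℝ ((chartAt EN x).symm u) (σ ((chartAt EN x).symm u))) (by
      filter_upwards [(chartAt EN x).open_source.mem_nhds (mem_chart_source EN x)] with z hz
      rw [(chartAt EN x).left_inv hz])).1 h1
  exact (ContinuousAlternatingMap.constOfIsEmptyLIE ℝ EN F (Fin 0)).contDiff.contDiffAt.comp _ h2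

end ZeroForms

/-! ### The simplicial differential face by face, and its commutator with the covariant derivative
-/

section SimplicialDifferential

variable {EM : Type*} [NormedAddCommGroup EM] [NormedSpace ℝ EM]
  {M : Type*} [TopologicalSpace M] [ChartedSpace EM M]
  {EG : Type*} [NormedAddCommGroup EG] [NormedSpace ℝ EG]
  {G : Type*} [TopologicalSpace G] [ChartedSpace EG G]
  {F : Type*} [NormedAddCommGroup F] [NormedSpace ℝ F]
  {V : M → Type*} [TopologicalSpace (TotalSpace F V)] [∀ x, AddCommGroup (V x)]
  [∀ x, Module ℝ (V x)] [∀ x, TopologicalSpace (V x)] [∀ x, IsTopologicalAddGroup (V x)]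
  [∀ x, ContinuousSMul ℝ (V x)] [FiberBundle F V] [VectorBundle ℝ F V]
  [IsManifold 𝓘(ℝ, EM) ∞ M] [IsManifold 𝓘(ℝ, EG) ∞ G]

namespace LieGroupoid.Representation

variable {𝒢 : LieGroupoid EM M EG G} (ρ : 𝒢.Representation F V) {p q : ℕ}

/-- The map of the values of forms that belongs to the pullback along the face map `f_i`: the
identity for `i ≤ p` and the action of `g_{p+1}⁻¹` for `i = p + 1`. -/
def faceFiber (i : Fin (p + 2)) (c : 𝒢.level (p + 1)) :
    (𝒢.levelBase p *ᵖ V) (𝒢.face i c) →L[ℝ] (𝒢.levelBase (p + 1) *ᵖ V) c :=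
  Fin.lastCases (motive := fun i ↦ V (𝒢.face i c).base →L[ℝ] V c.base)
    (ρ.act (𝒢.inv (c.arr (Fin.last p))) ((𝒢.src_inv _).trans (𝒢.tgt_last c))
      ((𝒢.tgt_inv _).trans (𝒢.src_last c)))
    (fun i ↦ fiberTransport V (𝒢.base_face_castSucc i c)) i

lemma faceFiber_castSucc (i : Fin (p + 1)) (c : 𝒢.level (p + 1)) :
    ρ.faceFiber i.castSucc c = fiberTransport V (𝒢.base_face_castSucc i c) :=
  Fin.lastCases_castSucc ..

lemma faceFiber_last (c : 𝒢.level (p + 1)) :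
    ρ.faceFiber (Fin.last (p + 1)) c = ρ.act (𝒢.inv (c.arr (Fin.last p)))
      ((𝒢.src_inv _).trans (𝒢.tgt_last c)) ((𝒢.tgt_inv _).trans (𝒢.src_last c)) :=
  Fin.lastCases_last ..

/-- The summand of `δ α` that belongs to the face map `f_i`, without its sign. -/
def faceForm (i : Fin (p + 2)) (α : 𝒢.NerveForm V p q) : 𝒢.NerveForm V (p + 1) q := fun c ↦
  (ρ.faceFiber i c).compContinuousAlternatingMap (facePullback i α c)

lemma faceForm_val (i : Fin (p + 2)) (α : 𝒢.NerveForm V p q) (c : 𝒢.level (p + 1))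
    (w : Fin q → 𝒢.LevelModel (p + 1)) :
    (ρ.faceForm i α).val c w = ρ.faceFiber i c (α.val (𝒢.face i c) fun j ↦
      tderiv (𝒢.LevelModel (p + 1)) (𝒢.LevelModel p) (𝒢.face i) c (w j)) := rfl

/-- Treats the last face on the same footing as the others, so that smoothness and `d^∇` can be
handled one summand at a time. -/
lemma delta_val (α : 𝒢.NerveForm V p q) (c : 𝒢.level (p + 1))
    (w : Fin q → 𝒢.LevelModel (p + 1)) :
    (ρ.delta α).val c w = ∑ i : Fin (p + 2), (-1 : ℝ) ^ (i : ℕ) • (ρ.faceForm i α).val c w := by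
  rw [Fin.sum_univ_castSucc]
  simp only [faceForm_val, faceFiber_castSucc, faceFiber_last, Fin.val_castSucc, Fin.val_last]
  have h : (ρ.delta α).val c w = (∑ i : Fin (p + 1), (-1 : ℝ) ^ (i : ℕ) •
    (fiberTransport V (𝒢.base_face_castSucc i c)).compContinuousAlternatingMap
      (facePullback i.castSucc α c)) w +
    (-1 : ℝ) ^ (p + 1) •
    (ρ.act (𝒢.inv (c.arr (Fin.last p))) ((𝒢.src_inv _).trans (𝒢.tgt_last c))
      ((𝒢.tgt_inv _).trans (𝒢.src_last c))).compContinuousAlternatingMap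
      (facePullback (Fin.last (p + 1)) α c) w := rfl
  refine h.trans (congrArg (· + _) ?_)
  exact ContinuousAlternatingMap.sum_apply _ _

variable [ContMDiffVectorBundle ∞ F V 𝓘(ℝ, EM)]

lemma isSmoothFiberMap_faceFiber (i : Fin (p + 2)) :
    IsSmoothFiberMap (𝒢.LevelModel (p + 1)) F (W := 𝒢.levelBase (p + 1) *ᵖ V)
      (W' := 𝒢.levelBase p *ᵖ V) (𝒢.face (p := p) i) (ρ.faceFiber i) := by
  intro c a
  have h1 : ContMDiffAt 𝓘(ℝ, 𝒢.LevelModel (p + 1)) (𝓘(ℝ, EM).prod 𝓘(ℝ, F)) ∞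
      (fun z ↦ (TotalSpace.mk' F (𝒢.face i z).base
        (frameSection (V := 𝒢.levelBase p *ᵖ V) (𝒢.face i c) a (𝒢.face i z)) : TotalSpace F V)) c :=
    (contMDiffAt_pullback_iff.1 (contMDiffAt_frameSection (mem_baseSet_trivializationAt F
      (𝒢.levelBase p *ᵖ V) (𝒢.face i c)) a)).comp c (𝒢.contMDiff_face i).contMDiffAt
  refine contMDiffAt_pullback_iff.2 ?_
  revert h1
  refine Fin.lastCases ?_ (fun i ↦ ?_) i <;> intro h1
  · simp only [faceFiber_last]
    exact ρ.contMDiffAt_act _ _ (𝒢.inv.contMDiff.contMDiffAt.comp c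
      (Nerve.contMDiff_arr_last (Q := 𝒢.toSubmersiveQuiver)).contMDiffAt) h1
  · simp only [faceFiber_castSucc]
    refine h1.congr_of_eventuallyEq (Filter.Eventually.of_forall fun z ↦ ?_)
    exact mk_fiberTransport (𝒢.base_face_castSucc i z) _

variable [FiniteDimensional ℝ F]

lemma isSmooth_faceForm (i : Fin (p + 2)) {α : 𝒢.NerveForm V p q} (hα : α.IsSmooth F) :
    (ρ.faceForm i α).IsSmooth F :=
  hα.map (𝒢.contMDiff_face i) (ρ.isSmoothFiberMap_faceFiber i) (ρ.faceForm_val i α)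

lemma isSmooth_delta {α : 𝒢.NerveForm V p q} (hα : α.IsSmooth F) : (ρ.delta α).IsSmooth F :=
  VForm.IsSmooth.linearCombination (ρ.delta_val α) fun i ↦ ρ.isSmooth_faceForm i hα

variable {D : CovariantDerivative 𝓘(ℝ, EM) F V}

lemma covd_eq_of_eq {x y : M} (h : x = y) (η : ∀ x, V x) (X : EM) :
    fiberTransport V h (covd D η x X) = covd D η y X := by
  subst h; rfl

/-- These faces keep the last object, so the connection at level `p + 1` is pulled back from level
`p` along `f_i` and the identification of the fibres is parallel. The correction term of
`extCovDeriv_map` vanishes. -/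
lemma covd_faceFiber_castSucc (i : Fin (p + 1)) (c : 𝒢.level (p + 1))
    (w : (𝒢.levelBase p *ᵖ V) (𝒢.face i.castSucc c)) (X : 𝒢.LevelModel (p + 1)) :
    covd (D.pullback (𝒢.levelBase (p + 1))) (fun z ↦ ρ.faceFiber i.castSucc z
      (frameSection (V := 𝒢.levelBase p *ᵖ V) (𝒢.face i.castSucc c)
        (frameAt F (𝒢.levelBase p *ᵖ V) (𝒢.face i.castSucc c) w) (𝒢.face i.castSucc z))) c X =
      ρ.faceFiber i.castSucc c (covTerm (D.pullback (𝒢.levelBase p)) (𝒢.face i.castSucc c) w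
        (tderiv (𝒢.LevelModel (p + 1)) (𝒢.LevelModel p) (𝒢.face i.castSucc) c X)) := by
  simp only [faceFiber_castSucc]
  exact covd_pullback_comp D (b := 𝒢.levelBase (p + 1)) (b' := 𝒢.levelBase p)
    (𝒢.contMDiff_face i.castSucc) (𝒢.base_face_castSucc i)
    (mdifferentiableAt_frameSection_of_mem (mem_baseSet_trivializationAt F
      (𝒢.levelBase p *ᵖ V) _) _) X

/-- The value of `(pr_{p+1})^*Θ` on the tangent vector `X` and the vector `w`. -/
def lastTerm (Θ : 𝒢.HomForm V) (c : 𝒢.level (p + 1)) (X : 𝒢.LevelModel (p + 1))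
    (w : V (𝒢.face (Fin.last (p + 1)) c).base) : (𝒢.levelBase (p + 1) *ᵖ V) c :=
  fiberTransport V (𝒢.src_last c) (Θ.val (c.arr (Fin.last p))
    (tderiv (𝒢.LevelModel (p + 1)) EG (fun c : 𝒢.level (p + 1) ↦ c.arr (Fin.last p)) c X)
    (fiberTransport V (𝒢.tgt_last c).symm w))

/-- The last object of `f_{p+1}(c)` is the target of `g_{p+1}`, and the fibre map is `pr^*φ`. Its
failure to be parallel is the pullback along `pr` of the failure of `φ`, which is `-Θ`. -/
lemma covd_faceFiber_last {Θ : 𝒢.HomForm V} (hΘ : ρ.IsInvarianceForm D Θ) (c : 𝒢.level (p + 1))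
    (w : V (𝒢.face (Fin.last (p + 1)) c).base) (X : 𝒢.LevelModel (p + 1)) :
    covd (D.pullback (𝒢.levelBase (p + 1))) (fun z ↦ ρ.faceFiber (Fin.last (p + 1)) z
      (frameSection (V := 𝒢.levelBase p *ᵖ V) (𝒢.face (Fin.last (p + 1)) c)
        (frameAt F (𝒢.levelBase p *ᵖ V) (𝒢.face (Fin.last (p + 1)) c) w)
        (𝒢.face (Fin.last (p + 1)) z))) c X =
      ρ.faceFiber (Fin.last (p + 1)) c (covTerm (D.pullback (𝒢.levelBase p))
        (𝒢.face (Fin.last (p + 1)) c) w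
        (tderiv (𝒢.LevelModel (p + 1)) (𝒢.LevelModel p) (𝒢.face (Fin.last (p + 1))) c X)) -
      lastTerm Θ c X w := by
  let f := 𝒢.face (p := p) (Fin.last (p + 1))
  let pr : 𝒢.level (p + 1) → G := fun c ↦ c.arr (Fin.last p)
  have hprs : ContMDiff 𝓘(ℝ, 𝒢.LevelModel (p + 1)) 𝓘(ℝ, EG) ∞ pr := Nerve.contMDiff_arr_last
  have hfs := 𝒢.contMDiff_face (p := p) (Fin.last (p + 1))
  set a := frameAt F V (f c).base w with ha
  -- A single local section of `V`: its pullback along `base ∘ f` is the frame section of the claim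
  -- near `c`, and its pullback `ξ` along `t` can be inserted into the definition of `Θ`.
  set η : ∀ x, V x := frameSection (f c).base a with hη
  set ξ : ∀ g, (𝒢.tgt *ᵖ V) g := fun g ↦ η (𝒢.tgt g) with hξ
  have hηm : ∀ x, x = (f c).base → MDifferentiableAt 𝓘(ℝ, EM) (𝓘(ℝ, EM).prod 𝓘(ℝ, F))
      (fun z ↦ TotalSpace.mk' F z (η z)) x := by
    rintro _ rfl
    exact mdifferentiableAt_frameSection_of_mem (mem_baseSet_trivializationAt F V _) a
  have hηc : η (f c).base = w := frameSection_self _ w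
  have hξm : MDifferentiableAt 𝓘(ℝ, EG) (𝓘(ℝ, EG).prod 𝓘(ℝ, F))
      (fun h ↦ TotalSpace.mk' F h (ξ h)) (pr c) :=
    mdifferentiableAt_pullback_section (hηm _ (𝒢.tgt_last c))
  have hξc : ξ (pr c) = fiberTransport V (𝒢.tgt_last c).symm w := by
    rw [← hηc, fiberTransport_section]
  have hφξ := ρ.mdifferentiableAt_phi hξm
  -- the section on the left agrees near `c` with the pullback of `φ ξ` along `pr`
  have hloc : ∀ z, ρ.faceFiber (Fin.last (p + 1)) z (η (f z).base) =
      fiberTransport V (𝒢.src_last z) (ρ.phi (pr z) (ξ (pr z))) := by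
    intro z
    rw [faceFiber_last]
    refine (ρ.act_eq_transport _ (𝒢.src_inv _) _ (𝒢.tgt_inv _) _).trans ?_
    exact congrArg (fun y ↦ fiberTransport V (𝒢.src_last z) (ρ.phi (pr z) y))
      (fiberTransport_section η _)
  have hev : ∀ᶠ z in nhds c, frameSection (V := 𝒢.levelBase p *ᵖ V) (f c)
      (frameAt F (𝒢.levelBase p *ᵖ V) (f c) w) (f z) = η (f z).base := by
    filter_upwards [((𝒢.levelBase p).contMDiff.continuous.comp hfs.continuous).continuousAt.eventually
      (eventually_mem_baseSet (mem_baseSet_trivializationAt F V (f c).base))] with z hz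
    exact frameSection_pullback (f := 𝒢.levelBase p) hz a
  have h1 : covd (D.pullback (𝒢.levelBase (p + 1))) (fun z ↦ ρ.faceFiber (Fin.last (p + 1)) z
      (frameSection (V := 𝒢.levelBase p *ᵖ V) (f c)
        (frameAt F (𝒢.levelBase p *ᵖ V) (f c) w) (f z))) c X =
      fiberTransport V (𝒢.src_last c) (covd (D.pullback 𝒢.src) (fun h ↦ ρ.phi h (ξ h)) (pr c)
        (tderiv (𝒢.LevelModel (p + 1)) EG pr c X)) := by
    refine Eq.trans ?_ (covd_pullback_comp D (b := 𝒢.levelBase (p + 1)) (b' := 𝒢.src) hprs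
      𝒢.src_last hφξ X)
    have hm := (ρ.isSmoothFiberMap_faceFiber (Fin.last (p + 1)) c
      (frameAt F (𝒢.levelBase p *ᵖ V) (f c) w)).mdifferentiableAt (by simp)
    have hev2 : ∀ᶠ z in nhds c, ρ.faceFiber (Fin.last (p + 1)) z
      (frameSection (V := 𝒢.levelBase p *ᵖ V) (f c)
        (frameAt F (𝒢.levelBase p *ᵖ V) (f c) w) (f z)) =
        fiberTransport V (𝒢.src_last z) (ρ.phi (pr z) (ξ (pr z))) := by
      filter_upwards [hev] with z hz
      exact (congrArg (ρ.faceFiber (Fin.last (p + 1)) z) hz).trans (hloc z)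
    refine congr($(covd_congr (D.pullback (𝒢.levelBase (p + 1))) hm
      (hm.congr_of_eventuallyEq ?_) hev2) X)
    filter_upwards [hev2] with z hz
    exact congrArg _ hz.symm
  -- The covariant derivatives in `h2` and `h4` both reduce to the derivative of `η` on `M`, in the
  -- directions of `base ∘ f` and of `t ∘ pr`. These are the same map.
  have h2 : covTerm (D.pullback (𝒢.levelBase p)) (f c) w
        (tderiv (𝒢.LevelModel (p + 1)) (𝒢.LevelModel p) f c X) =
      covd D η (f c).base (tderiv (𝒢.LevelModel (p + 1)) EM (fun z ↦ (f z).base) c X) := by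
    have h3 : tderiv (𝒢.LevelModel (p + 1)) EM (fun z ↦ (f z).base) c X = _ :=
      tderiv_comp (𝒢.LevelModel (p + 1)) (𝒢.LevelModel p) EM c
        ((𝒢.levelBase p).contMDiff.mdifferentiableAt (by simp))
        (hfs.mdifferentiableAt (by simp)) X
    rw [h3]
    refine Eq.trans ?_ (covd_pullback_section D (𝒢.levelBase p) (hηm (f c).base rfl) _)
    refine congr($(covd_congr (D.pullback (𝒢.levelBase p)) (mdifferentiableAt_frameSection_of_mem
      (mem_baseSet_trivializationAt F (𝒢.levelBase p *ᵖ V) (f c)) _)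
      (mdifferentiableAt_pullback_section (hηm (f c).base rfl)) ?_) _)
    filter_upwards [(𝒢.levelBase p).contMDiff.continuous.continuousAt.eventually
      (eventually_mem_baseSet (mem_baseSet_trivializationAt F V (f c).base))] with z hz
    exact frameSection_pullback (f := 𝒢.levelBase p) hz a
  have h4 : covd (D.pullback 𝒢.tgt) ξ (pr c) (tderiv (𝒢.LevelModel (p + 1)) EG pr c X) =
      covd D η (𝒢.tgt (pr c)) (tderiv (𝒢.LevelModel (p + 1)) EM (fun z ↦ (f z).base) c X) := by
    refine (covd_pullback_section D 𝒢.tgt (hηm _ (𝒢.tgt_last c)) _).trans ?_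
    have h3 := tderiv_comp (𝒢.LevelModel (p + 1)) EG EM c
        (𝒢.tgt.contMDiff.mdifferentiableAt (by simp)) (hprs.mdifferentiableAt (by simp)) X
    rw [← h3, funext 𝒢.tgt_last]
  have h5 : Θ.val (pr c) (tderiv (𝒢.LevelModel (p + 1)) EG pr c X) (ξ (pr c)) =
      ρ.phi (pr c) (covd (D.pullback 𝒢.tgt) ξ (pr c) (tderiv (𝒢.LevelModel (p + 1)) EG pr c X)) -
        covd (D.pullback 𝒢.src) (fun h ↦ ρ.phi h (ξ h)) (pr c)
          (tderiv (𝒢.LevelModel (p + 1)) EG pr c X) := hΘ ξ (pr c) hξm _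
  have h6 : ∀ Y, ρ.faceFiber (Fin.last (p + 1)) c (covd D η (f c).base Y) =
      fiberTransport V (𝒢.src_last c) (ρ.phi (pr c) (covd D η (𝒢.tgt (pr c)) Y)) := by
    intro Y
    rw [faceFiber_last]
    refine (ρ.act_eq_transport _ (𝒢.src_inv _) _ (𝒢.tgt_inv _) _).trans ?_
    exact congrArg (fun y ↦ fiberTransport V (𝒢.src_last c) (ρ.phi (pr c) y))
      (covd_eq_of_eq _ η Y)
  have h7 : lastTerm Θ c X w =
      fiberTransport V (𝒢.src_last c) (ρ.phi (pr c) (covd (D.pullback 𝒢.tgt) ξ (pr c)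
        (tderiv (𝒢.LevelModel (p + 1)) EG pr c X))) -
      fiberTransport V (𝒢.src_last c) (covd (D.pullback 𝒢.src) (fun h ↦ ρ.phi h (ξ h)) (pr c)
        (tderiv (𝒢.LevelModel (p + 1)) EG pr c X)) :=
    ((congrArg (fun y ↦ fiberTransport V (𝒢.src_last c) (Θ.val (pr c)
      (tderiv (𝒢.LevelModel (p + 1)) EG pr c X) y)) hξc.symm).trans
      (congrArg (fiberTransport V (𝒢.src_last c)) h5)).trans (map_sub _ _ _)
  refine h1.trans (Eq.trans ?_ (congrArg
    (fun y ↦ ρ.faceFiber (Fin.last (p + 1)) c y - lastTerm Θ c X w) h2.symm))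
  have h8 := (h6 (tderiv (𝒢.LevelModel (p + 1)) EM (fun z ↦ (f z).base) c X)).trans
    (congrArg (fun y ↦ fiberTransport V (𝒢.src_last c) (ρ.phi (pr c) y)) h4.symm)
  exact ((congrArg₂ (· - ·) h8 h7).trans (sub_sub_cancel _ _)).symm

lemma dNabla_faceForm_castSucc (i : Fin (p + 1)) {α : 𝒢.NerveForm V p q} (hα : α.IsSmooth F)
    (c : 𝒢.level (p + 1)) (X : Fin (q + 1) → 𝒢.LevelModel (p + 1)) :
    (𝒢.dNabla D (ρ.faceForm i.castSucc α)).val c X =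
      (ρ.faceForm i.castSucc (𝒢.dNabla D α)).val c X := by
  refine (extCovDeriv_map (D.pullback (𝒢.levelBase (p + 1))) (D.pullback (𝒢.levelBase p)) hα
    (𝒢.contMDiff_face i.castSucc) (ρ.isSmoothFiberMap_faceFiber i.castSucc)
    (ρ.faceForm_val i.castSucc α) c X).trans ?_
  refine (congrArg _ (Finset.sum_eq_zero fun j _ ↦ ?_)).trans (add_zero _)
  exact (congrArg _ (sub_eq_zero_of_eq (ρ.covd_faceFiber_castSucc i c _ _))).trans (smul_zero _)

lemma dNabla_faceForm_last {Θ : 𝒢.HomForm V} (hΘ : ρ.IsInvarianceForm D Θ)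
    {α : 𝒢.NerveForm V p q} (hα : α.IsSmooth F)
    (c : 𝒢.level (p + 1)) (X : Fin (q + 1) → 𝒢.LevelModel (p + 1)) :
    (𝒢.dNabla D (ρ.faceForm (Fin.last (p + 1)) α)).val c X =
      (ρ.faceForm (Fin.last (p + 1)) (𝒢.dNabla D α)).val c X -
        ∑ i : Fin (q + 1), (-1 : ℝ) ^ (i : ℕ) • lastTerm Θ c (X i)
          (α.val (𝒢.face (Fin.last (p + 1)) c) fun j ↦ tderiv (𝒢.LevelModel (p + 1))
            (𝒢.LevelModel p) (𝒢.face (Fin.last (p + 1))) c (i.removeNth X j)) := by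
  refine (extCovDeriv_map (D.pullback (𝒢.levelBase (p + 1))) (D.pullback (𝒢.levelBase p)) hα
    (𝒢.contMDiff_face (Fin.last (p + 1))) (ρ.isSmoothFiberMap_faceFiber (Fin.last (p + 1)))
    (ρ.faceForm_val (Fin.last (p + 1)) α) c X).trans ?_
  refine Eq.trans ?_ (sub_eq_add_neg _ _).symm
  refine congrArg _ ?_
  rw [← Finset.sum_neg_distrib]
  refine Finset.sum_congr rfl fun j _ ↦ ?_
  refine Eq.trans ?_ (smul_neg _ _)
  refine congrArg _ ?_
  refine (congrArg (· - _) (ρ.covd_faceFiber_last hΘ c _ _)).trans ?_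
  exact sub_sub_cancel_left _ _

/-- Only the last summands differ, and `(-1)^(p+1) * (-1) = (-1)^p`; this is the sign of the
commutator. -/
lemma alternating_sum_sub {E : Type*} [AddCommGroup E] [Module ℝ E] {a b : Fin (p + 2) → E} {w : E}
    (h : ∀ i : Fin (p + 1), a i.castSucc = b i.castSucc)
    (h' : a (Fin.last (p + 1)) = b (Fin.last (p + 1)) - w) :
    ∑ i : Fin (p + 2), (-1 : ℝ) ^ (i : ℕ) • a i - ∑ i : Fin (p + 2), (-1 : ℝ) ^ (i : ℕ) • b i =
      (-1 : ℝ) ^ p • w := by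
  rw [Fin.sum_univ_castSucc (n := p + 1), Fin.sum_univ_castSucc (n := p + 1), h']
  simp only [h, Fin.val_last]
  rw [add_sub_add_left_eq_sub, ← smul_sub, sub_sub_cancel_left, pow_succ, mul_neg_one, neg_smul,
    smul_neg, neg_neg]

/-- The commutator of `d^∇` and `δ`. -/
lemma dNabla_delta_sub {Θ : 𝒢.HomForm V} (hΘ : ρ.IsInvarianceForm D Θ)
    {α : 𝒢.NerveForm V p q} (hα : α.IsSmooth F)
    (c : 𝒢.level (p + 1)) (X : Fin (q + 1) → 𝒢.LevelModel (p + 1)) :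
    ((𝒢.dNabla D (ρ.delta α)).val c X - (ρ.delta (𝒢.dNabla D α)).val c X : V c.base) =
      (-1 : ℝ) ^ p • wedgeLast Θ α c X := by
  have h1 : (𝒢.dNabla D (ρ.delta α)).val c X = ∑ i : Fin (p + 2), (-1 : ℝ) ^ (i : ℕ) •
      (𝒢.dNabla D (ρ.faceForm i α)).val c X :=
    extCovDeriv_linearCombination (D.pullback (𝒢.levelBase (p + 1))) (ρ.delta_val α)
      (fun i ↦ ρ.isSmooth_faceForm i hα) c X
  exact (congrArg₂ (· - ·) h1 (ρ.delta_val (𝒢.dNabla D α) c X)).trans (alternating_sum_sub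
    (fun i ↦ ρ.dNabla_faceForm_castSucc i hα c X) (ρ.dNabla_faceForm_last hΘ hα c X))

end LieGroupoid.Representation

end SimplicialDifferential

/-! ### Invariance of the connection and the cochain property -/

section Invariance

variable {EM : Type*} [NormedAddCommGroup EM] [NormedSpace ℝ EM]
  {M : Type*} [TopologicalSpace M] [ChartedSpace EM M]
  {EG : Type*} [NormedAddCommGroup EG] [NormedSpace ℝ EG]
  {G : Type*} [TopologicalSpace G] [ChartedSpace EG G]
  {F : Type*} [NormedAddCommGroup F] [NormedSpace ℝ F]
  {V : M → Type*} [TopologicalSpace (TotalSpace F V)] [∀ x, AddCommGroup (V x)]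
  [∀ x, Module ℝ (V x)] [∀ x, TopologicalSpace (V x)] [∀ x, IsTopologicalAddGroup (V x)]
  [∀ x, ContinuousSMul ℝ (V x)] [FiberBundle F V] [VectorBundle ℝ F V]
  [IsManifold 𝓘(ℝ, EM) ∞ M] [IsManifold 𝓘(ℝ, EG) ∞ G]
  [ContMDiffVectorBundle ∞ F V 𝓘(ℝ, EM)]

lemma extCovDeriv_zero {EN : Type*} [NormedAddCommGroup EN] [NormedSpace ℝ EN]
    {N : Type*} [TopologicalSpace N] [ChartedSpace EN N] [IsManifold 𝓘(ℝ, EN) ∞ N]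
    {W : N → Type*} [TopologicalSpace (TotalSpace F W)] [∀ x, AddCommGroup (W x)]
    [∀ x, Module ℝ (W x)] [∀ x, TopologicalSpace (W x)] [∀ x, IsTopologicalAddGroup (W x)]
    [∀ x, ContinuousSMul ℝ (W x)] [FiberBundle F W] [VectorBundle ℝ F W]
    [ContMDiffVectorBundle ∞ F W 𝓘(ℝ, EN)] [FiniteDimensional ℝ F]
    (D : CovariantDerivative 𝓘(ℝ, EN) F W) {q : ℕ} :
    extCovDeriv D (0 : VForm EN W q) = 0 :=
  -- The zero form is the empty linear combination.
  VForm.val_injective fun x w ↦ (extCovDeriv_linearCombination (ι := Empty) (c := Empty.elim)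
    (β := fun i ↦ i.elim) D (γ := 0) (fun _ _ ↦ rfl) (fun i ↦ i.elim) x w)

namespace LieGroupoid.Representation

variable {𝒢 : LieGroupoid EM M EG G} (ρ : 𝒢.Representation F V) [FiniteDimensional ℝ F]
  {D : CovariantDerivative 𝓘(ℝ, EM) F V} {Θ : 𝒢.HomForm V}

lemma isCochainMap_of_invariant (hΘ : ρ.IsInvarianceForm D 0) : ρ.IsCochainMap D := by
  intro p q α hα
  refine VForm.val_injective fun c X ↦ sub_eq_zero.1 ((ρ.dNabla_delta_sub hΘ hα c X).trans ?_)
  refine (congrArg _ (Finset.sum_eq_zero fun i _ ↦ ?_)).trans (smul_zero (A := V c.base) _)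
  exact (congrArg _ (map_zero (fiberTransport V (𝒢.src_last c)))).trans (smul_zero (A := V c.base) _)

lemma IsCochainMap.isMultiplicative_dNabla {ρ : 𝒢.Representation F V} (h : ρ.IsCochainMap D)
    (hD : D.IsSmooth) {q : ℕ} {α : 𝒢.NerveForm V 1 q} (hα : ρ.IsMultiplicative α) :
    ρ.IsMultiplicative (𝒢.dNabla D α) := by
  refine ⟨hα.1.extCovDeriv (hD.pullback _), (h 1 q α hα.1).symm.trans ?_⟩
  rw [hα.2]
  exact extCovDeriv_zero _

/-- The map from an arrow to its string of length `1` is a section of `pr_1`, so every tangent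
vector of `G` lifts to level `1`, and pulling `Θ` back along `pr_1` loses nothing. -/
lemma lastTerm_ofArr (Θ : 𝒢.HomForm V) (g : G) (X : EG)
    (w : V (𝒢.face (Fin.last 1) (Nerve.ofArr 𝒢.toSubmersiveQuiver g)).base) :
    lastTerm Θ (Nerve.ofArr 𝒢.toSubmersiveQuiver g)
      (tderiv EG (𝒢.LevelModel 1) (Nerve.ofArr 𝒢.toSubmersiveQuiver) g X) w =
      Θ.val g X w := by
  have h1 : tderiv (𝒢.LevelModel 1) EG (fun c : 𝒢.level 1 ↦ c.arr (Fin.last 0))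
      (Nerve.ofArr 𝒢.toSubmersiveQuiver g)
      (tderiv EG (𝒢.LevelModel 1) (Nerve.ofArr 𝒢.toSubmersiveQuiver) g X) = X :=
    (tderiv_comp EG (𝒢.LevelModel 1) EG g (Nerve.contMDiff_arr_last.mdifferentiableAt (by simp))
      (Nerve.contMDiff_ofArr.mdifferentiableAt (by simp)) X).symm.trans
      congr($(mfderiv_id (I := 𝓘(ℝ, EG)) (x := g)) X)
  exact congrArg (fun Y ↦ Θ.val g Y w) h1

/-- The case `p = q = 0` suffices: there the commutator at an arrow `g`, for a section `τ` of `V`,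
is `Θ(X)` applied to `τ` at `t(g)`, and this value can be prescribed. -/
lemma IsCochainMap.eq_zero [FiniteDimensional ℝ EM] [T2Space M] {ρ : 𝒢.Representation F V}
    (h : ρ.IsCochainMap D) (hΘ : ρ.IsInvarianceForm D Θ) : Θ = 0 := by
  funext g
  refine ContinuousLinearMap.ext fun X ↦ ContinuousLinearMap.ext fun v ↦ ?_
  obtain ⟨τ, hτ, hτ'⟩ := exists_contMDiff_section_eq_frameSection (EN := EM) (W := V) (𝒢.tgt g)
    (frameAt F V (𝒢.tgt g) v)
  have hv : τ (𝒢.tgt g) = v := hτ'.self_of_nhds.symm.trans (frameSection_self (𝒢.tgt g) v)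
  set c := Nerve.ofArr 𝒢.toSubmersiveQuiver g
  -- Forms in `Ω^{0,0}` have to be smooth on all of `M`; this is why a global section through `v`
  -- was needed.
  set α : 𝒢.NerveForm V 0 0 := VForm.ofSection (𝒢.LevelModel 0)
    (W := 𝒢.levelBase 0 *ᵖ V) fun c ↦ τ (𝒢.levelBase 0 c)
  have hα : α.IsSmooth F := VForm.isSmooth_ofSection fun c ↦
    contMDiffAt_pullback_section (f := 𝒢.levelBase 0) hτ.contMDiffAt
  set Y : Fin 1 → 𝒢.LevelModel 1 := fun _ ↦
    tderiv EG (𝒢.LevelModel 1) (Nerve.ofArr 𝒢.toSubmersiveQuiver) g X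
  have h0 := ρ.dNabla_delta_sub hΘ hα c Y
  have h1 : wedgeLast Θ α c Y = 0 := by
    refine (one_smul ℝ _).symm.trans (Eq.trans (congrArg (· • _) (pow_zero (-1 : ℝ)).symm)
      (h0.symm.trans (sub_eq_zero_of_eq ?_)))
    exact congr(VForm.val $(h 0 0 α hα) c Y)
  have h2 : wedgeLast Θ α c Y = Θ.val g X (τ (𝒢.tgt g)) := by
    refine (Fin.sum_univ_one _).trans (Eq.trans (one_smul ℝ _) ?_)
    exact lastTerm_ofArr Θ g X (τ (𝒢.tgt g))
  have h3 := h2.symm.trans h1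
  rw [hv] at h3
  exact h3

end LieGroupoid.Representation

end Invariance

end

/-! ### The main theorem -/

theorem mainTheorem1
    {EM : Type*} [NormedAddCommGroup EM] [NormedSpace ℝ EM] [FiniteDimensional ℝ EM]
    {M : Type*} [TopologicalSpace M] [T2Space M] [ChartedSpace EM M] [IsManifold 𝓘(ℝ, EM) ∞ M]
    {EG : Type*} [NormedAddCommGroup EG] [NormedSpace ℝ EG] [FiniteDimensional ℝ EG]
    {G : Type*} [TopologicalSpace G] [ChartedSpace EG G] [IsManifold 𝓘(ℝ, EG) ∞ G]
    {F : Type*} [NormedAddCommGroup F] [NormedSpace ℝ F] [FiniteDimensional ℝ F]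
    {V : M → Type*} [TopologicalSpace (TotalSpace F V)] [∀ x, AddCommGroup (V x)]
    [∀ x, Module ℝ (V x)] [∀ x, TopologicalSpace (V x)] [∀ x, IsTopologicalAddGroup (V x)]
    [∀ x, ContinuousSMul ℝ (V x)] [FiberBundle F V] [VectorBundle ℝ F V]
    [ContMDiffVectorBundle ∞ F V 𝓘(ℝ, EM)]
    (𝒢 : LieGroupoid EM M EG G) (ρ : 𝒢.Representation F V)
    (D : CovariantDerivative 𝓘(ℝ, EM) F V) [D.ContMDiffCovariantDerivative ∞] :
    (∀ (p q : ℕ) (α : 𝒢.NerveForm V p q), α.IsSmooth F →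
      (ρ.delta α).IsSmooth F ∧ (𝒢.dNabla D α).IsSmooth F) ∧
    ∃ Θ : 𝒢.HomForm V,
      Θ.IsSmooth F ∧
      ρ.IsInvarianceForm D Θ ∧
      (∀ Θ' : 𝒢.HomForm V, ρ.IsInvarianceForm D Θ' → Θ' = Θ) ∧
      (∀ (p q : ℕ) (α : 𝒢.NerveForm V p q), α.IsSmooth F →
        ∀ (c : 𝒢.level (p + 1)) (X : Fin (q + 1) → TangentSpace 𝓘(ℝ, 𝒢.LevelModel (p + 1)) c),
          (𝒢.dNabla D (ρ.delta α) - ρ.delta (𝒢.dNabla D α)) c X =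
            (-1 : ℝ) ^ p • LieGroupoid.Representation.wedgeLast Θ α c X) ∧
      (ρ.IsCochainMap D ↔ Θ = 0) ∧
      (Θ = 0 → ∀ (q : ℕ) (α : 𝒢.NerveForm V 1 q),
        ρ.IsMultiplicative α → ρ.IsMultiplicative (𝒢.dNabla D α)) := by
  have hD : D.IsSmooth := D.isSmooth_of_contMDiff
  have hΘ := ρ.isInvarianceForm_invarianceForm D
  have hc : ρ.invarianceForm D = 0 → ρ.IsCochainMap D := fun h ↦
    ρ.isCochainMap_of_invariant (h ▸ hΘ)
  exact ⟨fun p q α hα ↦ ⟨ρ.isSmooth_delta hα, hα.extCovDeriv (hD.pullback _)⟩,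
    ρ.invarianceForm D, LieGroupoid.Representation.IsInvarianceForm.isSmooth hD hΘ, hΘ,
    fun Θ' h ↦ hΘ.eq h, fun p q α hα c X ↦ ρ.dNabla_delta_sub hΘ hα c X,
    ⟨fun h ↦ h.eq_zero hΘ, hc⟩, fun h q α hα ↦ (hc h).isMultiplicative_dNabla hD hα⟩
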